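/- Let $\mathcal R$ be the hyperfinite II$_1$ factor, i.e. the von Neumann algebra generated by the GNS representation of $\bigcup_n M_{2^n}(\mathbb C)$ (with the embeddings $A\mapsto \mathrm{diag}(A,A)$) with respect to its normalized trace, and let $\tau$ be its trace. On $M_p(\mathbb C)$, $p\ge 1$, let $\tau=\frac1p\mathrm{Tr}$. Write $\mathcal M_1$ for the operator norm unit ball of $\mathcal M$. *Moments.* For positive integers $n,d$ let $m_1,\dots,m_L$ be the $*$-monomials (words in $x_1,x_1^*,\dots,x_n,x_n^*$) of total degree at most $d$, and for a tuple $\vec a$ put $\mu_{n,d}(\vec a)=(\tau(m_1(\vec a)),\dots,\tau(m_L(\vec a)))\in\mathbb C^L$, where $\mathbb C^L$ carries the Euclidean norm. Let $X(n,d)=\mu_{n,d}(\mathcal R_1^n)$ and $X(n,d,p)=\mu_{n,d}(M_p(\mathbb C)_1^n)$. *Universal theory.* Fix a computable dense system of connectives: a sequence of continuous functions $u_i:\mathbb R^{m_i}\to\mathbb R$ which is computable (uniformly in $i$, the arity $m_i$, rational approximations of any precision to the values at rational points, and moduli of uniform continuity on the boxes $[-N,N]^{m_i}$ are computable) and such that,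 for every $m$, its members of arity $m$ are dense in $C(\mathbb R^m,\mathbb R)$ for uniform convergence on compact sets. A universal sentence is an expression $\sigma=\sup_{x_1}\cdots\sup_{x_n}u_i(\varphi_1,\dots,\varphi_{m_i})$ in which each $\varphi_j$ is $\mathrm{Re}\,\tau(p_j)$ or $\mathrm{Im}\,\tau(p_j)$ for a $*$-polynomial $p_j(x_1,\dots,x_n)$ with coefficients in $\mathbb Q+i\mathbb Q$ that satisfies $p_j(\mathcal M_1^n)\subseteq\mathcal M_1$ for every von Neumann algebra $\mathcal M$, and such that $u_i(\varphi_1,\dots,\varphi_{m_i})$ takes only nonnegative values on $\mathcal M_1^n$ for every tracial von Neumann algebra $(\mathcal M,\tau)$ (that is, $\tau$ is a faithful normal tracial state). Its value $\sigma^{\mathcal R}$ is the supremum of $u_i(\varphi_1(\vec a),\dots,\varphi_{m_i}(\vec a))$ over $\vec a\in\mathcal R_1^n$. The universal theory of $\mathcal R$ is computable if there is an algorithm which, upon input a universal sentence $\sigma$ and a rational $\epsilon>0$, returns $a,b\in\mathbb Q$ with $a<b$, $b-a<\epsilon$ and $\sigma^{\mathcal R}\in(a,b)$. **Theorem.** For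 every computable dense system of connectives, the following statements are equivalent: 1. The universal theory of $\mathcal R$ is computable. 2. There is a computable function $F:\mathbb N^3\to\mathbb N$ such that, for all positive integers $n,d,k$, $F(n,d,k)$ is positive and $X(n,d,F(n,d,k))$ is $\frac1k$-dense in $X(n,d)$, that is, for every $s\in X(n,d)$ there is $t\in X(n,d,F(n,d,k))$ with $\|t-s\|<\frac1k$. -/

import Mathlib

open Filter Topology

namespace MomentApprox

noncomputable section

/-! ## Matrix algebras and the hyperfinite II₁ factor -/

/-- The normalized trace on the `p × p` complex matrices (only used for `p ≥ 1`). -/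
def ntr (p : ℕ) : Matrix (Fin p) (Fin p) ℂ →ₗ[ℂ] ℂ :=
  (p : ℂ)⁻¹ • Matrix.traceLinearMap (Fin p) ℂ ℂ

/-- The identification of two consecutive blocks of length `2 ^ n` with one of length `2 ^ (n+1)`. -/
def blockEquiv (n : ℕ) : Fin (2 ^ n) ⊕ Fin (2 ^ n) ≃ Fin (2 ^ (n + 1)) :=
  finSumFinEquiv.trans (finCongr (by rw [pow_succ, mul_two]))

/-- The embedding `A ↦ diag(A, A)` of the `2 ^ n × 2 ^ n` matrices into the
`2 ^ (n+1) × 2 ^ (n+1)` matrices. -/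
def dbl (n : ℕ) :
    Matrix (Fin (2 ^ n)) (Fin (2 ^ n)) ℂ →⋆ₐ[ℂ]
      Matrix (Fin (2 ^ (n + 1))) (Fin (2 ^ (n + 1))) ℂ where
  toFun A := Matrix.reindex (blockEquiv n) (blockEquiv n) (Matrix.fromBlocks A 0 0 A)
  map_one' := by simp
  map_mul' A B := by
    simp only [Matrix.reindex_apply, Matrix.submatrix_mul_equiv, Matrix.fromBlocks_multiply]
    simp
  map_zero' := by simp
  map_add' A B := by
    have h : Matrix.fromBlocks (A + B) 0 0 (A + B) =
        Matrix.fromBlocks A 0 0 A + Matrix.fromBlocks B 0 0 B := by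
      rw [Matrix.fromBlocks_add]; simp
    rw [h]; rfl
  commutes' r := by
    rw [Algebra.algebraMap_eq_smul_one, Algebra.algebraMap_eq_smul_one]
    have h : Matrix.fromBlocks (r • (1 : Matrix (Fin (2 ^ n)) (Fin (2 ^ n)) ℂ)) 0 0
        (r • (1 : Matrix (Fin (2 ^ n)) (Fin (2 ^ n)) ℂ)) = r • 1 := by
      rw [← Matrix.fromBlocks_one, Matrix.fromBlocks_smul]; simp
    rw [h]
    change Matrix.reindexLinearEquiv ℂ ℂ (blockEquiv n) (blockEquiv n) (r • 1) = _
    rw [map_smul]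
    simp
  map_star' A := by
    simp [Matrix.star_eq_conjTranspose, Matrix.conjTranspose_submatrix,
      Matrix.fromBlocks_conjTranspose]

/-- The `*`-algebra of sequences `(x_n)`, `x_n` a `2 ^ n × 2 ^ n` matrix, that are eventually
coherent, `x_{n+1} = diag(x_n, x_n)`.  The union `⋃ M_{2^n}(ℂ)` of the tower is the quotient of
this algebra by the ideal of the sequences that are eventually `0`; these are null vectors for the
inner product below, so that the GNS construction performs this quotient. -/
def tower : StarSubalgebra ℂ (∀ n : ℕ, Matrix (Fin (2 ^ n)) (Fin (2 ^ n)) ℂ) where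
  carrier := {x | ∀ᶠ n in atTop, x (n + 1) = dbl n (x n)}
  mul_mem' {x y} hx hy := by
    filter_upwards [hx, hy] with n h1 h2
    simp [h1, h2]
  add_mem' {x y} hx hy := by
    filter_upwards [hx, hy] with n h1 h2
    simp [h1, h2]
  algebraMap_mem' r := by
    refine Eventually.of_forall fun n => ?_
    exact ((dbl n).toAlgHom.commutes r).symm
  star_mem' {x} hx := by
    filter_upwards [hx] with n h1
    simp only [Pi.star_apply]
    rw [h1, map_star]

lemma ntr_dbl (n : ℕ) (A : Matrix (Fin (2 ^ n)) (Fin (2 ^ n)) ℂ) :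
    ntr (2 ^ (n + 1)) (dbl n A) = ntr (2 ^ n) A := by
  have h : Matrix.trace (dbl n A) = 2 * Matrix.trace A := by
    have h1 : Matrix.trace (dbl n A) = Matrix.trace (Matrix.fromBlocks A 0 0 A) := by
      change ∑ i, (Matrix.fromBlocks A 0 0 A) ((blockEquiv n).symm i) ((blockEquiv n).symm i) = _
      exact Equiv.sum_comp (blockEquiv n).symm fun i => (Matrix.fromBlocks A 0 0 A) i i
    rw [h1, two_mul]
    simp [Matrix.trace, Fintype.sum_sum_type]
  simp only [ntr, LinearMap.smul_apply, Matrix.traceLinearMap_apply, h, smul_eq_mul]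
  push_cast
  rw [pow_succ]
  field_simp

/-- The trace of an element of the tower: the eventually constant value of the normalized
traces. -/
def towerTr (x : tower) : ℂ := limUnder atTop fun n => ntr (2 ^ n) (x.1 n)

lemma eventually_towerTr (x : tower) : ∀ᶠ n in atTop, ntr (2 ^ n) (x.1 n) = towerTr x := by
  obtain ⟨N, hN⟩ := eventually_atTop.1 x.2
  have hc : ∀ n ≥ N, ntr (2 ^ n) (x.1 n) = ntr (2 ^ N) (x.1 N) := by
    intro n hn
    induction n, hn using Nat.le_induction with
    | base => rfl
    | succ n hn ih => rw [hN n hn, ntr_dbl, ih]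
  have hlim : towerTr x = ntr (2 ^ N) (x.1 N) := by
    apply Tendsto.limUnder_eq
    exact tendsto_const_nhds.congr' (eventually_atTop.2 ⟨N, fun n hn => (hc n hn).symm⟩)
  exact eventually_atTop.2 ⟨N, fun n hn => by rw [hlim, hc n hn]⟩

lemma towerTr_add (x y : tower) : towerTr (x + y) = towerTr x + towerTr y := by
  obtain ⟨n, h1, h2, h3⟩ :=
    ((eventually_towerTr (x + y)).and ((eventually_towerTr x).and (eventually_towerTr y))).exists
  rw [← h1, ← h2, ← h3, ← map_add]; rfl

lemma towerTr_smul (c : ℂ) (x : tower) : towerTr (c • x) = c * towerTr x := by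
  obtain ⟨n, h1, h2⟩ := ((eventually_towerTr (c • x)).and (eventually_towerTr x)).exists
  rw [← h1, ← h2, ← smul_eq_mul, ← map_smul]; rfl

lemma towerTr_star (x : tower) : towerTr (star x) = star (towerTr x) := by
  obtain ⟨n, h1, h2⟩ := ((eventually_towerTr (star x)).and (eventually_towerTr x)).exists
  rw [← h1, ← h2]
  have : (star x).1 n = (x.1 n).conjTranspose := rfl
  simp [ntr, this, Matrix.trace_conjTranspose]

open scoped ComplexOrder in
lemma ntr_star_mul_self_nonneg (p : ℕ) (A : Matrix (Fin p) (Fin p) ℂ) :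
    0 ≤ (ntr p (star A * A)).re := by
  have h := (Matrix.posSemidef_conjTranspose_mul_self A).trace_nonneg
  have h2 : (0 : ℝ) ≤ (Matrix.trace (A.conjTranspose * A)).re := (Complex.le_def.1 h).1
  have : ntr p (star A * A) = ((p : ℝ)⁻¹ : ℝ) * Matrix.trace (A.conjTranspose * A) := by
    simp [ntr, Matrix.star_eq_conjTranspose]
  rw [this, Complex.re_ofReal_mul]
  positivity

/-- The tower with the GNS pre-inner product `⟪x, y⟫ = τ(x* y)`. -/
def PreL2 : Type := tower

instance : AddCommGroup PreL2 := inferInstanceAs (AddCommGroup tower)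
instance : Module ℂ PreL2 := inferInstanceAs (Module ℂ tower)

/-- The element of the tower, viewed as a vector. -/
def toVec : tower ≃ₗ[ℂ] PreL2 := LinearEquiv.refl ℂ _

abbrev preL2Core : PreInnerProductSpace.Core ℂ PreL2 where
  inner x y := towerTr (star (toVec.symm x) * toVec.symm y)
  conj_inner_symm x y := by
    rw [starRingEnd_apply, ← towerTr_star, star_mul, star_star]
  re_inner_nonneg x := by
    obtain ⟨n, h⟩ := (eventually_towerTr (star (toVec.symm x) * toVec.symm x)).exists
    rw [← h]
    exact ntr_star_mul_self_nonneg _ _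
  add_left x y z := by
    rw [map_add, star_add, add_mul, towerTr_add]
  smul_left x y r := by
    rw [map_smul, star_smul, smul_mul_assoc, towerTr_smul]; rfl

instance : SeminormedAddCommGroup PreL2 :=
  InnerProductSpace.Core.toSeminormedAddCommGroup (c := preL2Core)

instance : InnerProductSpace ℂ PreL2 := InnerProductSpace.ofCore preL2Core

lemma preL2_norm_sq (x : PreL2) :
    ‖x‖ ^ 2 = (towerTr (star (toVec.symm x) * toVec.symm x)).re :=
  norm_sq_eq_re_inner (𝕜 := ℂ) x

section

open scoped Matrix.Norms.L2Operator MatrixOrder ComplexOrder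

lemma ntr_mul_le (p : ℕ) (A X : Matrix (Fin p) (Fin p) ℂ) :
    (ntr p (star (A * X) * (A * X))).re ≤ ‖A‖ ^ 2 * (ntr p (star X * X)).re := by
  have h : star X * (star A * A) * X ≤ ‖star A * A‖ • (star X * X) :=
    CStarAlgebra.star_left_conjugate_le_norm_smul
  have h1 := (Matrix.le_iff.1 h).trace_nonneg
  have h2 := (Complex.le_def.1 h1).1
  rw [CStarRing.norm_star_mul_self, Matrix.trace_sub, Matrix.trace_smul] at h2
  have e : star (A * X) * (A * X) = star X * (star A * A) * X := by
    simp only [star_mul, mul_assoc]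
  have r : ∀ B : Matrix (Fin p) (Fin p) ℂ, (ntr p B).re = (p : ℝ)⁻¹ * (Matrix.trace B).re := by
    intro B
    have : ntr p B = ((p : ℝ)⁻¹ : ℝ) * Matrix.trace B := by simp [ntr]
    rw [this, Complex.re_ofReal_mul]
  rw [r, r, e]
  simp only [Complex.zero_re, Complex.sub_re, Complex.smul_re, smul_eq_mul] at h2
  have hp : (0 : ℝ) ≤ (p : ℝ)⁻¹ := by positivity
  nlinarith

lemma exists_leftMul_bound (a : tower) :
    ∃ C : ℝ, ∀ x : tower, ‖toVec (a * x)‖ ≤ C * ‖toVec x‖ := by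
  obtain ⟨N, hN⟩ := eventually_atTop.1 a.2
  have hb : ∀ n ≥ N, ‖a.1 n‖ ≤ ‖a.1 N‖ := by
    intro n hn
    induction n, hn using Nat.le_induction with
    | base => exact le_rfl
    | succ n hn ih =>
      rw [hN n hn]
      exact (NonUnitalStarAlgHom.norm_apply_le (dbl n) (a.1 n)).trans ih
  refine ⟨‖a.1 N‖, fun x => ?_⟩
  rw [← sq_le_sq₀ (norm_nonneg _) (by positivity), mul_pow, preL2_norm_sq, preL2_norm_sq]
  simp only [LinearEquiv.symm_apply_apply]
  obtain ⟨n, hn, h1, h2⟩ := ((eventually_ge_atTop N).and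
    ((eventually_towerTr (star (a * x) * (a * x))).and (eventually_towerTr (star x * x)))).exists
  rw [← h1, ← h2]
  refine (ntr_mul_le _ (a.1 n) (x.1 n)).trans ?_
  have h3 := ntr_star_mul_self_nonneg _ (x.1 n)
  have h4 : ‖a.1 n‖ ^ 2 ≤ ‖a.1 N‖ ^ 2 := pow_le_pow_left₀ (norm_nonneg _) (hb n hn) 2
  exact mul_le_mul_of_nonneg_right h4 h3

end

/-- The GNS Hilbert space `L²(⋃ M_{2^n}(ℂ), τ)`. -/
abbrev L2 : Type := UniformSpace.Completion PreL2

/-- Left multiplication on the pre-Hilbert space. -/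
def leftMul (a : tower) : PreL2 →L[ℂ] PreL2 :=
  LinearMap.mkContinuousOfExistsBound
    (toVec.toLinearMap ∘ₗ LinearMap.mulLeft ℂ a ∘ₗ toVec.symm.toLinearMap)
    (by
      obtain ⟨C, hC⟩ := exists_leftMul_bound a
      exact ⟨C, fun x => by simpa using hC (toVec.symm x)⟩)

/-- The GNS representation `π_τ`. -/
def gns (a : tower) : L2 →L[ℂ] L2 := (leftMul a).completion

/-- The hyperfinite II₁ factor `𝓡`: the von Neumann algebra (double commutant) generated by the
image of the GNS representation of the tower of the algebras `M_{2^n}(ℂ)`.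
(`StarSubalgebra.centralizer ℂ S` is the commutant of `S ∪ S*`.) -/
def hyperfinite : VonNeumannAlgebra L2 where
  toStarSubalgebra :=
    StarSubalgebra.centralizer ℂ
      (StarSubalgebra.centralizer ℂ (Set.range gns) : Set (L2 →L[ℂ] L2))
  centralizer_centralizer' := by simp [StarSubalgebra.centralizer]

/-- The trace on `𝓡`: the vector state `x ↦ ⟪1̂, x 1̂⟫` (the inner product is linear in the second
variable). -/
def hyperfiniteTr : hyperfinite.toStarSubalgebra →ₗ[ℂ] ℂ where
  toFun x := inner ℂ ((toVec 1 : PreL2) : L2) ((x : L2 →L[ℂ] L2) ((toVec 1 : PreL2) : L2))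
  map_add' x y := by simp [inner_add_right]
  map_smul' c x := by simp [inner_smul_right]

/-! ## Tracial von Neumann algebras -/

/-- `τ` is a trace on the von Neumann algebra `M`: a faithful normal tracial state, where normal
means that the restriction to the operator norm unit ball is continuous for the weak operator
topology. -/
structure IsTrace {H : Type} [NormedAddCommGroup H] [InnerProductSpace ℂ H] [CompleteSpace H]
    (M : VonNeumannAlgebra H) (τ : M.toStarSubalgebra →ₗ[ℂ] ℂ) : Prop where
  map_one : τ 1 = 1
  nonneg : ∀ x, 0 ≤ (τ (star x * x)).re ∧ (τ (star x * x)).im = 0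
  tracial : ∀ x y, τ (x * y) = τ (y * x)
  faithful : ∀ x, τ (star x * x) = 0 → x = 0
  normal : @Continuous {x : M.toStarSubalgebra // ‖x‖ ≤ 1} ℂ
    (TopologicalSpace.induced
      (fun x => (ContinuousLinearMapWOT.ofCLM (x.1 : H →L[ℂ] H) : H →WOT[ℂ] H)) inferInstance)
    inferInstance (fun x => τ x.1)

/-! ## Moments -/

/-- The value of a `*`-monomial: a word whose letters `(i, false)` and `(i, true)` stand for
`x_i` and `x_i*`. -/
def evalWord {ι A : Type} [Monoid A] [Star A] (a : ι → A) (w : List (ι × Bool)) : A :=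
  (w.map fun l => if l.2 then star (a l.1) else a l.1).prod

/-- The `*`-monomials in `x_1, …, x_n` of total degree at most `d`. -/
abbrev Monomial (n d : ℕ) : Type := Σ j : Fin (d + 1), (Fin j → Fin n × Bool)

/-- The moment vector `(τ(m(a)))_m`, in `ℂ^L` with its Euclidean norm. -/
def moments {A : Type} [Monoid A] [Star A] (τ : A → ℂ) (n d : ℕ) (a : Fin n → A) :
    EuclideanSpace ℂ (Monomial n d) :=
  WithLp.toLp 2 fun m => τ (evalWord a (List.ofFn m.2))

/-- `X(n,d)`: the moment vectors of the `n`-tuples from the unit ball of `𝓡`. -/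
def momentSet (n d : ℕ) : Set (EuclideanSpace ℂ (Monomial n d)) :=
  {s | ∃ a : Fin n → hyperfinite.toStarSubalgebra,
    (∀ i, ‖a i‖ ≤ 1) ∧ moments hyperfiniteTr n d a = s}

section

open scoped Matrix.Norms.L2Operator

/-- `X(n,d,p)`: the moment vectors of the `n`-tuples from the operator norm unit ball of
`M_p(ℂ)`. -/
def matrixMomentSet (n d p : ℕ) : Set (EuclideanSpace ℂ (Monomial n d)) :=
  {s | ∃ a : Fin n → Matrix (Fin p) (Fin p) ℂ, (∀ i, ‖a i‖ ≤ 1) ∧ moments (ntr p) n d a = s}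

end

/-! ## The language -/

/-- Codes of rational numbers: `(z, k)` codes `z / (k + 1)`. -/
abbrev RatCode : Type := ℤ × ℕ

def ratVal (q : RatCode) : ℚ := q.1 / (q.2 + 1)

/-- Codes of `*`-polynomials with coefficients in `ℚ + iℚ`: formal sums of pairs of a coefficient
(real and imaginary part) and a `*`-monomial. -/
abbrev PolyCode : Type := List ((RatCode × RatCode) × List (ℕ × Bool))

def coeffVal (c : RatCode × RatCode) : ℂ := ⟨(ratVal c.1 : ℝ), (ratVal c.2 : ℝ)⟩

/-- Only the variables `x_0, …, x_{n-1}` occur. -/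
def PolyCode.VarsLT (p : PolyCode) (n : ℕ) : Prop := ∀ t ∈ p, ∀ l ∈ t.2, l.1 < n

def evalPoly {A : Type} [Ring A] [StarRing A] [Algebra ℂ A] (p : PolyCode) (a : ℕ → A) : A :=
  (p.map fun t => coeffVal t.1 • evalWord a t.2).sum

/-- Extend a tuple by `0`; the additional variables never occur in the formulas considered. -/
def extendTuple {A : Type} [Zero A] {n : ℕ} (a : Fin n → A) (i : ℕ) : A :=
  if h : i < n then a ⟨i, h⟩ else 0

/-- `p` is a function symbol of the language: a `*`-polynomial in `n` variables that maps
`n`-tuples from the unit ball to the unit ball in every von Neumann algebra. -/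
def IsFunctionSymbol (n : ℕ) (p : PolyCode) : Prop :=
  p.VarsLT n ∧
  ∀ (H : Type) [NormedAddCommGroup H] [InnerProductSpace ℂ H] [CompleteSpace H]
    (M : VonNeumannAlgebra H) (a : Fin n → M.toStarSubalgebra),
    (∀ i, ‖a i‖ ≤ 1) → ‖evalPoly p (extendTuple a)‖ ≤ 1

/-- A computable dense system of connectives: a sequence of continuous functions
`u_i : ℝ^{m_i} → ℝ` that is computable (the arities are computable, the values at rational points
can be computed to any precision, and there is a computable modulus of uniform continuity on the
boxes `[-N, N]^{m_i}`, all uniformly in `i`), such that for every `m` the members of arity `m` are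
dense in `C(ℝ^m, ℝ)` for the topology of uniform convergence on compact sets. -/
structure Connectives where
  arity : ℕ → ℕ
  fn : ∀ i : ℕ, (Fin (arity i) → ℝ) → ℝ
  computable_arity : Computable arity
  computable_values : ∃ v : (ℕ × List RatCode) × ℕ → RatCode, Computable v ∧
    ∀ (i : ℕ) (q : List RatCode) (k : ℕ) (hq : q.length = arity i),
      |fn i (fun j => (ratVal (q.get (Fin.cast hq.symm j)) : ℝ)) - (ratVal (v ((i, q), k)) : ℝ)|
        ≤ 1 / ((k : ℝ) + 1)
  computable_modulus : ∃ δ : (ℕ × ℕ) × ℕ → ℕ, Computable δ ∧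
    ∀ (i N k : ℕ) (x y : Fin (arity i) → ℝ),
      (∀ j, |x j| ≤ N) → (∀ j, |y j| ≤ N) →
      (∀ j, |x j - y j| ≤ 1 / ((δ ((i, N), k) : ℝ) + 1)) →
      |fn i x - fn i y| ≤ 1 / ((k : ℝ) + 1)
  dense : ∀ (m : ℕ) (f : (Fin m → ℝ) → ℝ), Continuous f →
    ∀ K : Set (Fin m → ℝ), IsCompact K → ∀ ε : ℝ, 0 < ε →
      ∃ (i : ℕ) (h : arity i = m), ∀ x ∈ K, |fn i (fun j => x (Fin.cast h j)) - f x| < ε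

/-- Codes of basic formulas: `(false, p)` codes `tr_Re(p)` and `(true, p)` codes `tr_Im(p)`. -/
abbrev BasicCode : Type := Bool × PolyCode

/-- Codes of sentences: `((n, i), [φ_1, …, φ_m])` codes
`sup_{x_1} ⋯ sup_{x_n} u_i(φ_1, …, φ_m)`, where `u_i` is the `i`-th connective. -/
abbrev SentenceCode : Type := (ℕ × ℕ) × List BasicCode

section

variable {A : Type} [Ring A] [StarRing A] [Algebra ℂ A]

def evalBasic (τ : A → ℂ) (φ : BasicCode) (a : ℕ → A) : ℝ :=
  if φ.1 then (τ (evalPoly φ.2 a)).im else (τ (evalPoly φ.2 a)).re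

/-- The value of the quantifier-free part of `σ` at the tuple `a`. -/
def evalMatrix (C : Connectives) (τ : A → ℂ) (σ : SentenceCode) (a : Fin σ.1.1 → A) : ℝ :=
  C.fn σ.1.2 fun j => ((σ.2.map fun φ => evalBasic τ φ (extendTuple a))[(j : ℕ)]?).getD 0

end

/-- `σ` codes a universal sentence: the number of basic formulas is the arity of the connective,
every polynomial is a function symbol, and the quantifier-free part takes only nonnegative values
(on the unit balls of all tracial von Neumann algebras). -/
structure IsUniversalSentence (C : Connectives) (σ : SentenceCode) : Prop where
  length_eq : σ.2.length = C.arity σ.1.2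
  symbols : ∀ φ ∈ σ.2, IsFunctionSymbol σ.1.1 φ.2
  nonneg : ∀ (H : Type) [NormedAddCommGroup H] [InnerProductSpace ℂ H] [CompleteSpace H]
    (M : VonNeumannAlgebra H) (τ : M.toStarSubalgebra →ₗ[ℂ] ℂ), IsTrace M τ →
    ∀ a : Fin σ.1.1 → M.toStarSubalgebra, (∀ i, ‖a i‖ ≤ 1) → 0 ≤ evalMatrix C τ σ a

/-- The value of the universal sentence `σ` in `(M, τ)`. -/
def sentenceVal (C : Connectives) {H : Type} [NormedAddCommGroup H] [InnerProductSpace ℂ H]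
    [CompleteSpace H] (M : VonNeumannAlgebra H) (τ : M.toStarSubalgebra →ₗ[ℂ] ℂ)
    (σ : SentenceCode) : ℝ :=
  sSup {r | ∃ a : Fin σ.1.1 → M.toStarSubalgebra, (∀ i, ‖a i‖ ≤ 1) ∧ evalMatrix C τ σ a = r}

/-- The universal theory of `(M, τ)` is computable: there is an algorithm that, upon input a
universal sentence `σ` and a rational `ε > 0`, halts and returns rationals `a < b` with
`b - a < ε` and `σ^M ∈ (a, b)`. -/
def UniversalTheoryComputable (C : Connectives) {H : Type} [NormedAddCommGroup H]
    [InnerProductSpace ℂ H] [CompleteSpace H] (M : VonNeumannAlgebra H)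
    (τ : M.toStarSubalgebra →ₗ[ℂ] ℂ) : Prop :=
  ∃ f : SentenceCode × RatCode →. RatCode × RatCode, Partrec f ∧
    ∀ (σ : SentenceCode) (ε : RatCode), IsUniversalSentence C σ → 0 < ratVal ε →
      ∃ ab ∈ f (σ, ε),
        ratVal ab.1 < ratVal ab.2 ∧ ratVal ab.2 - ratVal ab.1 < ratVal ε ∧
        (ratVal ab.1 : ℝ) < sentenceVal C M τ σ ∧ sentenceVal C M τ σ < (ratVal ab.2 : ℝ)

end

end MomentApprox

/-! Moments of contractions in 𝓡 and moments of contractions in matrix algebras approximate each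
other. A tuple in M_p is copied along the diagonal into some M_{2^m}, with a small zero block left
over, and M_{2^m} sits inside 𝓡 (`exists_hyperfinite_near`). Conversely, projecting L² onto the
vectors of M_{2^m} compresses elements of 𝓡 to matrices, and the moments of the compressions
converge (`tendsto_compression`). Since X(n,d) is totally bounded, one m serves all tuples
(`exists_uniform_approx`). So a function F exists in any case, and only its computability is at
stake.

The matrix side is effective: up to a given error, the unit ball of M_p is a finite net of matrices
B with rational entries, selected by the decidable test Tr((B*B)^(pM)) ≤ 1. The test forces ‖B‖ ≤ 1
(`norm_le_one_of_inNet`), and grid approximations of slightly shrunk contractions pass it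
(`exists_inNet`).

From F to the theory: F supplies a matrix size at which the moments are dense up to a precision
dictated by the coefficients of the sentence and the modulus of its connective. The maximum of the
quantifier-free part over a fine net then approximates the value in 𝓡 (`abs_sentenceVal_sub_le`).

From the theory to F: one would like to ask for the supremum over 𝓡 of the distance from the moments
to the finitely many moment vectors of a net. Only the listed connectives may occur, and the
algorithm may be called only on sentences known to be universal. Therefore triples (p, M, i) are
searched for which finitely many evaluations of u_i on a grid prove that u_i is nonnegative on the
cube and large away from the net. If the theory then reports a small value, the net is dense enough
(`exists_of_certificate`). Density of the connectives, applied to an affine function of the distance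
to a good net, shows that the search succeeds (`exists_certificate`). -/

namespace MomentApprox

/-! ## Computability of arithmetic on codes -/

section Computability

attribute [fun_prop] Primrec Computable
attribute [fun_prop] Primrec.id Primrec.const Primrec.comp Primrec.pair Primrec.to_comp
attribute [fun_prop] Computable.id Computable.const Computable.comp Computable.pair

variable {α β γ : Type*} [Primcodable α] [Primcodable β] [Primcodable γ]

@[fun_prop] lemma primrec_fst {f : α → β × γ} (hf : Primrec f) : Primrec fun x => (f x).1 :=
  Primrec.fst.comp hf

@[fun_prop] lemma primrec_snd {f : α → β × γ} (hf : Primrec f) : Primrec fun x => (f x).2 :=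
  Primrec.snd.comp hf

@[fun_prop] lemma primrec_nat_add {f g : α → ℕ} (hf : Primrec f) (hg : Primrec g) :
    Primrec fun a => f a + g a := Primrec.nat_add.comp hf hg

@[fun_prop] lemma primrec_nat_sub {f g : α → ℕ} (hf : Primrec f) (hg : Primrec g) :
    Primrec fun a => f a - g a := Primrec.nat_sub.comp hf hg

@[fun_prop] lemma primrec_nat_mul {f g : α → ℕ} (hf : Primrec f) (hg : Primrec g) :
    Primrec fun a => f a * g a := Primrec.nat_mul.comp hf hg

@[fun_prop] lemma primrec_nat_div {f g : α → ℕ} (hf : Primrec f) (hg : Primrec g) :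
    Primrec fun a => f a / g a := Primrec.nat_div.comp hf hg

@[fun_prop] lemma primrec_nat_mod {f g : α → ℕ} (hf : Primrec f) (hg : Primrec g) :
    Primrec fun a => f a % g a := Primrec.nat_mod.comp hf hg

@[fun_prop] lemma primrec_nat_pow {f g : α → ℕ} (hf : Primrec f) (hg : Primrec g) :
    Primrec fun a => f a ^ g a :=
  (Primrec₂.unpaired'.1 Nat.Primrec.pow).comp hf hg

@[fun_prop] lemma primrec_decide_le {f g : α → ℕ} (hf : Primrec f) (hg : Primrec g) :
    Primrec fun a => decide (f a ≤ g a) := Primrec.nat_le.decide.comp hf hg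

@[fun_prop] lemma primrec_decide_eq {f g : α → ℕ} (hf : Primrec f) (hg : Primrec g) :
    Primrec fun a => decide (f a = g a) := Primrec.eq.decide.comp hf hg

@[fun_prop] lemma primrec_cond {c : α → Bool} {f g : α → β} (hc : Primrec c) (hf : Primrec f)
    (hg : Primrec g) : Primrec fun a => bif c a then f a else g a := Primrec.cond hc hf hg

@[fun_prop] lemma primrec_and {f g : α → Bool} (hf : Primrec f) (hg : Primrec g) :
    Primrec fun a => f a && g a := Primrec.and.comp hf hg

@[fun_prop] lemma primrec_not {f : α → Bool} (hf : Primrec f) :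
    Primrec fun a => !f a := Primrec.not.comp hf

@[fun_prop] lemma primrec_list_map {f : α → List β} {g : α → β → γ} (hf : Primrec f)
    (hg : Primrec fun x : α × β => g x.1 x.2) : Primrec fun a => (f a).map (g a) :=
  Primrec.list_map hf hg

@[fun_prop] lemma primrec_list_flatMap {f : α → List β} {g : α → β → List γ} (hf : Primrec f)
    (hg : Primrec fun x : α × β => g x.1 x.2) : Primrec fun a => (f a).flatMap (g a) :=
  Primrec.list_flatMap hf hg

@[fun_prop] lemma primrec_list_foldr {f : α → List β} {g : α → γ} {h : α → β → γ → γ}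
    (hf : Primrec f) (hg : Primrec g)
    (hh : Primrec fun x : α × (β × γ) => h x.1 x.2.1 x.2.2) :
    Primrec fun a => (f a).foldr (h a) (g a) :=
  Primrec.list_foldr (h := fun a x => h a x.1 x.2) hf hg hh

@[fun_prop] lemma primrec_list_range {f : α → ℕ} (hf : Primrec f) :
    Primrec fun a => List.range (f a) := Primrec.list_range.comp hf

@[fun_prop] lemma primrec_list_cons {f : α → β} {g : α → List β} (hf : Primrec f)
    (hg : Primrec g) : Primrec fun a => f a :: g a := Primrec.list_cons.comp hf hg

@[fun_prop] lemma primrec_list_length {f : α → List β} (hf : Primrec f) :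
    Primrec fun a => (f a).length := Primrec.list_length.comp hf

@[fun_prop] lemma primrec_list_getD {f : α → List β} {g : α → ℕ} (d : β) (hf : Primrec f)
    (hg : Primrec g) : Primrec fun a => (f a).getD (g a) d := (Primrec.list_getD d).comp hf hg

@[fun_prop] lemma primrec_nat_rec {f : α → ℕ} {g : α → β} {h : α → ℕ → β → β}
    (hf : Primrec f) (hg : Primrec g)
    (hh : Primrec fun x : α × (ℕ × β) => h x.1 x.2.1 x.2.2) :
    Primrec fun a => Nat.rec (motive := fun _ => β) (g a) (h a) (f a) :=
  Primrec.nat_rec' (h := fun a x => h a x.1 x.2) hf hg hh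

@[fun_prop] lemma computable_fst {f : α → β × γ} (hf : Computable f) :
    Computable fun x => (f x).1 := Computable.fst.comp hf

@[fun_prop] lemma computable_snd {f : α → β × γ} (hf : Computable f) :
    Computable fun x => (f x).2 := Computable.snd.comp hf

@[fun_prop] lemma computable_nat_add {f g : α → ℕ} (hf : Computable f) (hg : Computable g) :
    Computable fun a => f a + g a := Primrec.nat_add.to_comp.comp hf hg

@[fun_prop] lemma computable_nat_mul {f g : α → ℕ} (hf : Computable f) (hg : Computable g) :
    Computable fun a => f a * g a := Primrec.nat_mul.to_comp.comp hf hg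

@[fun_prop] lemma computable_nat_pow {f g : α → ℕ} (hf : Computable f) (hg : Computable g) :
    Computable fun a => f a ^ g a :=
  (Primrec₂.unpaired'.1 Nat.Primrec.pow).to_comp.comp hf hg

@[fun_prop] lemma computable_decide_eq {f g : α → ℕ} (hf : Computable f) (hg : Computable g) :
    Computable fun a => decide (f a = g a) :=
  (Primrec.eq (α := ℕ)).decide.to_comp.comp hf hg

@[fun_prop] lemma computable_and {f g : α → Bool} (hf : Computable f) (hg : Computable g) :
    Computable fun a => f a && g a := Primrec.and.to_comp.comp hf hg

@[fun_prop] lemma computable_or {f g : α → Bool} (hf : Computable f) (hg : Computable g) :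
    Computable fun a => f a || g a := Primrec.or.to_comp.comp hf hg

@[fun_prop] lemma computable_not {f : α → Bool} (hf : Computable f) :
    Computable fun a => !f a := Primrec.not.to_comp.comp hf

/-- Bounded universal quantification of a Boolean predicate. -/
def allLT (n : ℕ) (p : ℕ → Bool) : Bool :=
  Nat.rec true (fun k b => b && p k) n

lemma allLT_eq_true {n : ℕ} {p : ℕ → Bool} : allLT n p = true ↔ ∀ k < n, p k = true := by
  induction n with
  | zero => simp [allLT]
  | succ n ih =>
    have : allLT (n + 1) p = (allLT n p && p n) := rfl
    rw [this, Bool.and_eq_true, ih, Nat.forall_lt_succ_right]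

@[fun_prop] lemma primrec_allLT {f : α → ℕ} {p : α → ℕ → Bool} (hf : Primrec f)
    (hp : Primrec fun x : α × ℕ => p x.1 x.2) : Primrec fun a => allLT (f a) (p a) := by
  unfold allLT
  exact Primrec.nat_rec' (h := fun a x => x.2 && p a x.1) hf (Primrec.const _)
    (Primrec.and.comp (by fun_prop)
      (hp.comp (g := fun x : α × (ℕ × Bool) => (x.1, x.2.1)) (by fun_prop)))

@[fun_prop] lemma computable_allLT {f : α → ℕ} {p : α → ℕ → Bool} (hf : Computable f)
    (hp : Computable fun x : α × ℕ => p x.1 x.2) : Computable fun a => allLT (f a) (p a) := by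
  unfold allLT
  exact Computable.nat_rec (h := fun a x => x.2 && p a x.1) hf (Computable.const _)
    (Primrec.and.to_comp.comp (by fun_prop)
      (hp.comp (g := fun x : α × (ℕ × Bool) => (x.1, x.2.1)) (by fun_prop)))

/-! ### Integers -/

/-- Integers are encoded by `Int.ofNat n ↦ 2 * n` and `Int.negSucc n ↦ 2 * n + 1`, so sign and size
are read off from the parity and the half of the code. -/
lemma primrec_int_ofNat : Primrec Int.ofNat := by
  rw [← Primrec.encode_iff]
  exact (Primrec.nat_double).of_eq fun n => rfl

lemma primrec_int_negSucc : Primrec Int.negSucc := by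
  rw [← Primrec.encode_iff]
  exact (Primrec.nat_double_succ).of_eq fun n => rfl

@[fun_prop] lemma primrec_int_natCast {f : α → ℕ} (hf : Primrec f) :
    Primrec fun a => (f a : ℤ) := primrec_int_ofNat.comp hf

@[fun_prop] lemma primrec_int_toNat {f : α → ℤ} (hf : Primrec f) :
    Primrec fun a => (f a).toNat := by
  have h : Primrec Int.toNat := by
    have h1 : Primrec fun z : ℤ =>
        bif decide (Encodable.encode z % 2 = 0) then Encodable.encode z / 2 else 0 := by
      have := Primrec.encode (α := ℤ)
      fun_prop
    refine h1.of_eq fun z => ?_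
    rcases z with n | n
    · have : Encodable.encode (n : ℤ) = 2 * n := rfl
      simp [this]
    · have : Encodable.encode (Int.negSucc n) = 2 * n + 1 := rfl
      simp [this, Nat.add_mod]
  exact h.comp hf

/-- Subtraction of natural numbers with integer values. -/
lemma primrec_int_subNatNat {f g : α → ℕ} (hf : Primrec f) (hg : Primrec g) :
    Primrec fun a => (f a : ℤ) - (g a : ℤ) := by
  have h : Primrec fun a => bif decide (g a ≤ f a) then Int.ofNat (f a - g a)
      else Int.negSucc (g a - f a - 1) := by
    have h1 := primrec_int_ofNat.comp (primrec_nat_sub hf hg)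
    have h2 := primrec_int_negSucc.comp (f := Int.negSucc) (g := fun a => g a - f a - 1)
      (by fun_prop)
    exact Primrec.cond (by fun_prop) h1 h2
  refine h.of_eq fun a => ?_
  by_cases hle : g a ≤ f a
  · simp [hle]
  · simp only [hle, decide_false, cond_false]
    omega

lemma negPart_primrec : Primrec fun z : ℤ => (-z).toNat := by
  have h1 : Primrec fun z : ℤ =>
      bif decide (Encodable.encode z % 2 = 0) then 0 else Encodable.encode z / 2 + 1 := by
    have := Primrec.encode (α := ℤ)
    fun_prop
  refine h1.of_eq fun z => ?_
  rcases z with n | n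
  · have : Encodable.encode (n : ℤ) = 2 * n := rfl
    simp [this]
  · have : Encodable.encode (Int.negSucc n) = 2 * n + 1 := rfl
    simp [this, Nat.add_mod]
    omega

/-- Integer operations reduce to natural ones on positive and negative parts, recombined by
`primrec_int_subNatNat`. -/
lemma int_eq_toNat_sub (z : ℤ) : z = z.toNat - (-z).toNat := by omega

@[fun_prop] lemma primrec_int_neg {f : α → ℤ} (hf : Primrec f) : Primrec fun a => -f a := by
  refine (primrec_int_subNatNat (negPart_primrec.comp hf) (primrec_int_toNat hf)).of_eq ?_
  intro a; omega

@[fun_prop] lemma primrec_int_add {f g : α → ℤ} (hf : Primrec f) (hg : Primrec g) :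
    Primrec fun a => f a + g a := by
  have h1 := negPart_primrec.comp hf
  have h2 := negPart_primrec.comp hg
  refine (primrec_int_subNatNat (f := fun a => (f a).toNat + (g a).toNat)
    (g := fun a => (-f a).toNat + (-g a).toNat) (by fun_prop) (by fun_prop)).of_eq ?_
  intro a; push_cast; omega

@[fun_prop] lemma primrec_int_sub {f g : α → ℤ} (hf : Primrec f) (hg : Primrec g) :
    Primrec fun a => f a - g a := by
  simp only [sub_eq_add_neg]; fun_prop

@[fun_prop] lemma primrec_int_mul {f g : α → ℤ} (hf : Primrec f) (hg : Primrec g) :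
    Primrec fun a => f a * g a := by
  have h1 := negPart_primrec.comp hf
  have h2 := negPart_primrec.comp hg
  refine (primrec_int_subNatNat
    (f := fun a => (f a).toNat * (g a).toNat + (-f a).toNat * (-g a).toNat)
    (g := fun a => (f a).toNat * (-g a).toNat + (-f a).toNat * (g a).toNat)
    (by fun_prop) (by fun_prop)).of_eq ?_
  intro a
  conv_rhs => rw [int_eq_toNat_sub (f a), int_eq_toNat_sub (g a)]
  push_cast; ring

@[fun_prop] lemma primrec_int_natAbs {f : α → ℤ} (hf : Primrec f) :
    Primrec fun a => (f a).natAbs := by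
  have h1 := negPart_primrec.comp hf
  refine (primrec_nat_add (primrec_int_toNat hf) h1).of_eq fun a => by omega

@[fun_prop] lemma primrec_int_le {f g : α → ℤ} (hf : Primrec f) (hg : Primrec g) :
    Primrec fun a => decide (f a ≤ g a) := by
  have h : Primrec fun a => decide ((f a - g a).toNat ≤ 0) := by fun_prop
  refine h.of_eq fun a => ?_
  congr 1
  simp

/-! ### Rational and complex rational codes -/

def RatCode.ofNat (n : ℕ) : RatCode := (n, 0)
-- A code stores the denominator minus one, hence the `- 1` in the second component.
def RatCode.add (a b : RatCode) : RatCode :=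
  (a.1 * ((b.2 + 1 : ℕ) : ℤ) + b.1 * ((a.2 + 1 : ℕ) : ℤ), (a.2 + 1) * (b.2 + 1) - 1)
def RatCode.neg (a : RatCode) : RatCode := (-a.1, a.2)
def RatCode.mul (a b : RatCode) : RatCode := (a.1 * b.1, (a.2 + 1) * (b.2 + 1) - 1)
def RatCode.le (a b : RatCode) : Bool := decide (a.1 * ((b.2 + 1 : ℕ) : ℤ) ≤ b.1 * ((a.2 + 1 : ℕ) : ℤ))

lemma ratVal_ofNat (n : ℕ) : ratVal (RatCode.ofNat n) = n := by simp [ratVal, RatCode.ofNat]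

lemma ratVal_add (a b : RatCode) : ratVal (a.add b) = ratVal a + ratVal b := by
  have h : (((a.2 + 1) * (b.2 + 1) - 1 : ℕ) : ℚ) + 1 = (a.2 + 1) * (b.2 + 1) := by
    rw [Nat.cast_sub (Nat.mul_pos a.2.succ_pos b.2.succ_pos)]; push_cast; ring
  simp only [ratVal, RatCode.add, h]
  push_cast
  field_simp

lemma ratVal_mul (a b : RatCode) : ratVal (a.mul b) = ratVal a * ratVal b := by
  have h : (((a.2 + 1) * (b.2 + 1) - 1 : ℕ) : ℚ) + 1 = (a.2 + 1) * (b.2 + 1) := by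
    rw [Nat.cast_sub (Nat.mul_pos a.2.succ_pos b.2.succ_pos)]; push_cast; ring
  simp only [ratVal, RatCode.mul, h]
  push_cast
  field_simp

lemma ratVal_neg (a : RatCode) : ratVal a.neg = -ratVal a := by
  simp [ratVal, RatCode.neg, neg_div]

lemma RatCode.le_iff (a b : RatCode) : a.le b = true ↔ ratVal a ≤ ratVal b := by
  simp only [RatCode.le, decide_eq_true_eq, ratVal]
  rw [div_le_div_iff₀ (by positivity) (by positivity)]
  exact_mod_cast Iff.rfl

@[fun_prop] lemma primrec_ratCode_ofNat {f : α → ℕ} (hf : Primrec f) :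
    Primrec fun x => RatCode.ofNat (f x) := by unfold RatCode.ofNat; fun_prop

@[fun_prop] lemma primrec_ratCode_add {f g : α → RatCode} (hf : Primrec f) (hg : Primrec g) :
    Primrec fun x => (f x).add (g x) := by
  unfold RatCode.add
  exact Primrec.pair (by fun_prop) (by fun_prop)

@[fun_prop] lemma primrec_ratCode_mul {f g : α → RatCode} (hf : Primrec f) (hg : Primrec g) :
    Primrec fun x => (f x).mul (g x) := by
  unfold RatCode.mul
  exact Primrec.pair (by fun_prop) (by fun_prop)

@[fun_prop] lemma primrec_ratCode_neg {f : α → RatCode} (hf : Primrec f) :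
    Primrec fun x => (f x).neg := by unfold RatCode.neg; fun_prop

@[fun_prop] lemma primrec_ratCode_le {f g : α → RatCode} (hf : Primrec f) (hg : Primrec g) :
    Primrec fun x => (f x).le (g x) := by unfold RatCode.le; fun_prop

@[fun_prop] lemma computable_ratCode_add {f g : α → RatCode} (hf : Computable f)
    (hg : Computable g) : Computable fun x => (f x).add (g x) := by
  have h : Computable fun x : RatCode × RatCode => RatCode.add x.1 x.2 :=
    (primrec_ratCode_add Primrec.fst Primrec.snd).to_comp
  exact h.comp (g := fun x => (f x, g x)) (hf.pair hg)

@[fun_prop] lemma computable_ratCode_le {f g : α → RatCode} (hf : Computable f)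
    (hg : Computable g) : Computable fun x => (f x).le (g x) := by
  have h : Computable fun x : RatCode × RatCode => RatCode.le x.1 x.2 :=
    (primrec_ratCode_le Primrec.fst Primrec.snd).to_comp
  exact h.comp (g := fun x => (f x, g x)) (hf.pair hg)

/-- Codes of complex numbers with rational real and imaginary parts. -/
abbrev CRat : Type := RatCode × RatCode

def CRat.add (a b : CRat) : CRat := (a.1.add b.1, a.2.add b.2)
def CRat.mul (a b : CRat) : CRat :=
  ((a.1.mul b.1).add (a.2.mul b.2).neg, (a.1.mul b.2).add (a.2.mul b.1))
def CRat.ofRat (q : RatCode) : CRat := (q, RatCode.ofNat 0)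
def CRat.sum (l : List CRat) : CRat := l.foldr CRat.add (CRat.ofRat (RatCode.ofNat 0))

lemma coeffVal_add (a b : CRat) : coeffVal (a.add b) = coeffVal a + coeffVal b := by
  apply Complex.ext <;> simp [coeffVal, CRat.add, ratVal_add]

lemma coeffVal_mul (a b : CRat) : coeffVal (a.mul b) = coeffVal a * coeffVal b := by
  apply Complex.ext <;> simp [coeffVal, CRat.mul, ratVal_add, ratVal_mul, ratVal_neg, sub_eq_add_neg]

lemma coeffVal_ofRat (q : RatCode) : coeffVal (CRat.ofRat q) = ((ratVal q : ℝ) : ℂ) := by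
  apply Complex.ext <;> simp [coeffVal, CRat.ofRat, ratVal_ofNat]

lemma coeffVal_sum (l : List CRat) : coeffVal (CRat.sum l) = (l.map coeffVal).sum := by
  induction l with
  | nil => simp [CRat.sum, coeffVal_ofRat, ratVal_ofNat]
  | cons a l ih =>
    have : CRat.sum (a :: l) = a.add (CRat.sum l) := rfl
    rw [this, coeffVal_add, ih, List.map_cons, List.sum_cons]

@[fun_prop] lemma primrec_cRat_add {f g : α → CRat} (hf : Primrec f) (hg : Primrec g) :
    Primrec fun x => (f x).add (g x) := by unfold CRat.add; fun_prop

@[fun_prop] lemma primrec_cRat_mul {f g : α → CRat} (hf : Primrec f) (hg : Primrec g) :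
    Primrec fun x => (f x).mul (g x) := by unfold CRat.mul; fun_prop

@[fun_prop] lemma primrec_cRat_ofRat {f : α → RatCode} (hf : Primrec f) :
    Primrec fun x => CRat.ofRat (f x) := by unfold CRat.ofRat; fun_prop

@[fun_prop] lemma primrec_cRat_sum {f : α → List CRat} (hf : Primrec f) :
    Primrec fun x => CRat.sum (f x) := by
  unfold CRat.sum
  exact primrec_list_foldr hf (by fun_prop) (by fun_prop)

end Computability

/-! ## Matrices with entries from a finite grid -/

section Grid

/-- The `e`-th coordinate of the point with code `c` of the grid of mesh `1 / N` in a cube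
`[-1, 1]^m`. -/
def gridCoord (N c e : ℕ) : RatCode :=
  (((c / (2 * N + 1) ^ e % (2 * N + 1) : ℕ) : ℤ) - (N : ℤ), N - 1)

/-- The index `(l * p + i) * p + j` numbers the entries of all matrices of the tuple row by row;
each entry uses two consecutive digits of `c`, for its real and its imaginary part. -/
def gridEntry (p N c l i j : ℕ) : CRat :=
  (gridCoord N c (2 * ((l * p + i) * p + j)), gridCoord N c (2 * ((l * p + i) * p + j) + 1))

/-- The `l`-th matrix of the tuple of `p × p` matrices with code `c`, whose entries have real and
imaginary parts in the grid of mesh `1 / N` in `[-1, 1]`. -/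
noncomputable def gridMat (p N c l : ℕ) : Matrix (Fin p) (Fin p) ℂ :=
  Matrix.of fun i j => coeffVal (gridEntry p N c l i j)

def letterEntry (p N c : ℕ) (l : ℕ × Bool) (i j : ℕ) : CRat :=
  bif l.2 then ((gridEntry p N c l.1 j i).1, (gridEntry p N c l.1 j i).2.neg)
  else gridEntry p N c l.1 i j

/-- The `j`-th column of the value of a word at the tuple with code `c`. -/
def wordCol (p N c j : ℕ) (w : List (ℕ × Bool)) : List CRat :=
  -- Each letter acts on the current column by one matrix-vector product, so that only a list of `p`
  -- numbers is carried along.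
  w.foldr (fun l v => (List.range p).map fun i => CRat.sum ((List.range p).map fun k =>
      (letterEntry p N c l i k).mul (v.getD k (CRat.ofRat (RatCode.ofNat 0)))))
    ((List.range p).map fun i => CRat.ofRat (RatCode.ofNat (bif decide (i = j) then 1 else 0)))

/-- The normalized trace of the value of a word at the tuple with code `c`. -/
def gridTr (p N c : ℕ) (w : List (ℕ × Bool)) : CRat :=
  (CRat.ofRat (1, p - 1)).mul (CRat.sum ((List.range p).map fun j =>
    (wordCol p N c j w).getD j (CRat.ofRat (RatCode.ofNat 0))))

def gridPoly (p N c : ℕ) (P : PolyCode) : CRat :=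
  CRat.sum (P.map fun t => CRat.mul t.1 (gridTr p N c t.2))

def gridBasic (p N c : ℕ) (φ : BasicCode) : RatCode :=
  bif φ.1 then (gridPoly p N c φ.2).2 else (gridPoly p N c φ.2).1

lemma coeffVal_letterEntry (p N c : ℕ) (l : ℕ × Bool) (i j : Fin p) :
    coeffVal (letterEntry p N c l i j) =
      (if l.2 then star (gridMat p N c l.1) else gridMat p N c l.1) i j := by
  rcases l with ⟨l, b⟩
  cases b
  · rfl
  · apply Complex.ext <;>
      simp [letterEntry, gridMat, Matrix.star_apply, coeffVal, ratVal_neg]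

lemma sum_range_map {p : ℕ} (f : ℕ → ℂ) :
    ((List.range p).map f).sum = ∑ k : Fin p, f k := by
  rw [← Fin.sum_ofFn, List.ofFn_eq_map, ← List.map_coe_finRange_eq_range, List.map_map]
  rfl

lemma coeffVal_wordCol (p N c : ℕ) (w : List (ℕ × Bool)) (i j : Fin p) :
    coeffVal ((wordCol p N c j w).getD i (CRat.ofRat (RatCode.ofNat 0))) =
      evalWord (gridMat p N c) w i j := by
  induction w generalizing i with
  | nil =>
    simp only [wordCol, evalWord, List.foldr_nil, List.map_nil, List.prod_nil]
    rw [List.getD_eq_getElem _ _ (by simp)]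
    by_cases h : i = j
    · subst h; simp [coeffVal_ofRat, ratVal_ofNat]
    · have h' : (i : ℕ) ≠ j := fun e => h (Fin.ext e)
      simp [coeffVal_ofRat, ratVal_ofNat, h, h']
  | cons l w ih =>
    have h1 : wordCol p N c j (l :: w) = (List.range p).map fun i =>
        CRat.sum ((List.range p).map fun k => (letterEntry p N c l i k).mul
          ((wordCol p N c j w).getD k (CRat.ofRat (RatCode.ofNat 0)))) := rfl
    have h2 : evalWord (gridMat p N c) (l :: w) =
      (if l.2 then star (gridMat p N c l.1) else gridMat p N c l.1) *
        evalWord (gridMat p N c) w := by simp [evalWord]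
    rw [h1, h2, List.getD_eq_getElem _ _ (by simp), List.getElem_map, List.getElem_range,
      coeffVal_sum, List.map_map, Matrix.mul_apply, sum_range_map]
    refine Finset.sum_congr rfl fun k _ => ?_
    simp only [Function.comp]
    rw [coeffVal_mul, coeffVal_letterEntry, ih]

lemma coeffVal_gridTr {p : ℕ} (hp : 0 < p) (N c : ℕ) (w : List (ℕ × Bool)) :
    coeffVal (gridTr p N c w) = ntr p (evalWord (gridMat p N c) w) := by
  rw [gridTr, coeffVal_mul, coeffVal_sum, List.map_map, sum_range_map, coeffVal_ofRat]
  have h : ((ratVal (1, p - 1) : ℝ) : ℂ) = (p : ℂ)⁻¹ := by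
    have : ((p - 1 : ℕ) : ℂ) + 1 = p := by
      exact_mod_cast Nat.sub_add_cancel hp
    simp [ratVal, this]
  rw [h]
  simp only [ntr, LinearMap.smul_apply, Matrix.traceLinearMap_apply, smul_eq_mul, Matrix.trace,
    Matrix.diag]
  congr 1
  exact Finset.sum_congr rfl fun j _ => coeffVal_wordCol p N c w j j

lemma coeffVal_gridPoly {p : ℕ} (hp : 0 < p) (N c : ℕ) (P : PolyCode) :
    coeffVal (gridPoly p N c P) = ntr p (evalPoly P (gridMat p N c)) := by
  rw [gridPoly, coeffVal_sum, List.map_map, evalPoly, map_list_sum, List.map_map]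
  congr 1
  refine List.map_congr_left fun t _ => ?_
  simp [coeffVal_mul, coeffVal_gridTr hp]

lemma ratVal_gridBasic {p : ℕ} (hp : 0 < p) (N c : ℕ) (φ : BasicCode) :
    (ratVal (gridBasic p N c φ) : ℝ) = evalBasic (ntr p) φ (gridMat p N c) := by
  rcases φ with ⟨b, P⟩
  simp only [evalBasic, gridBasic, ← coeffVal_gridPoly hp]
  cases b <;> rfl

variable {α : Type*} [Primcodable α]

@[fun_prop] lemma primrec_gridCoord {N c e : α → ℕ} (hN : Primrec N) (hc : Primrec c)
    (he : Primrec e) : Primrec fun a => gridCoord (N a) (c a) (e a) := by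
  unfold gridCoord
  exact Primrec.pair (by fun_prop) (by fun_prop)

@[fun_prop] lemma primrec_gridEntry {p N c l i j : α → ℕ} (hp : Primrec p) (hN : Primrec N)
    (hc : Primrec c) (hl : Primrec l) (hi : Primrec i) (hj : Primrec j) :
    Primrec fun a => gridEntry (p a) (N a) (c a) (l a) (i a) (j a) := by
  unfold gridEntry
  exact Primrec.pair (by fun_prop) (by fun_prop)

@[fun_prop] lemma primrec_letterEntry {p N c i j : α → ℕ} {l : α → ℕ × Bool} (hp : Primrec p)
    (hN : Primrec N) (hc : Primrec c) (hl : Primrec l) (hi : Primrec i) (hj : Primrec j) :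
    Primrec fun a => letterEntry (p a) (N a) (c a) (l a) (i a) (j a) := by
  unfold letterEntry
  exact primrec_cond (by fun_prop) (Primrec.pair (by fun_prop) (by fun_prop)) (by fun_prop)

@[fun_prop] lemma primrec_wordCol {p N c j : α → ℕ} {w : α → List (ℕ × Bool)} (hp : Primrec p)
    (hN : Primrec N) (hc : Primrec c) (hj : Primrec j) (hw : Primrec w) :
    Primrec fun a => wordCol (p a) (N a) (c a) (j a) (w a) := by
  unfold wordCol
  refine primrec_list_foldr hw (by fun_prop) ?_
  refine primrec_list_map (by fun_prop) ?_
  refine primrec_cRat_sum (primrec_list_map (by fun_prop) ?_)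
  fun_prop

@[fun_prop] lemma primrec_gridTr {p N c : α → ℕ} {w : α → List (ℕ × Bool)} (hp : Primrec p)
    (hN : Primrec N) (hc : Primrec c) (hw : Primrec w) :
    Primrec fun a => gridTr (p a) (N a) (c a) (w a) := by
  unfold gridTr
  refine primrec_cRat_mul ?_ (primrec_cRat_sum (primrec_list_map (by fun_prop) ?_))
  · exact primrec_cRat_ofRat (Primrec.pair (by fun_prop) (by fun_prop))
  · fun_prop

@[fun_prop] lemma primrec_gridPoly {p N c : α → ℕ} {P : α → PolyCode} (hp : Primrec p)
    (hN : Primrec N) (hc : Primrec c) (hP : Primrec P) :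
    Primrec fun a => gridPoly (p a) (N a) (c a) (P a) := by
  unfold gridPoly
  refine primrec_cRat_sum (primrec_list_map hP ?_)
  exact primrec_cRat_mul (by fun_prop) (by fun_prop)

@[fun_prop] lemma primrec_gridBasic {p N c : α → ℕ} {φ : α → BasicCode} (hp : Primrec p)
    (hN : Primrec N) (hc : Primrec c) (hφ : Primrec φ) :
    Primrec fun a => gridBasic (p a) (N a) (c a) (φ a) := by
  unfold gridBasic
  exact primrec_cond (by fun_prop) (by fun_prop) (by fun_prop)

/-- The word `(x_l* x_l)^m`. -/
def sqWord (l m : ℕ) : List (ℕ × Bool) :=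
  (List.range m).flatMap fun _ => [(l, true), (l, false)]

/-- The test defining the net of contractions. -/
def inNet (n p M c : ℕ) : Bool :=
  -- The factor `p` undoes the normalization of the trace. The trace of a power of x* x is real, so
  -- its real part suffices.
  allLT n fun l => RatCode.le
    (RatCode.mul (RatCode.ofNat p) (gridTr p (4 * p * M) c (sqWord l (p * M))).1)
    (RatCode.ofNat 1)

/-- All codes of `n`-tuples of matrices from the grid used for the net are below this number. -/
def netBound (n p M : ℕ) : ℕ := (2 * (4 * p * M) + 1) ^ (2 * (n * p * p))

@[fun_prop] lemma primrec_sqWord {l m : α → ℕ} (hl : Primrec l) (hm : Primrec m) :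
    Primrec fun a => sqWord (l a) (m a) := by
  unfold sqWord
  refine primrec_list_flatMap (by fun_prop) ?_
  exact primrec_list_cons (by fun_prop) (primrec_list_cons (by fun_prop) (by fun_prop))

@[fun_prop] lemma primrec_inNet {n p M c : α → ℕ} (hn : Primrec n) (hp : Primrec p)
    (hM : Primrec M) (hc : Primrec c) : Primrec fun a => inNet (n a) (p a) (M a) (c a) := by
  unfold inNet
  refine primrec_allLT hn ?_
  fun_prop

@[fun_prop] lemma primrec_netBound {n p M : α → ℕ} (hn : Primrec n) (hp : Primrec p)
    (hM : Primrec M) : Primrec fun a => netBound (n a) (p a) (M a) := by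
  unfold netBound; fun_prop

end Grid

/-! ## The net of contractions -/

section Net

open scoped Matrix.Norms.L2Operator ComplexOrder

lemma conjStarAlgAut_norm {p : ℕ} (U : unitary (Matrix (Fin p) (Fin p) ℂ))
    (A : Matrix (Fin p) (Fin p) ℂ) : ‖Unitary.conjStarAlgAut ℂ _ U A‖ = ‖A‖ := by
  rw [Unitary.conjStarAlgAut_apply, ← Unitary.coe_star, CStarRing.norm_mul_coe_unitary,
    CStarRing.norm_coe_unitary_mul]

/-- The norm is the largest eigenvalue, and the trace is the sum of the `m`-th powers of all
eigenvalues. This replaces norms by traces, which are computed exactly on rational matrices. -/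
lemma norm_pow_le_trace_pow {p : ℕ} {A : Matrix (Fin p) (Fin p) ℂ} (hA : A.PosSemidef) {m : ℕ}
    (hm : m ≠ 0) : ‖A‖ ^ m ≤ (Matrix.trace (A ^ m)).re := by
  set lam := hA.isHermitian.eigenvalues
  have hspec := hA.isHermitian.spectral_theorem
  have hnorm : ‖A‖ = ‖((fun i => (lam i : ℂ)) : Fin p → ℂ)‖ := by
    conv_lhs => rw [hspec]
    rw [conjStarAlgAut_norm, Matrix.l2_opNorm_diagonal]
    rfl
  have htr : Matrix.trace (A ^ m) = ((∑ i, lam i ^ m : ℝ) : ℂ) := by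
    conv_lhs => rw [hspec]
    rw [← map_pow, Unitary.conjStarAlgAut_apply, Matrix.trace_mul_comm, ← mul_assoc]
    simp [Matrix.diagonal_pow, Matrix.trace_diagonal, lam]
  rw [htr, Complex.ofReal_re]
  have h0 : ∀ i, 0 ≤ lam i := hA.eigenvalues_nonneg
  have hle : ∀ i, lam i ^ m ≤ ∑ i, lam i ^ m := fun i =>
    Finset.single_le_sum (f := fun i => lam i ^ m) (fun j _ => pow_nonneg (h0 j) m)
      (Finset.mem_univ i)
  rw [hnorm]
  -- For `p = 0` both sides vanish because `m ≠ 0`.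
  rcases isEmpty_or_nonempty (Fin p) with he | hne
  · rw [Subsingleton.elim (fun i => (lam i : ℂ)) 0]
    simp [hm]
  · obtain ⟨i, hi⟩ := Finite.exists_max lam
    refine le_trans (pow_le_pow_left₀ (norm_nonneg _) ?_ m) (hle i)
    refine (pi_norm_le_iff_of_nonneg (h0 i)).2 fun j => ?_
    rw [Complex.norm_real, Real.norm_of_nonneg (h0 j)]
    exact hi j

lemma norm_entry_le {p : ℕ} (A : Matrix (Fin p) (Fin p) ℂ) (i j : Fin p) : ‖A i j‖ ≤ ‖A‖ := by
  have h := Matrix.l2_opNorm_mulVec A (EuclideanSpace.single j 1)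
  rw [PiLp.norm_single, norm_one, mul_one] at h
  refine le_trans ?_ h
  have := PiLp.norm_apply_le (p := 2) ((EuclideanSpace.equiv (Fin p) ℂ).symm
    (A.mulVec (EuclideanSpace.single j (1 : ℂ)))) i
  simpa using this

/-- Exponent one in `norm_pow_le_trace_pow`, applied to A* A, whose trace is the squared Frobenius
norm. -/
lemma norm_sq_le_sum {p : ℕ} (A : Matrix (Fin p) (Fin p) ℂ) :
    ‖A‖ ^ 2 ≤ ∑ i, ∑ j, ‖A i j‖ ^ 2 := by
  have h := norm_pow_le_trace_pow (Matrix.posSemidef_conjTranspose_mul_self A) one_ne_zero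
  rw [pow_one, pow_one, Matrix.l2_opNorm_conjTranspose_mul_self, ← sq] at h
  refine h.trans (le_of_eq ?_)
  rw [Finset.sum_comm]
  simp only [Matrix.trace, Matrix.diag, Matrix.mul_apply, Matrix.conjTranspose_apply,
    Complex.re_sum]
  refine Finset.sum_congr rfl fun j _ => Finset.sum_congr rfl fun i _ => ?_
  rw [Complex.star_def, ← Complex.normSq_eq_conj_mul_self, Complex.ofReal_re,
    Complex.normSq_eq_norm_sq]

lemma norm_le_of_entry_le {p : ℕ} (A : Matrix (Fin p) (Fin p) ℂ) {r : ℝ} (hr : 0 ≤ r)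
    (h : ∀ i j, ‖A i j‖ ≤ r) : ‖A‖ ≤ p * r := by
  refine abs_le_of_sq_le_sq' ?_ (by positivity) |>.2
  refine (norm_sq_le_sum A).trans ?_
  calc ∑ i, ∑ j, ‖A i j‖ ^ 2 ≤ ∑ i : Fin p, ∑ j : Fin p, r ^ 2 :=
        Finset.sum_le_sum fun i _ => Finset.sum_le_sum fun j _ =>
          pow_le_pow_left₀ (norm_nonneg _) (h i j) 2
    _ = (p * r) ^ 2 := by simp; ring

lemma norm_ntr_le (p : ℕ) (A : Matrix (Fin p) (Fin p) ℂ) : ‖ntr p A‖ ≤ ‖A‖ := by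
  have h : ‖Matrix.trace A‖ ≤ p * ‖A‖ := by
    refine (norm_sum_le _ _).trans ?_
    refine (Finset.sum_le_sum fun i _ => norm_entry_le A i i).trans ?_
    simp
  simp only [ntr, LinearMap.smul_apply, Matrix.traceLinearMap_apply, smul_eq_mul, norm_mul,
    norm_inv, Complex.norm_natCast]
  rcases Nat.eq_zero_or_pos p with hp | hp
  · subst hp; simp
  · rw [inv_mul_le_iff₀ (by positivity)]; exact h

lemma evalWord_append {ι A : Type} [Monoid A] [Star A] (a : ι → A) (v w : List (ι × Bool)) :
    evalWord a (v ++ w) = evalWord a v * evalWord a w := by simp [evalWord]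

lemma evalWord_cons {ι A : Type} [Monoid A] [Star A] (a : ι → A) (l : ι × Bool)
    (w : List (ι × Bool)) :
    evalWord a (l :: w) = (if l.2 then star (a l.1) else a l.1) * evalWord a w := by
  simp [evalWord]

lemma evalWord_nil {ι A : Type} [Monoid A] [Star A] (a : ι → A) :
    evalWord a ([] : List (ι × Bool)) = 1 := by
  simp [evalWord]

lemma evalWord_sqWord {A : Type} [Monoid A] [Star A] (a : ℕ → A) (l m : ℕ) :
    evalWord a (sqWord l m) = (star (a l) * a l) ^ m := by
  induction m with
  | zero => simp [sqWord, evalWord]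
  | succ m ih =>
    have : sqWord l (m + 1) = sqWord l m ++ [(l, true), (l, false)] := by
      simp [sqWord, List.range_succ]
    rw [this, evalWord_append, ih, pow_succ]
    simp [evalWord]

lemma mul_ntr_re {p : ℕ} (hp : 0 < p) (A : Matrix (Fin p) (Fin p) ℂ) :
    p * (ntr p A).re = (Matrix.trace A).re := by
  have : ntr p A = ((p : ℝ)⁻¹ : ℝ) * Matrix.trace A := by simp [ntr]
  rw [this, Complex.re_ofReal_mul]
  field_simp

lemma inNet_iff {n p M c : ℕ} (hp : 0 < p) : inNet n p M c = true ↔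
    ∀ l < n, (Matrix.trace ((star (gridMat p (4 * p * M) c l) *
      gridMat p (4 * p * M) c l) ^ (p * M))).re ≤ 1 := by
  rw [inNet, allLT_eq_true]
  refine forall₂_congr fun l _ => ?_
  rw [RatCode.le_iff, ratVal_mul, ratVal_ofNat, ratVal_ofNat, ← mul_ntr_re hp, ← evalWord_sqWord,
    ← coeffVal_gridTr hp]
  simp only [coeffVal]
  exact_mod_cast Iff.rfl

/-- The tested trace dominates ‖B‖^(2pM), so passing the test gives contractivity without any loss.
-/
lemma norm_le_one_of_inNet {n p M c : ℕ} (hp : 0 < p) (hM : 0 < M) (h : inNet n p M c = true)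
    {l : ℕ} (hl : l < n) : ‖gridMat p (4 * p * M) c l‖ ≤ 1 := by
  have h1 := (inNet_iff hp).1 h l hl
  set B := gridMat p (4 * p * M) c l
  have hm : p * M ≠ 0 := by positivity
  have h2 := (norm_pow_le_trace_pow (Matrix.posSemidef_conjTranspose_mul_self B) hm).trans h1
  rw [Matrix.l2_opNorm_conjTranspose_mul_self, ← sq, ← pow_mul] at h2
  exact (pow_le_one_iff_of_nonneg (norm_nonneg _) (by positivity)).1 h2

lemma exists_digits (b : ℕ) (m : ℕ) (D : ℕ → ℕ) (hD : ∀ e < m, D e < b) :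
    ∃ c < b ^ m, ∀ e < m, c / b ^ e % b = D e := by
  induction m with
  | zero => exact ⟨0, by simp, by simp⟩
  | succ m ih =>
    obtain ⟨c, hc, h⟩ := ih fun e he => hD e (he.trans (Nat.lt_succ_self m))
    have hDm := hD m (Nat.lt_succ_self m)
    have hb : 0 < b := by omega
    refine ⟨c + D m * b ^ m, ?_, fun e he => ?_⟩
    · calc c + D m * b ^ m < b ^ m + D m * b ^ m := by omega
        _ = (D m + 1) * b ^ m := by ring
        _ ≤ b * b ^ m := Nat.mul_le_mul_right _ hDm
        _ = b ^ (m + 1) := by ring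
    · rcases Nat.lt_succ_iff_lt_or_eq.1 he with he | rfl
      · have h1 : D m * b ^ m = b ^ e * (b * (D m * b ^ (m - e - 1))) := by
          have : b ^ m = b ^ e * b * b ^ (m - e - 1) := by
            rw [← pow_succ, ← pow_add]; congr 1; omega
          rw [this]; ring
        rw [h1, Nat.add_mul_div_left _ _ (pow_pos hb e), Nat.add_mul_mod_self_left, h e he]
      · rw [Nat.add_mul_div_right _ _ (pow_pos hb e), Nat.div_eq_of_lt hc, zero_add,
          Nat.mod_eq_of_lt hDm]

lemma ratVal_gridCoord {N : ℕ} (hN : 0 < N) (c e : ℕ) :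
    ratVal (gridCoord N c e) = ((c / (2 * N + 1) ^ e % (2 * N + 1) : ℕ) - (N : ℚ)) / N := by
  have : ((N - 1 : ℕ) : ℚ) + 1 = N := by exact_mod_cast Nat.sub_add_cancel hN
  simp only [ratVal, gridCoord, this, Int.cast_sub, Int.cast_natCast]

lemma abs_gridCoord_le {N : ℕ} (hN : 0 < N) (c e : ℕ) :
    |(ratVal (gridCoord N c e) : ℝ)| ≤ 1 := by
  rw [ratVal_gridCoord hN]
  have h : c / (2 * N + 1) ^ e % (2 * N + 1) < 2 * N + 1 := Nat.mod_lt _ (by omega)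
  set D := c / (2 * N + 1) ^ e % (2 * N + 1)
  have h1 : (D : ℝ) ≤ 2 * N := by exact_mod_cast Nat.lt_succ_iff.1 h
  have hN' : (0 : ℝ) < N := by exact_mod_cast hN
  push_cast
  rw [abs_div, abs_of_pos hN', div_le_one hN', abs_le]
  constructor <;> linarith [(Nat.cast_nonneg D : (0 : ℝ) ≤ D)]

lemma exists_gridCoord {N : ℕ} (hN : 0 < N) (m : ℕ) (x : ℕ → ℝ) (hx : ∀ e < m, |x e| ≤ 1) :
    ∃ c < (2 * N + 1) ^ m, ∀ e < m, |(ratVal (gridCoord N c e) : ℝ) - x e| ≤ 1 / N := by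
  have hN' : (0 : ℝ) < N := by exact_mod_cast hN
  -- Rounding `N * x e` down and shifting by `N` gives a digit in base `2 * N + 1`.
  have hfl : ∀ e < m, 0 ≤ ⌊N * x e⌋ + N ∧ ⌊N * x e⌋ + N ≤ 2 * N := by
    intro e he
    have := abs_le.1 (hx e he)
    have h1 : -(N : ℤ) ≤ ⌊N * x e⌋ := Int.le_floor.2 (by push_cast; nlinarith)
    have h2 : ⌊N * x e⌋ ≤ (N : ℤ) := by
      have : (⌊N * x e⌋ : ℝ) ≤ N := (Int.floor_le _).trans (by nlinarith)
      exact_mod_cast this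
    omega
  obtain ⟨c, hc, h⟩ := exists_digits (2 * N + 1) m (fun e => (⌊N * x e⌋ + N).toNat)
    (fun e he => by have := hfl e he; omega)
  refine ⟨c, hc, fun e he => ?_⟩
  rw [ratVal_gridCoord hN, h e he]
  have h0 : (((⌊N * x e⌋ + N).toNat : ℕ) : ℝ) = ⌊N * x e⌋ + N := by
    have : (((⌊N * x e⌋ + N).toNat : ℕ) : ℤ) = ⌊N * x e⌋ + N := Int.toNat_of_nonneg (hfl e he).1
    exact_mod_cast this
  push_cast
  rw [h0]
  have e1 : ((⌊N * x e⌋ : ℝ) + N - N) / N - x e = (⌊N * x e⌋ - N * x e) / N := by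
    field_simp; ring
  rw [e1, abs_div, abs_of_pos hN', div_le_div_iff_of_pos_right hN', abs_le]
  constructor <;> linarith [Int.floor_le (N * x e), Int.lt_floor_add_one (N * x e)]

lemma exists_gridMat {n p N : ℕ} (hp : 0 < p) (hN : 0 < N) (A : ℕ → Matrix (Fin p) (Fin p) ℂ)
    (hA : ∀ l < n, ‖A l‖ ≤ 1) :
    ∃ c < (2 * N + 1) ^ (2 * (n * p * p)), ∀ l < n, ‖gridMat p N c l - A l‖ ≤ p * (2 / N) := by
  -- Inverts the numbering of `gridEntry`: the parity of `e` selects real or imaginary part, and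
  -- successive divisions by `p` recover column, row and matrix.
  let x : ℕ → ℝ := fun e =>
    let z := A (e / 2 / p / p) ⟨e / 2 / p % p, Nat.mod_lt _ hp⟩ ⟨e / 2 % p, Nat.mod_lt _ hp⟩
    if e % 2 = 0 then z.re else z.im
  have hx : ∀ e < 2 * (n * p * p), |x e| ≤ 1 := by
    intro e he
    have hl : e / 2 / p / p < n := by
      rw [Nat.div_div_eq_div_mul, Nat.div_div_eq_div_mul]
      apply Nat.div_lt_of_lt_mul
      calc e < 2 * (n * p * p) := he
        _ = 2 * p * p * n := by ring
        _ = 2 * (p * p) * n := by ring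
    have h1 := (norm_entry_le (A (e / 2 / p / p)) ⟨e / 2 / p % p, Nat.mod_lt _ hp⟩
      ⟨e / 2 % p, Nat.mod_lt _ hp⟩).trans (hA _ hl)
    simp only [x]
    split_ifs
    · exact (Complex.abs_re_le_norm _).trans h1
    · exact (Complex.abs_im_le_norm _).trans h1
  obtain ⟨c, hc, h⟩ := exists_gridCoord hN _ x hx
  refine ⟨c, hc, fun l hl => norm_le_of_entry_le _ (by positivity) fun i j => ?_⟩
  have hlt : (l * p + i) * p + j < n * p * p := by
    have h1 : l * p + i + 1 ≤ n * p := by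
      calc l * p + i + 1 ≤ l * p + p := by have := i.2; omega
        _ = (l + 1) * p := by ring
        _ ≤ n * p := Nat.mul_le_mul_right _ hl
    calc (l * p + i) * p + j < (l * p + i) * p + p := by have := j.2; omega
      _ = (l * p + i + 1) * p := by ring
      _ ≤ n * p * p := Nat.mul_le_mul_right _ h1
  have d1 : ((l * p + i) * p + j) / p = l * p + i := by
    rw [mul_comm _ p, Nat.mul_add_div hp, Nat.div_eq_of_lt j.2, add_zero]
  have d2 : ((l * p + i) * p + j) % p = j := by
    rw [mul_comm _ p, Nat.mul_add_mod, Nat.mod_eq_of_lt j.2]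
  have d3 : (l * p + i) / p = l := by
    rw [mul_comm _ p, Nat.mul_add_div hp, Nat.div_eq_of_lt i.2, add_zero]
  have d4 : (l * p + i) % p = i := by
    rw [mul_comm _ p, Nat.mul_add_mod, Nat.mod_eq_of_lt i.2]
  have x0 : x (2 * ((l * p + i) * p + j)) = (A l i j).re := by
    have e1 : 2 * ((l * p + i) * p + (j : ℕ)) / 2 = (l * p + i) * p + j := by omega
    have e2 : 2 * ((l * p + i) * p + (j : ℕ)) % 2 = 0 := by omega
    simp only [x, e1, e2, d1, d2, d3, d4, if_true, Fin.eta]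
  have x1 : x (2 * ((l * p + i) * p + j) + 1) = (A l i j).im := by
    have e1 : (2 * ((l * p + i) * p + (j : ℕ)) + 1) / 2 = (l * p + i) * p + j := by omega
    have e2 : (2 * ((l * p + i) * p + (j : ℕ)) + 1) % 2 = 1 := by omega
    simp [x, e1, e2, d1, d2, d3, d4]
  have h0 := h (2 * ((l * p + i) * p + j)) (by omega)
  have h1 := h (2 * ((l * p + i) * p + j) + 1) (by omega)
  rw [x0] at h0
  rw [x1] at h1
  refine (Complex.norm_le_abs_re_add_abs_im _).trans ?_
  have : (2 : ℝ) / N = 1 / N + 1 / N := by ring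
  rw [this]
  exact add_le_add (by simpa [gridMat, gridEntry, coeffVal] using h0)
    (by simpa [gridMat, gridEntry, coeffVal] using h1)

/-- Shrinking A by the factor 1 - 1/M makes room for rounding: the grid approximation B still has
norm at most 1 - 1/(2M). The trace of (B*B)^(pM) collects p eigenvalues, and the exponent is large
enough that p (1 - 1/(2M))^(2pM) ≤ 1. Shrinking and rounding together move A by at most 2/M. -/
lemma exists_inNet {n p M : ℕ} (hp : 0 < p) (hM : 0 < M) (A : ℕ → Matrix (Fin p) (Fin p) ℂ)
    (hA : ∀ l < n, ‖A l‖ ≤ 1) :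
    ∃ c < netBound n p M, inNet n p M c = true ∧
      ∀ l < n, ‖gridMat p (4 * p * M) c l - A l‖ ≤ 2 / M := by
  have hM' : (0 : ℝ) < M := by exact_mod_cast hM
  have hp' : (0 : ℝ) < p := by exact_mod_cast hp
  have hM1 : (1 : ℝ) ≤ M := by exact_mod_cast hM
  have hinv : 1 / (M : ℝ) ≤ 1 := by rw [div_le_one hM']; exact hM1
  set r : ℝ := 1 - 1 / M with hr
  have hr0 : 0 ≤ r := by linarith
  obtain ⟨c, hc, h⟩ := exists_gridMat (n := n) hp (N := 4 * p * M) (by positivity)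
    (fun l => (r : ℂ) • A l) (fun l hl => by
      rw [norm_smul, Complex.norm_real, Real.norm_of_nonneg hr0]
      have := hA l hl
      nlinarith [norm_nonneg (A l), div_pos one_pos hM'])
  -- The mesh 1/(4pM) is chosen so that rounding costs 1/(2M) in operator norm.
  have herr : (p : ℝ) * (2 / ((4 * p * M : ℕ) : ℝ)) = 1 / (2 * M) := by
    push_cast; field_simp; ring
  rw [herr] at h
  refine ⟨c, hc, ?_, fun l hl => ?_⟩
  · rw [inNet_iff hp]
    intro l hl
    set B := gridMat p (4 * p * M) c l with hB
    have hBn : ‖B‖ ≤ 1 - 1 / (2 * M) := by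
      have h1 : ‖(r : ℂ) • A l‖ ≤ r := by
        rw [norm_smul, Complex.norm_real, Real.norm_of_nonneg hr0]
        have := hA l hl
        nlinarith
      have h2 := norm_le_norm_add_norm_sub ((r : ℂ) • A l) B
      have h3 := h l hl
      rw [norm_sub_rev] at h2
      have h4 : (1 : ℝ) / M = 1 / (2 * M) + 1 / (2 * M) := by field_simp; ring
      rw [norm_sub_rev] at h2
      have h5 : ‖(r : ℂ) • A l - B‖ = ‖B - (r : ℂ) • A l‖ := norm_sub_rev _ _
      linarith
    rw [← mul_ntr_re hp]
    have h6 : (ntr p ((star B * B) ^ (p * M))).re ≤ (1 - 1 / (2 * M)) ^ (2 * (p * M)) := by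
      refine (Complex.re_le_norm _).trans ((norm_ntr_le _ _).trans ?_)
      refine (norm_pow_le' _ (by positivity)).trans ?_
      rw [CStarRing.norm_star_mul_self, ← sq, ← pow_mul]
      exact pow_le_pow_left₀ (norm_nonneg _) hBn _
    set x : ℝ := 1 / (2 * M) with hx
    have hx0 : 0 < x := by positivity
    have hx1 : x ≤ 1 := by rw [hx, div_le_one (by positivity)]; linarith
    -- Since (1 - x)(1 + x) ≤ 1 and Bernoulli's inequality gives (1 + x)^(2pM) ≥ 1 + p, it follows
    -- that p (1 - x)^(2pM) ≤ 1.
    have h7 : (1 - x) ^ (2 * (p * M)) * (1 + x) ^ (2 * (p * M)) ≤ 1 := by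
      rw [← mul_pow]
      apply pow_le_one₀
      · nlinarith
      · nlinarith
    have h8 : (p : ℝ) ≤ (1 + x) ^ (2 * (p * M)) := by
      have := one_add_mul_le_pow (a := x) (by linarith) (2 * (p * M))
      refine le_trans ?_ this
      have : ((2 * (p * M) : ℕ) : ℝ) * x = p := by rw [hx]; push_cast; field_simp
      rw [this]; linarith
    have h9 : 0 ≤ (1 - x) ^ (2 * (p * M)) := pow_nonneg (by linarith) _
    nlinarith
  · have h1 : ‖(r : ℂ) • A l - A l‖ ≤ 1 / M := by
      have : (r : ℂ) • A l - A l = ((r - 1 : ℝ) : ℂ) • A l := by push_cast; rw [sub_smul, one_smul]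
      rw [this, norm_smul, Complex.norm_real]
      have e : ‖r - 1‖ = 1 / M := by
        rw [hr, Real.norm_eq_abs, abs_of_nonpos] <;> [ring; linarith [div_pos one_pos hM']]
      rw [e]
      exact mul_le_of_le_one_right (by positivity) (hA l hl)
    have h2 := norm_sub_le_norm_sub_add_norm_sub (gridMat p (4 * p * M) c l) ((r : ℂ) • A l) (A l)
    have h3 := h l hl
    have h4 : (1 : ℝ) / (2 * M) ≤ 1 / M := by
      apply one_div_le_one_div_of_le hM'; linarith
    have h5 : (2 : ℝ) / M = 1 / M + 1 / M := by ring
    linarith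

end Net

/-! ## The hyperfinite factor: the GNS representation -/

noncomputable section GNS

open scoped Matrix.Norms.L2Operator ComplexOrder

/-- The vector in the GNS space given by an element of the tower. -/
def vec (x : tower) : L2 := ((toVec x : PreL2) : L2)

lemma norm_vec (x : tower) : ‖vec x‖ = ‖toVec x‖ := UniformSpace.Completion.norm_coe _

lemma inner_vec (x y : tower) : inner ℂ (vec x) (vec y) = towerTr (star x * y) := by
  rw [vec, vec, UniformSpace.Completion.inner_coe]; rfl

lemma norm_vec_sq (x : tower) : ‖vec x‖ ^ 2 = (towerTr (star x * x)).re := by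
  rw [norm_vec, preL2_norm_sq]; rfl

lemma vec_add (x y : tower) : vec (x + y) = vec x + vec y := by
  simp [vec, UniformSpace.Completion.coe_add]

lemma vec_sub (x y : tower) : vec (x - y) = vec x - vec y := by
  simp [vec, UniformSpace.Completion.coe_sub]

lemma vec_smul (c : ℂ) (x : tower) : vec (c • x) = c • vec x := by
  simp [vec, UniformSpace.Completion.coe_smul]

lemma towerTr_eq_of_eventually {x : tower} {c : ℂ} (h : ∀ᶠ n in atTop, ntr (2 ^ n) (x.1 n) = c) :
    towerTr x = c := by
  obtain ⟨n, h1, h2⟩ := (h.and (eventually_towerTr x)).exists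
  rw [← h1, ← h2]

/-- Eventually vanishing sequences are null vectors, so identities in the tower need only hold from
some index on. -/
lemma vec_congr {x y : tower} (h : ∀ᶠ n in atTop, x.1 n = y.1 n) : vec x = vec y := by
  rw [← sub_eq_zero, ← vec_sub, ← norm_eq_zero, ← sq_eq_zero_iff, norm_vec_sq,
    towerTr_eq_of_eventually (c := 0), Complex.zero_re]
  filter_upwards [h] with n hn
  have : (star (x - y) * (x - y)).1 n = star (x.1 n - y.1 n) * (x.1 n - y.1 n) := rfl
  rw [this, hn, sub_self, mul_zero, map_zero]

lemma vec_induction {P : L2 → Prop} (ξ : L2) (hc : IsClosed {ξ | P ξ}) (h : ∀ x, P (vec x)) :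
    P ξ := by
  refine UniformSpace.Completion.induction_on ξ hc fun v => ?_
  have := h (toVec.symm v)
  rwa [vec, LinearEquiv.apply_symm_apply] at this

lemma ntr_one {p : ℕ} (hp : 0 < p) : ntr p 1 = 1 := by
  have : (p : ℂ) ≠ 0 := by exact_mod_cast hp.ne'
  simp [ntr, this]

lemma norm_vec_one : ‖vec 1‖ = 1 := by
  rw [← sq_eq_sq₀ (norm_nonneg _) zero_le_one, norm_vec_sq, star_one, one_mul,
    towerTr_eq_of_eventually (c := 1)]
  · simp
  · exact Eventually.of_forall fun n => ntr_one (by positivity)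

lemma ntr_mul_comm (p : ℕ) (A B : Matrix (Fin p) (Fin p) ℂ) : ntr p (A * B) = ntr p (B * A) := by
  simp [ntr, Matrix.trace_mul_comm A B]

lemma towerTr_mul_comm (x y : tower) : towerTr (x * y) = towerTr (y * x) := by
  apply towerTr_eq_of_eventually
  filter_upwards [eventually_towerTr (y * x)] with n hn
  rw [← hn]
  exact ntr_mul_comm _ _ _

lemma gns_vec (a x : tower) : gns a (vec x) = vec (a * x) := by
  rw [gns, vec, ContinuousLinearMap.completion_apply_coe]
  rfl

lemma norm_vec_star (x : tower) : ‖vec (star x)‖ = ‖vec x‖ := by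
  rw [← sq_eq_sq₀ (norm_nonneg _) (norm_nonneg _), norm_vec_sq, norm_vec_sq, star_star,
    towerTr_mul_comm]

/-- By traciality the adjoint is isometric on vectors, and it turns right multiplication by `b` into
left multiplication by `star b`. -/
lemma exists_rightMul_bound (b : tower) :
    ∃ C : ℝ, ∀ x : tower, ‖toVec (x * b)‖ ≤ C * ‖toVec x‖ := by
  obtain ⟨C, hC⟩ := exists_leftMul_bound (star b)
  refine ⟨C, fun x => ?_⟩
  have h := hC (star x)
  rwa [← norm_vec, ← norm_vec, norm_vec_star, ← star_mul, norm_vec_star, norm_vec, norm_vec] at h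

/-- Right multiplication on the GNS space. -/
def rightMul (b : tower) : L2 →L[ℂ] L2 :=
  (LinearMap.mkContinuousOfExistsBound
    (toVec.toLinearMap ∘ₗ LinearMap.mulRight ℂ b ∘ₗ toVec.symm.toLinearMap)
    (by
      obtain ⟨C, hC⟩ := exists_rightMul_bound b
      exact ⟨C, fun x => by simpa using hC (toVec.symm x)⟩) : PreL2 →L[ℂ] PreL2).completion

lemma rightMul_vec (b x : tower) : rightMul b (vec x) = vec (x * b) := by
  rw [rightMul, vec, ContinuousLinearMap.completion_apply_coe]
  rfl

lemma gns_rightMul_comm (a b : tower) : gns a * rightMul b = rightMul b * gns a := by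
  ext ξ
  refine vec_induction ξ (isClosed_eq (by fun_prop) (by fun_prop)) fun x => ?_
  simp only [mul_apply_eq_comp, rightMul_vec, gns_vec, mul_assoc]

lemma gns_star (a : tower) : star (gns a) = gns (star a) := by
  symm
  rw [ContinuousLinearMap.star_eq_adjoint, ContinuousLinearMap.eq_adjoint_iff]
  intro ξ η
  refine vec_induction (P := fun ξ => inner ℂ (gns (star a) ξ) η = inner ℂ ξ (gns a η)) ξ
    (isClosed_eq (by fun_prop) (by fun_prop)) fun x => ?_
  refine vec_induction
    (P := fun η => inner ℂ (gns (star a) (vec x)) η = inner ℂ (vec x) (gns a η)) η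
    (isClosed_eq (by fun_prop) (by fun_prop)) fun y => ?_
  rw [gns_vec, gns_vec, inner_vec, inner_vec, star_mul, star_star, mul_assoc]

/-- Traciality makes right multiplication by `star b` the adjoint of right multiplication by `b`. -/
lemma inner_vec_rightMul (c b : tower) (ξ : L2) :
    inner ℂ (vec c) (rightMul b ξ) = inner ℂ (vec (c * star b)) ξ := by
  refine vec_induction
    (P := fun ξ => inner ℂ (vec c) (rightMul b ξ) = inner ℂ (vec (c * star b)) ξ) ξ
    (isClosed_eq (by fun_prop) (by fun_prop)) fun x => ?_
  rw [rightMul_vec, inner_vec, inner_vec, star_mul, star_star, ← mul_assoc, towerTr_mul_comm,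
    mul_assoc]

lemma rightMul_mem_commutant (b : tower) :
    rightMul b ∈ StarSubalgebra.centralizer ℂ (Set.range gns) := by
  rw [StarSubalgebra.mem_centralizer_iff]
  rintro _ ⟨a, rfl⟩
  exact ⟨gns_rightMul_comm a b, by rw [gns_star]; exact gns_rightMul_comm _ b⟩

/-- Right multiplications lie in the commutant of the representation, hence commute with the double
commutant. This is why compressions are again left multiplications. -/
lemma hyperfinite_comm_rightMul (x : hyperfinite.toStarSubalgebra) (b : tower) (ξ : L2) :
    (x : L2 →L[ℂ] L2) (rightMul b ξ) = rightMul b ((x : L2 →L[ℂ] L2) ξ) := by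
  have h := x.2
  have h1 := (StarSubalgebra.mem_centralizer_iff ℂ).1 h (rightMul b) (rightMul_mem_commutant b)
  exact congrArg (fun T : L2 →L[ℂ] L2 => T ξ) h1.1.symm

lemma gns_mem (a : tower) : gns a ∈ hyperfinite.toStarSubalgebra := by
  change gns a ∈ StarSubalgebra.centralizer ℂ _
  rw [StarSubalgebra.mem_centralizer_iff]
  intro g hg
  have h1 := (StarSubalgebra.mem_centralizer_iff ℂ).1 hg (gns a) ⟨a, rfl⟩
  have h2 := (StarSubalgebra.mem_centralizer_iff ℂ).1 (star_mem hg) (gns a) ⟨a, rfl⟩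
  exact ⟨h1.1.symm, h2.1.symm⟩

lemma hyperfiniteTr_apply (x : hyperfinite.toStarSubalgebra) :
    hyperfiniteTr x = inner ℂ (vec 1) ((x : L2 →L[ℂ] L2) (vec 1)) := rfl

lemma norm_gns_le {a : tower} {C : ℝ} (hC : 0 ≤ C) (h : ∀ᶠ n in atTop, ‖a.1 n‖ ≤ C) :
    ‖gns a‖ ≤ C := by
  refine ContinuousLinearMap.opNorm_le_bound _ hC fun ξ => ?_
  refine vec_induction (P := fun ξ => ‖gns a ξ‖ ≤ C * ‖ξ‖) ξ
    (isClosed_le (by fun_prop) (by fun_prop)) fun x => ?_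
  rw [gns_vec, ← sq_le_sq₀ (norm_nonneg _) (by positivity), mul_pow, norm_vec_sq, norm_vec_sq]
  obtain ⟨n, hn, h1, h2⟩ := (h.and
    ((eventually_towerTr (star (a * x) * (a * x))).and (eventually_towerTr (star x * x)))).exists
  rw [← h1, ← h2]
  refine (ntr_mul_le _ (a.1 n) (x.1 n)).trans ?_
  exact mul_le_mul_of_nonneg_right (pow_le_pow_left₀ (norm_nonneg _) hn 2)
    (ntr_star_mul_self_nonneg _ (x.1 n))

/-! ### The matrix algebras inside the tower -/

/-- The sequence that starts with `A` in position `m`. -/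
def embSeq (m : ℕ) (A : Matrix (Fin (2 ^ m)) (Fin (2 ^ m)) ℂ) :
    ∀ n, Matrix (Fin (2 ^ n)) (Fin (2 ^ n)) ℂ
  -- Positions before `m` hold the default value `0`, which the GNS vector does not see.
  | 0 => if h : m = 0 then h ▸ A else 0
  | n + 1 => if h : m = n + 1 then h ▸ A else dbl n (embSeq m A n)

lemma embSeq_self (m : ℕ) (A : Matrix (Fin (2 ^ m)) (Fin (2 ^ m)) ℂ) : embSeq m A m = A := by
  cases m <;> simp [embSeq]

lemma embSeq_succ {m n : ℕ} (h : m ≤ n) (A : Matrix (Fin (2 ^ m)) (Fin (2 ^ m)) ℂ) :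
    embSeq m A (n + 1) = dbl n (embSeq m A n) := by
  rw [embSeq, dif_neg (by omega)]

def emb (m : ℕ) (A : Matrix (Fin (2 ^ m)) (Fin (2 ^ m)) ℂ) : tower :=
  ⟨embSeq m A, eventually_atTop.2 ⟨m, fun _ hn => embSeq_succ hn A⟩⟩

/-- From position `m` on, the sequence is the image of its first matrix under iterated doubling.
Algebraic identities and traces in M_{2^m} are carried to the tower through this homomorphism. -/
lemma exists_embSeq_hom {m n : ℕ} (h : m ≤ n) :
    ∃ φ : Matrix (Fin (2 ^ m)) (Fin (2 ^ m)) ℂ →⋆ₐ[ℂ] Matrix (Fin (2 ^ n)) (Fin (2 ^ n)) ℂ,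
      (∀ A, embSeq m A n = φ A) ∧ ∀ A, ntr (2 ^ n) (φ A) = ntr (2 ^ m) A := by
  induction n, h using Nat.le_induction with
  | base => exact ⟨StarAlgHom.id _ _, fun A => embSeq_self m A, fun A => rfl⟩
  | succ n hn ih =>
    obtain ⟨φ, hφ, ht⟩ := ih
    refine ⟨(dbl n).comp φ, fun A => ?_, fun A => ?_⟩
    · rw [embSeq_succ hn, hφ]; rfl
    · rw [StarAlgHom.comp_apply, ntr_dbl, ht]

lemma eventually_eq_emb (x : tower) : ∀ᶠ m in atTop, ∀ n ≥ m, x.1 n = (emb m (x.1 m)).1 n := by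
  obtain ⟨N, hN⟩ := eventually_atTop.1 x.2
  refine eventually_atTop.2 ⟨N, fun m hm n hn => ?_⟩
  change x.1 n = embSeq m (x.1 m) n
  induction n, hn using Nat.le_induction with
  | base => rw [embSeq_self]
  | succ n hn ih => rw [embSeq_succ hn, ← ih, hN n (le_trans hm hn)]

/-- The vector of a matrix. -/
def matVec (m : ℕ) : Matrix (Fin (2 ^ m)) (Fin (2 ^ m)) ℂ →ₗ[ℂ] L2 where
  toFun A := vec (emb m A)
  map_add' A B := by
    rw [← vec_add]
    refine vec_congr (eventually_atTop.2 ⟨m, fun n hn => ?_⟩)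
    obtain ⟨φ, hφ, -⟩ := exists_embSeq_hom hn
    change embSeq m (A + B) n = embSeq m A n + embSeq m B n
    simp only [hφ, map_add]
  map_smul' c A := by
    rw [RingHom.id_apply, ← vec_smul]
    refine vec_congr (eventually_atTop.2 ⟨m, fun n hn => ?_⟩)
    obtain ⟨φ, hφ, -⟩ := exists_embSeq_hom hn
    change embSeq m (c • A) n = c • embSeq m A n
    simp only [hφ, map_smul]

lemma matVec_apply (m : ℕ) (A : Matrix (Fin (2 ^ m)) (Fin (2 ^ m)) ℂ) :
    matVec m A = vec (emb m A) := rfl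

lemma vec_emb_mul (m : ℕ) (A B : Matrix (Fin (2 ^ m)) (Fin (2 ^ m)) ℂ) :
    vec (emb m A * emb m B) = matVec m (A * B) := by
  refine vec_congr (eventually_atTop.2 ⟨m, fun n hn => ?_⟩)
  obtain ⟨φ, hφ, -⟩ := exists_embSeq_hom hn
  change embSeq m A n * embSeq m B n = embSeq m (A * B) n
  simp only [hφ, map_mul]

lemma vec_emb_mul_star (m : ℕ) (A B : Matrix (Fin (2 ^ m)) (Fin (2 ^ m)) ℂ) :
    vec (emb m A * star (emb m B)) = matVec m (A * star B) := by
  refine vec_congr (eventually_atTop.2 ⟨m, fun n hn => ?_⟩)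
  obtain ⟨φ, hφ, -⟩ := exists_embSeq_hom hn
  change embSeq m A n * star (embSeq m B n) = embSeq m (A * star B) n
  simp only [hφ, map_mul, map_star]

lemma vec_star_emb_mul (m : ℕ) (A B : Matrix (Fin (2 ^ m)) (Fin (2 ^ m)) ℂ) :
    vec (star (emb m A) * emb m B) = matVec m (star A * B) := by
  refine vec_congr (eventually_atTop.2 ⟨m, fun n hn => ?_⟩)
  obtain ⟨φ, hφ, -⟩ := exists_embSeq_hom hn
  change star (embSeq m A n) * embSeq m B n = embSeq m (star A * B) n
  simp only [hφ, map_mul, map_star]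

lemma matVec_one (m : ℕ) : matVec m 1 = vec 1 := by
  refine vec_congr (eventually_atTop.2 ⟨m, fun n hn => ?_⟩)
  obtain ⟨φ, hφ, -⟩ := exists_embSeq_hom hn
  change embSeq m 1 n = 1
  simp only [hφ, map_one]

lemma inner_matVec (m : ℕ) (A B : Matrix (Fin (2 ^ m)) (Fin (2 ^ m)) ℂ) :
    inner ℂ (matVec m A) (matVec m B) = ntr (2 ^ m) (star A * B) := by
  rw [matVec_apply, matVec_apply, inner_vec]
  refine towerTr_eq_of_eventually (eventually_atTop.2 ⟨m, fun n hn => ?_⟩)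
  obtain ⟨φ, hφ, ht⟩ := exists_embSeq_hom hn
  change ntr (2 ^ n) (star (embSeq m A n) * embSeq m B n) = _
  rw [hφ, hφ, ← map_star, ← map_mul, ht]

/-- Tuples of contractions in `M_{2^m}(ℂ)` have the same moments as tuples of contractions
in `𝓡`. -/
lemma exists_hyperfinite_of_matrix {ι : Type} (m : ℕ)
    (A : ι → Matrix (Fin (2 ^ m)) (Fin (2 ^ m)) ℂ) (hA : ∀ i, ‖A i‖ ≤ 1) :
    ∃ a : ι → hyperfinite.toStarSubalgebra, (∀ i, ‖a i‖ ≤ 1) ∧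
      ∀ w, hyperfiniteTr (evalWord a w) = ntr (2 ^ m) (evalWord A w) := by
  refine ⟨fun i => ⟨gns (emb m (A i)), gns_mem _⟩, fun i => ?_, fun w => ?_⟩
  · refine norm_gns_le zero_le_one (eventually_atTop.2 ⟨m, fun n hn => ?_⟩)
    obtain ⟨φ, hφ, -⟩ := exists_embSeq_hom hn
    change ‖embSeq m (A i) n‖ ≤ 1
    rw [hφ]
    exact (NonUnitalStarAlgHom.norm_apply_le φ (A i)).trans (hA i)
  -- A word applied to the trace vector is the vector of the same word in the matrices; pairing with
  -- `vec 1` then gives the trace.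
  · have key : ∀ w, ((evalWord (fun i => (⟨gns (emb m (A i)), gns_mem _⟩ :
        hyperfinite.toStarSubalgebra)) w : hyperfinite.toStarSubalgebra) : L2 →L[ℂ] L2) (vec 1) =
        matVec m (evalWord A w) := by
      intro w
      induction w with
      | nil => rw [evalWord_nil, evalWord_nil, matVec_one]; rfl
      | cons l w ih =>
        rw [evalWord_cons, evalWord_cons, MulMemClass.coe_mul, mul_apply_eq_comp, ih,
          matVec_apply]
        split_ifs
        · change (star (gns (emb m (A l.1)))) _ = _
          rw [gns_star, gns_vec, vec_star_emb_mul]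
        · change (gns (emb m (A l.1))) _ = _
          rw [gns_vec, vec_emb_mul]
    rw [hyperfiniteTr_apply, key, ← matVec_one m, inner_matVec, star_one, one_mul]

/-! ### Compression to the matrix algebras -/

/-- The finite-dimensional subspace of the vectors of the `2 ^ m × 2 ^ m` matrices. -/
def matSpace (m : ℕ) : Submodule ℂ L2 := LinearMap.range (matVec m)

instance (m : ℕ) : FiniteDimensional ℂ (matSpace m) := by
  unfold matSpace; infer_instance

lemma monotone_matSpace : Monotone matSpace := by
  intro m k hmk
  rintro _ ⟨A, rfl⟩
  refine ⟨embSeq m A k, vec_congr (eventually_atTop.2 ⟨k, fun n hn => ?_⟩)⟩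
  change embSeq k (embSeq m A k) n = embSeq m A n
  induction n, hn using Nat.le_induction with
  | base => rw [embSeq_self]
  | succ n hn ih => rw [embSeq_succ hn, ih, embSeq_succ (hmk.trans hn)]

/-- The subspaces increase, and every vector of the tower lies in one of them, so their union is
dense. -/
lemma tendsto_starProjection_matSpace (ξ : L2) :
    Tendsto (fun m => (matSpace m).starProjection ξ) atTop (𝓝 ξ) := by
  refine Submodule.starProjection_tendsto_self matSpace monotone_matSpace ξ ?_
  intro η _
  refine vec_induction η (Submodule.isClosed_topologicalClosure _) fun x => ?_
  apply Submodule.le_topologicalClosure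
  obtain ⟨m, hm⟩ := (eventually_eq_emb x).exists
  refine (le_iSup matSpace m) ⟨x.1 m, vec_congr (eventually_atTop.2 ⟨m, fun n hn => ?_⟩)⟩
  exact (hm n hn).symm

/-- A is the matrix whose vector is the projection of x 1̂. The vector of B is 1̂ multiplied by B on
the right, which commutes with x; moving B to the other side of the inner product reduces everything
to x 1̂. -/
lemma exists_compression (m : ℕ) (x : hyperfinite.toStarSubalgebra) :
    ∃ A : Matrix (Fin (2 ^ m)) (Fin (2 ^ m)) ℂ, ∀ B C,
      inner ℂ (matVec m C) ((x : L2 →L[ℂ] L2) (matVec m B)) =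
        inner ℂ (matVec m C) (matVec m (A * B)) := by
  obtain ⟨A, hA⟩ := Submodule.starProjection_apply_mem (matSpace m)
    ((x : L2 →L[ℂ] L2) (vec 1))
  refine ⟨A, fun B C => ?_⟩
  have h1 : matVec m B = rightMul (emb m B) (vec 1) := by
    rw [rightMul_vec, one_mul, matVec_apply]
  have h2 : inner ℂ (matVec m (C * star B)) ((x : L2 →L[ℂ] L2) (vec 1)) =
      inner ℂ (matVec m (C * star B)) (matVec m A) := by
    rw [hA, ← Submodule.inner_starProjection_left_eq_right,
      Submodule.starProjection_eq_self_iff.2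
        (show matVec m (C * star B) ∈ matSpace m from LinearMap.mem_range_self _ _)]
  rw [h1, hyperfinite_comm_rightMul, matVec_apply m C, inner_vec_rightMul, vec_emb_mul_star, h2,
    ← matVec_apply, inner_matVec, inner_matVec, star_mul, star_star, mul_assoc, ntr_mul_comm,
    mul_assoc]

def compression (m : ℕ) (x : hyperfinite.toStarSubalgebra) :
    Matrix (Fin (2 ^ m)) (Fin (2 ^ m)) ℂ := (exists_compression m x).choose

lemma starProjection_apply_matVec (m : ℕ) (x : hyperfinite.toStarSubalgebra)
    (B : Matrix (Fin (2 ^ m)) (Fin (2 ^ m)) ℂ) :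
    (matSpace m).starProjection ((x : L2 →L[ℂ] L2) (matVec m B)) =
      matVec m (compression m x * B) := by
  refine Submodule.eq_starProjection_of_mem_of_inner_eq_zero ⟨_, rfl⟩ ?_
  rintro _ ⟨C, rfl⟩
  rw [inner_eq_zero_symm, inner_sub_right, (exists_compression m x).choose_spec B C]
  exact sub_self _

lemma starProjection_star_apply_matVec (m : ℕ) (x : hyperfinite.toStarSubalgebra)
    (B : Matrix (Fin (2 ^ m)) (Fin (2 ^ m)) ℂ) :
    (matSpace m).starProjection (((star x : hyperfinite.toStarSubalgebra) : L2 →L[ℂ] L2)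
      (matVec m B)) = matVec m (star (compression m x) * B) := by
  refine Submodule.eq_starProjection_of_mem_of_inner_eq_zero ⟨_, rfl⟩ ?_
  rintro _ ⟨C, rfl⟩
  rw [inner_eq_zero_symm, inner_sub_right, sub_eq_zero]
  have h : ((star x : hyperfinite.toStarSubalgebra) : L2 →L[ℂ] L2) =
    ContinuousLinearMap.adjoint (x : L2 →L[ℂ] L2) := rfl
  rw [h, ContinuousLinearMap.adjoint_inner_right, ← inner_conj_symm,
    (exists_compression m x).choose_spec C B, inner_conj_symm, inner_matVec, inner_matVec, star_mul,
    mul_assoc]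
  rfl

/-- Left multiplications by A and A* are compressions of x and x*, hence contract the vectors of
matrices, and so τ((A*A)^k) ≤ 1 for all k. Then ‖A‖^(2k) ≤ 2^m for every k > 0, which excludes ‖A‖ >
1. -/
lemma norm_compression_le_one (m : ℕ) {x : hyperfinite.toStarSubalgebra} (hx : ‖x‖ ≤ 1) :
    ‖compression m x‖ ≤ 1 := by
  set A := compression m x with hA
  have hx' : ‖(x : L2 →L[ℂ] L2)‖ ≤ 1 := hx
  have hxs : ‖((star x : hyperfinite.toStarSubalgebra) : L2 →L[ℂ] L2)‖ ≤ 1 := by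
    have : ‖star (x : L2 →L[ℂ] L2)‖ ≤ 1 := by rw [norm_star]; exact hx
    exact this
  have h1 : ∀ B, ‖matVec m (A * B)‖ ≤ ‖matVec m B‖ := fun B => by
    rw [hA, ← starProjection_apply_matVec]
    refine (Submodule.norm_starProjection_apply_le _ _).trans ?_
    exact (ContinuousLinearMap.le_of_opNorm_le _ hx' _).trans (one_mul _).le
  have h2 : ∀ B, ‖matVec m (star A * B)‖ ≤ ‖matVec m B‖ := fun B => by
    rw [hA, ← starProjection_star_apply_matVec]
    refine (Submodule.norm_starProjection_apply_le _ _).trans ?_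
    exact (ContinuousLinearMap.le_of_opNorm_le _ hxs _).trans (one_mul _).le
  have h3 : ∀ k : ℕ, ‖matVec m ((star A * A) ^ k)‖ ≤ ‖matVec m 1‖ := by
    intro k
    induction k with
    | zero => simp
    | succ k ih =>
      rw [pow_succ', mul_assoc]
      exact (h2 _).trans ((h1 _).trans ih)
  have h4 : ‖matVec m 1‖ ≤ 1 := by
    rw [matVec_one, norm_vec_one]
  have h5 : ∀ k : ℕ, k ≠ 0 → (‖A‖ ^ 2) ^ k ≤ ((2 ^ m : ℕ) : ℝ) := by
    intro k hk
    have h6 := norm_pow_le_trace_pow (Matrix.posSemidef_conjTranspose_mul_self A) hk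
    rw [Matrix.l2_opNorm_conjTranspose_mul_self, ← sq, ← mul_ntr_re (by positivity)] at h6
    refine h6.trans ?_
    refine mul_le_of_le_one_right (by positivity) ?_
    refine (Complex.re_le_norm _).trans ?_
    have h7 : ntr (2 ^ m) ((star A * A) ^ k) =
      inner ℂ (matVec m 1) (matVec m ((star A * A) ^ k)) := by
      rw [inner_matVec, star_one, one_mul]
    rw [← Matrix.star_eq_conjTranspose, h7]
    refine (norm_inner_le_norm _ _).trans ?_
    exact mul_le_one₀ h4 (norm_nonneg _) ((h3 k).trans h4)
  by_contra hcon
  push Not at hcon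
  obtain ⟨k, hk⟩ := pow_unbounded_of_one_lt ((2 ^ m : ℕ) : ℝ) (one_lt_pow₀ hcon two_ne_zero)
  have h8 := h5 (k + 1) k.succ_ne_zero
  have h9 : (‖A‖ ^ 2) ^ k ≤ (‖A‖ ^ 2) ^ (k + 1) :=
    pow_le_pow_right₀ (one_le_pow₀ hcon.le) (Nat.le_succ k)
  linarith

/-- The moments of a tuple in the unit ball of `𝓡` are limits of the moments of tuples in the
unit balls of the matrix algebras `M_{2^m}(ℂ)`. -/
lemma tendsto_compression {ι : Type} (a : ι → hyperfinite.toStarSubalgebra)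
    (w : List (ι × Bool)) :
    Tendsto (fun m => ntr (2 ^ m) (evalWord (fun i => compression m (a i)) w)) atTop
      (𝓝 (hyperfiniteTr (evalWord a w))) := by
  -- The projections are contractions converging strongly to the identity, so one may be inserted
  -- after each letter without changing the limit.
  have step : ∀ (y : L2 →L[ℂ] L2) (u : ℕ → L2) (ξ : L2), Tendsto u atTop (𝓝 ξ) →
      Tendsto (fun m => (matSpace m).starProjection (y (u m))) atTop (𝓝 (y ξ)) := by
    intro y u ξ hu
    have h1 : Tendsto (fun m => (matSpace m).starProjection (y (u m) - y ξ)) atTop (𝓝 0) := by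
      rw [tendsto_zero_iff_norm_tendsto_zero]
      refine squeeze_zero (fun _ => norm_nonneg _)
        (fun m => Submodule.norm_starProjection_apply_le _ _) ?_
      rw [← tendsto_iff_norm_sub_tendsto_zero]
      exact (y.continuous.tendsto ξ).comp hu
    have h2 := h1.add (tendsto_starProjection_matSpace (y ξ))
    rw [zero_add] at h2
    refine h2.congr fun m => ?_
    rw [← map_add, sub_add_cancel]
  have key : ∀ w, Tendsto (fun m => matVec m (evalWord (fun i => compression m (a i)) w)) atTop
      (𝓝 (((evalWord a w : hyperfinite.toStarSubalgebra) : L2 →L[ℂ] L2) (vec 1))) := by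
    intro w
    induction w with
    | nil =>
      simp only [evalWord_nil, matVec_one]
      exact tendsto_const_nhds
    | cons l w ih =>
      rw [evalWord_cons, MulMemClass.coe_mul, mul_apply_eq_comp]
      have := step ((if l.2 then star (a l.1) else a l.1 : hyperfinite.toStarSubalgebra) :
        L2 →L[ℂ] L2) _ _ ih
      refine this.congr fun m => ?_
      rw [evalWord_cons]
      split_ifs
      · exact starProjection_star_apply_matVec m _ _
      · exact starProjection_apply_matVec m _ _
  rw [hyperfiniteTr_apply]
  refine (((innerSL ℂ (vec 1)).continuous.tendsto _).comp (key w)).congr fun m => ?_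
  rw [Function.comp_apply, innerSL_apply_apply, ← matVec_one m, inner_matVec, star_one, one_mul]

end GNS

/-! ## Matrix algebras of arbitrary size, traces, and words -/

section

open scoped Matrix.Norms.L2Operator ComplexOrder

/-- `q` diagonal copies of a `p × p` matrix, followed by a zero block of size `r`. -/
noncomputable def blockCopies (p q r : ℕ) :
    Matrix (Fin p) (Fin p) ℂ →⋆ₙₐ[ℂ] Matrix (Fin (p * q + r)) (Fin (p * q + r)) ℂ where
  toFun A := Matrix.reindex ((Equiv.sumCongr finProdFinEquiv (Equiv.refl _)).trans finSumFinEquiv)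
    ((Equiv.sumCongr finProdFinEquiv (Equiv.refl _)).trans finSumFinEquiv)
    (Matrix.fromBlocks (Matrix.blockDiagonal fun _ : Fin q => A) 0 0
      (0 : Matrix (Fin r) (Fin r) ℂ))
  map_smul' c A := by
    have h : (Matrix.blockDiagonal fun _ : Fin q => c • A) =
        c • Matrix.blockDiagonal fun _ : Fin q => A := Matrix.blockDiagonal_smul c fun _ => A
    rw [h, show Matrix.fromBlocks (c • Matrix.blockDiagonal fun _ : Fin q => A) 0 0
      (0 : Matrix (Fin r) (Fin r) ℂ) =
      c • Matrix.fromBlocks (Matrix.blockDiagonal fun _ : Fin q => A) 0 0 0 by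
        rw [Matrix.fromBlocks_smul]; simp]
    rfl
  map_zero' := by
    have h : (Matrix.blockDiagonal fun _ : Fin q => (0 : Matrix (Fin p) (Fin p) ℂ)) = 0 :=
      Matrix.blockDiagonal_zero
    rw [h]; simp
  map_add' A B := by
    have h : (Matrix.blockDiagonal fun _ : Fin q => A + B) =
        (Matrix.blockDiagonal fun _ : Fin q => A) + Matrix.blockDiagonal fun _ : Fin q => B :=
      Matrix.blockDiagonal_add (fun _ => A) fun _ => B
    rw [h, show Matrix.fromBlocks ((Matrix.blockDiagonal fun _ : Fin q => A) +
      Matrix.blockDiagonal fun _ : Fin q => B) 0 0 (0 : Matrix (Fin r) (Fin r) ℂ) =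
      Matrix.fromBlocks (Matrix.blockDiagonal fun _ : Fin q => A) 0 0 0 +
      Matrix.fromBlocks (Matrix.blockDiagonal fun _ : Fin q => B) 0 0 0 by
        rw [Matrix.fromBlocks_add]; simp]
    rfl
  map_mul' A B := by
    have h : (Matrix.blockDiagonal fun _ : Fin q => A * B) =
        (Matrix.blockDiagonal fun _ : Fin q => A) * Matrix.blockDiagonal fun _ : Fin q => B :=
      Matrix.blockDiagonal_mul (fun _ => A) fun _ => B
    simp only [Matrix.reindex_apply, Matrix.submatrix_mul_equiv, Matrix.fromBlocks_multiply, h]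
    simp
  map_star' A := by
    have h : (Matrix.blockDiagonal fun _ : Fin q => star A) =
        (Matrix.blockDiagonal fun _ : Fin q => A).conjTranspose :=
      (Matrix.blockDiagonal_conjTranspose fun _ => A).symm
    rw [h]
    simp [Matrix.star_eq_conjTranspose, Matrix.conjTranspose_submatrix,
      Matrix.fromBlocks_conjTranspose]

lemma trace_blockCopies (p q r : ℕ) (A : Matrix (Fin p) (Fin p) ℂ) :
    Matrix.trace (blockCopies p q r A) = q * Matrix.trace A := by
  set e := (Equiv.sumCongr (finProdFinEquiv (m := p) (n := q)) (Equiv.refl (Fin r))).trans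
    finSumFinEquiv
  set X := Matrix.fromBlocks (Matrix.blockDiagonal fun _ : Fin q => A) 0 0
      (0 : Matrix (Fin r) (Fin r) ℂ)
  have h1 : Matrix.trace (blockCopies p q r A) = Matrix.trace X :=
    Equiv.sum_comp e.symm fun i => X i i
  have h2 : Matrix.trace X = Matrix.trace (Matrix.blockDiagonal fun _ : Fin q => A) := by
    simp [X, Matrix.trace, Fintype.sum_sum_type]
  rw [h1, h2, Matrix.trace_blockDiagonal]
  simp

/-- The empty word is excluded because `φ` need not be unital, as is the case for `blockCopies`. -/
lemma evalWord_map {ι : Type} {A B : Type} [Ring A] [StarRing A] [Algebra ℂ A] [Ring B] [StarRing B]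
    [Algebra ℂ B] (φ : A →⋆ₙₐ[ℂ] B) (a : ι → A) (w : List (ι × Bool)) (hw : w ≠ []) :
    evalWord (fun i => φ (a i)) w = φ (evalWord a w) := by
  induction w with
  | nil => exact absurd rfl hw
  | cons l w ih =>
    have h1 : (if l.2 then star (φ (a l.1)) else φ (a l.1)) =
        φ (if l.2 then star (a l.1) else a l.1) := by
      split_ifs
      · rw [map_star]
      · rfl
    rw [evalWord_cons, evalWord_cons, h1]
    by_cases h : w = []
    · subst h; rw [evalWord_nil, evalWord_nil, mul_one, mul_one]
    · rw [ih h, map_mul]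

lemma norm_evalWord_le_one {ι A : Type} [NormedRing A] [StarRing A] [NormedStarGroup A]
    (h1 : ‖(1 : A)‖ ≤ 1) (a : ι → A) (w : List (ι × Bool)) (ha : ∀ l ∈ w, ‖a l.1‖ ≤ 1) :
    ‖evalWord a w‖ ≤ 1 := by
  induction w with
  | nil => rwa [evalWord_nil]
  | cons l w ih =>
    rw [evalWord_cons]
    refine (norm_mul_le _ _).trans (mul_le_one₀ ?_ (norm_nonneg _)
      (ih fun l hl => ha l (List.mem_cons_of_mem _ hl)))
    have := ha l List.mem_cons_self
    split_ifs
    · rwa [norm_star]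
    · exact this

/-- Telescoping: exchanging one letter costs at most `δ`, all other factors being contractions. -/
lemma norm_evalWord_sub_le {ι A : Type} [NormedRing A] [StarRing A] [NormedStarGroup A]
    (h1 : ‖(1 : A)‖ ≤ 1) (a b : ι → A) {δ : ℝ} (w : List (ι × Bool))
    (ha : ∀ l ∈ w, ‖a l.1‖ ≤ 1) (hb : ∀ l ∈ w, ‖b l.1‖ ≤ 1)
    (hab : ∀ l ∈ w, ‖a l.1 - b l.1‖ ≤ δ) :
    ‖evalWord a w - evalWord b w‖ ≤ w.length * δ := by
  induction w with
  | nil => simp [evalWord_nil]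
  | cons l w ih =>
    have ih' := ih (fun l hl => ha l (List.mem_cons_of_mem _ hl))
      (fun l hl => hb l (List.mem_cons_of_mem _ hl)) (fun l hl => hab l (List.mem_cons_of_mem _ hl))
    have hw := norm_evalWord_le_one h1 a w (fun l hl => ha l (List.mem_cons_of_mem _ hl))
    rw [evalWord_cons, evalWord_cons]
    set x := if l.2 then star (a l.1) else a l.1
    set y := if l.2 then star (b l.1) else b l.1
    have hy : ‖y‖ ≤ 1 := by
      have := hb l List.mem_cons_self
      simp only [y]
      split_ifs
      · rwa [norm_star]
      · exact this
    have hxy : ‖x - y‖ ≤ δ := by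
      have := hab l List.mem_cons_self
      simp only [x, y]
      split_ifs
      · rwa [← star_sub, norm_star]
      · exact this
    have e : x * evalWord a w - y * evalWord b w =
        (x - y) * evalWord a w + y * (evalWord a w - evalWord b w) := by noncomm_ring
    rw [e]
    have h2 : ‖(x - y) * evalWord a w‖ ≤ δ :=
      (norm_mul_le _ _).trans (by nlinarith [norm_nonneg (x - y), norm_nonneg (evalWord a w)])
    have h3 : ‖y * (evalWord a w - evalWord b w)‖ ≤ w.length * δ :=
      (norm_mul_le _ _).trans
        (by nlinarith [norm_nonneg y, norm_nonneg (evalWord a w - evalWord b w)])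
    refine (norm_add_le _ _).trans ?_
    push_cast [List.length_cons]
    linarith

lemma matrix_norm_one_le (p : ℕ) : ‖(1 : Matrix (Fin p) (Fin p) ℂ)‖ ≤ 1 := by
  rcases Nat.eq_zero_or_pos p with hp | hp
  · subst hp
    rw [Subsingleton.elim (1 : Matrix (Fin 0) (Fin 0) ℂ) 0, norm_zero]; exact zero_le_one
  · have : Nonempty (Fin p) := ⟨⟨0, hp⟩⟩
    exact (CStarRing.norm_one).le

/-- The moments of a tuple of contractions in `M_p(ℂ)` are limits of moments of tuples of
contractions in `𝓡`. -/
lemma exists_hyperfinite_near {ι : Type} {p : ℕ} (hp : 0 < p) (A : ι → Matrix (Fin p) (Fin p) ℂ)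
    (hA : ∀ i, ‖A i‖ ≤ 1) {ε : ℝ} (hε : 0 < ε) :
    ∃ a : ι → hyperfinite.toStarSubalgebra, (∀ i, ‖a i‖ ≤ 1) ∧
      ∀ w, ‖hyperfiniteTr (evalWord a w) - ntr p (evalWord A w)‖ ≤ ε := by
  have hp' : (0 : ℝ) < p := by exact_mod_cast hp
  -- With p/ε < 2^m the zero block, of size r < p, takes up at most the proportion ε of the trace.
  obtain ⟨m, hm⟩ := pow_unbounded_of_one_lt (p / ε : ℝ) one_lt_two
  have h2 : p * (2 ^ m / p) + 2 ^ m % p = 2 ^ m := Nat.div_add_mod _ _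
  have hr : 2 ^ m % p < p := Nat.mod_lt _ hp
  generalize 2 ^ m / p = q at h2
  generalize 2 ^ m % p = r at h2 hr
  -- Stated for a variable `N`, so that the size `2 ^ m` can be used without casting matrices.
  have key : ∀ N, N = p * q + r → ∃ B : ι → Matrix (Fin N) (Fin N) ℂ, (∀ i, ‖B i‖ ≤ 1) ∧
      ∀ w, w ≠ [] → Matrix.trace (evalWord B w) = q * Matrix.trace (evalWord A w) := by
    rintro _ rfl
    refine ⟨fun i => blockCopies p q r (A i), fun i =>
      (NonUnitalStarAlgHom.norm_apply_le _ (A i)).trans (hA i), fun w hw => ?_⟩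
    rw [evalWord_map _ _ _ hw, trace_blockCopies]
  obtain ⟨B, hB, ht⟩ := key (2 ^ m) h2.symm
  obtain ⟨a, ha, hta⟩ := exists_hyperfinite_of_matrix m B hB
  refine ⟨a, ha, fun w => ?_⟩
  rw [hta]
  by_cases hw : w = []
  · subst hw
    rw [evalWord_nil, evalWord_nil, ntr_one hp, ntr_one (by positivity), sub_self, norm_zero]
    exact hε.le
  · have hpc : (p : ℂ) ≠ 0 := by exact_mod_cast hp.ne'
    have h2c : ((2 ^ m : ℕ) : ℂ) = p * q + r := by rw [← h2]; push_cast; ring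
    have h2n : ((2 ^ m : ℕ) : ℂ) ≠ 0 := by positivity
    -- Only the proportion pq/2^m = 1 - r/2^m of the normalized trace survives.
    have e : ntr (2 ^ m) (evalWord B w) - ntr p (evalWord A w) =
        (-(r / (2 ^ m : ℕ)) : ℂ) * ntr p (evalWord A w) := by
      simp only [ntr, LinearMap.smul_apply, Matrix.traceLinearMap_apply, smul_eq_mul, ht w hw]
      field_simp
      rw [h2c]; ring
    rw [e, norm_mul, norm_neg, norm_div, Complex.norm_natCast, Complex.norm_natCast]
    have h3 : ‖ntr p (evalWord A w)‖ ≤ 1 := (norm_ntr_le _ _).trans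
      (norm_evalWord_le_one (matrix_norm_one_le p) A w fun l _ => hA l.1)
    have h4 : (r : ℝ) / (2 ^ m : ℕ) ≤ ε := by
      rw [div_le_iff₀ (by positivity)]
      have h5 : (r : ℝ) ≤ p := by exact_mod_cast hr.le
      rw [div_lt_iff₀ hε] at hm
      push_cast
      linarith
    exact (mul_le_of_le_one_right (by positivity) h3).trans h4

end

/-! ### Norm bounds for traces on von Neumann algebras -/

section Trace

variable {H : Type} [NormedAddCommGroup H] [InnerProductSpace ℂ H] [CompleteSpace H]
  {M : VonNeumannAlgebra H}

lemma norm_one_le_one (M : VonNeumannAlgebra H) : ‖(1 : M.toStarSubalgebra)‖ ≤ 1 :=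
  ContinuousLinearMap.norm_id_le

/-- Commutants are norm closed. This makes the algebra a C*-algebra, to which `exists_one_sub_eq`
applies. -/
lemma isClosed_vonNeumannAlgebra (M : VonNeumannAlgebra H) :
    IsClosed (M.toStarSubalgebra : Set (H →L[ℂ] H)) := by
  have h := M.centralizer_centralizer
  have h2 : (M.toStarSubalgebra : Set (H →L[ℂ] H)) = (M : Set (H →L[ℂ] H)) := rfl
  rw [h2, ← h]
  exact Set.isClosed_centralizer _

/-- In the spectral order x* x ≤ 1, and nonnegative elements have the form s* s, the only form on
which `IsTrace` postulates positivity. -/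
lemma exists_one_sub_eq {A : Type*} [CStarAlgebra A] (x : A) (hx : ‖x‖ ≤ 1) :
    ∃ s : A, 1 - star x * x = star s * s := by
  let _ : PartialOrder A := CStarAlgebra.spectralOrder _
  have : StarOrderedRing A := CStarAlgebra.spectralOrderedRing _
  have h1 : star x * x ≤ 1 := by
    rw [← CStarAlgebra.norm_le_one_iff_of_nonneg _ (star_mul_self_nonneg x),
      CStarRing.norm_star_mul_self]
    exact mul_le_one₀ hx (norm_nonneg _) hx
  exact CStarAlgebra.nonneg_iff_eq_star_mul_self.1 (sub_nonneg.2 h1)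

/-- Realness of the trace at (x + 1)*(x + 1) and (x + i)*(x + i) kills the imaginary part of τ(x*) +
τ(x) and the real part of τ(x*) - τ(x). -/
lemma IsTrace.map_star {τ : M.toStarSubalgebra →ₗ[ℂ] ℂ} (hτ : IsTrace M τ)
    (x : M.toStarSubalgebra) : τ (star x) = star (τ x) := by
  have h0 := (hτ.nonneg x).2
  have e1 : star (x + 1) * (x + 1) = star x * x + star x + x + 1 := by
    rw [star_add, star_one]; noncomm_ring
  have e2 : star (x + Complex.I • 1) * (x + Complex.I • 1) =
      star x * x + Complex.I • star x - Complex.I • x + 1 := by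
    rw [star_add, star_smul, star_one, add_mul, mul_add, mul_add, mul_smul_comm, smul_mul_assoc,
      smul_mul_smul_comm]
    simp
    abel
  have h1 := (hτ.nonneg (x + 1)).2
  have h2 := (hτ.nonneg (x + Complex.I • 1)).2
  rw [e1] at h1
  rw [e2] at h2
  simp only [map_add, map_sub, map_smul, hτ.map_one, Complex.add_im, Complex.sub_im, h0,
    smul_eq_mul, Complex.mul_im, Complex.I_re, Complex.I_im, Complex.one_im] at h1 h2
  apply Complex.ext
  · simp; linarith
  · simp; linarith

/-- Positivity at x - τ(x)1 is the Cauchy–Schwarz inequality |τ(x)|² ≤ τ(x* x), and the right side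
is at most 1 because 1 - x* x = s* s. This is needed for arbitrary tracial algebras, since universal
sentences must be nonnegative in all of them. -/
lemma IsTrace.norm_le_one {τ : M.toStarSubalgebra →ₗ[ℂ] ℂ} (hτ : IsTrace M τ)
    {x : M.toStarSubalgebra} (hx : ‖x‖ ≤ 1) : ‖τ x‖ ≤ 1 := by
  have := isClosed_vonNeumannAlgebra M
  obtain ⟨s, hs⟩ := exists_one_sub_eq x hx
  have h1 := (hτ.nonneg s).1
  rw [← hs, map_sub, hτ.map_one, Complex.sub_re, Complex.one_re] at h1
  have h2 := (hτ.nonneg (x - τ x • 1)).1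
  have e : star (x - τ x • 1) * (x - τ x • 1) =
      star x * x - τ x • star x - star (τ x) • x + (star (τ x) * τ x) • 1 := by
    rw [star_sub, star_smul, star_one, sub_mul, mul_sub, mul_sub, mul_smul_comm, smul_mul_assoc,
      smul_mul_smul_comm]
    simp
    abel
  rw [e] at h2
  simp only [map_add, map_sub, map_smul, hτ.map_one, hτ.map_star, smul_eq_mul, mul_one,
    Complex.add_re, Complex.sub_re] at h2
  have e2 : star (τ x) * τ x = ((‖τ x‖ ^ 2 : ℝ) : ℂ) := by
    rw [Complex.star_def, ← Complex.normSq_eq_conj_mul_self, Complex.normSq_eq_norm_sq]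
  rw [mul_comm (τ x), e2, Complex.ofReal_re] at h2
  have h3 : ‖τ x‖ ^ 2 ≤ 1 := by linarith
  exact (sq_le_one_iff₀ (norm_nonneg _)).1 h3

lemma hyperfiniteTr_norm_le {x : hyperfinite.toStarSubalgebra} (hx : ‖x‖ ≤ 1) :
    ‖hyperfiniteTr x‖ ≤ 1 := by
  rw [hyperfiniteTr_apply]
  refine (norm_inner_le_norm _ _).trans ?_
  rw [norm_vec_one, one_mul]
  have := ContinuousLinearMap.le_of_opNorm_le (x : L2 →L[ℂ] L2) (show _ ≤ 1 from hx) (vec 1)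
  rwa [norm_vec_one, one_mul] at this

end Trace

/-! ## Moments and formulas -/

section Moments

lemma evalWord_congr {ι A : Type} [Monoid A] [Star A] {a b : ι → A} {w : List (ι × Bool)}
    (h : ∀ l ∈ w, a l.1 = b l.1) : evalWord a w = evalWord b w := by
  unfold evalWord
  congr 1
  exact List.map_congr_left fun l hl => by rw [h l hl]

lemma evalWord_mapLetters {ι κ A : Type} [Monoid A] [Star A] (f : ι → κ) (a : κ → A)
    (w : List (ι × Bool)) :
    evalWord a (w.map fun l => (f l.1, l.2)) = evalWord (fun i => a (f i)) w := by
  simp [evalWord, Function.comp_def]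

lemma extendTuple_val {A : Type} [Zero A] {n : ℕ} (a : Fin n → A) :
    (fun i : Fin n => extendTuple a i) = a := by
  funext i
  simp [extendTuple]

lemma extendTuple_of_lt {A : Type} [Zero A] {n i : ℕ} (a : ℕ → A) (hi : i < n) :
    extendTuple (fun j : Fin n => a j) i = a i := by
  simp [extendTuple, hi]

lemma extendTuple_succ {A : Type} [Zero A] {n : ℕ} (a : Fin n → A) :
    extendTuple (fun j : Fin (n + 1) => extendTuple a j) = extendTuple a := by
  funext i
  by_cases h : i < n + 1
  · exact extendTuple_of_lt (extendTuple a) h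
  · simp [extendTuple, h, show ¬ i < n by omega]

lemma norm_extendTuple_le {A : Type} [SeminormedAddCommGroup A] {n : ℕ} {a : Fin n → A}
    (ha : ∀ i, ‖a i‖ ≤ 1) (i : ℕ) : ‖extendTuple a i‖ ≤ 1 := by
  unfold extendTuple
  split_ifs
  · exact ha _
  · rw [norm_zero]; exact zero_le_one

variable {A B : Type} [Ring A] [Star A] [Ring B] [Star B]

lemma norm_sub_le_of_dist_moments_le {τ : A → ℂ} {τ' : B → ℂ} {n d : ℕ} {a : Fin n → A}
    {b : Fin n → B} {ε : ℝ} (h : dist (moments τ n d a) (moments τ' n d b) ≤ ε)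
    {w : List (ℕ × Bool)} (hw : ∀ l ∈ w, l.1 < n) (hd : w.length ≤ d) :
    ‖τ (evalWord (extendTuple a) w) - τ' (evalWord (extendTuple b) w)‖ ≤ ε := by
  let m : Monomial n d := ⟨⟨w.length, Nat.lt_succ_of_le hd⟩,
    fun j => (⟨(w.get j).1, hw _ (List.get_mem w j)⟩, (w.get j).2)⟩
  have hm : (List.ofFn m.2).map (fun l => ((l.1 : ℕ), l.2)) = w := by
    rw [List.map_ofFn]
    exact List.ofFn_get w
  have h1 := PiLp.norm_apply_le (p := 2) (moments τ n d a - moments τ' n d b) m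
  rw [← dist_eq_norm] at h1
  refine le_trans (le_of_eq ?_) (h1.trans h)
  rw [← hm, evalWord_mapLetters, evalWord_mapLetters, extendTuple_val, extendTuple_val]
  rfl

/-- The Euclidean norm is at most the number of monomials times the largest coordinate. The explicit
bound on that number can be computed by the algorithm; the base `2 * n + 1` keeps its powers
monotone even for `n = 0`. -/
lemma dist_moments_le {τ : A → ℂ} {τ' : B → ℂ} {n d : ℕ} {a : Fin n → A}
    {b : Fin n → B} {ε : ℝ} (hε : 0 ≤ ε)
    (h : ∀ w : List (ℕ × Bool), (∀ l ∈ w, l.1 < n) → w.length ≤ d →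
      ‖τ (evalWord (extendTuple a) w) - τ' (evalWord (extendTuple b) w)‖ ≤ ε) :
    dist (moments τ n d a) (moments τ' n d b) ≤ ((d + 1) * (2 * n + 1) ^ d : ℕ) * ε := by
  have h1 : ∀ m : Monomial n d, ‖(moments τ n d a - moments τ' n d b) m‖ ≤ ε := by
    intro m
    have := h ((List.ofFn m.2).map fun l => ((l.1 : ℕ), l.2)) (by simp) (by
      have := m.1.2
      simp only [List.length_map, List.length_ofFn]
      omega)
    rw [evalWord_mapLetters, evalWord_mapLetters, extendTuple_val, extendTuple_val] at this
    exact this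
  have hcard : Fintype.card (Monomial n d) ≤ (d + 1) * (2 * n + 1) ^ d := by
    rw [Fintype.card_sigma]
    calc ∑ j : Fin (d + 1), Fintype.card (Fin j → Fin n × Bool)
        ≤ ∑ _j : Fin (d + 1), (2 * n + 1) ^ d := by
          refine Finset.sum_le_sum fun j _ => ?_
          simp only [Fintype.card_fun, Fintype.card_prod, Fintype.card_fin, Fintype.card_bool]
          calc (n * 2) ^ (j : ℕ) ≤ (2 * n + 1) ^ (j : ℕ) := Nat.pow_le_pow_left (by omega) _
            _ ≤ (2 * n + 1) ^ d := Nat.pow_le_pow_right (by omega) (Nat.lt_succ_iff.1 j.2)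
      _ = (d + 1) * (2 * n + 1) ^ d := by simp
  have hcard' : (Fintype.card (Monomial n d) : ℝ) ≤ ((d + 1) * (2 * n + 1) ^ d : ℕ) := by
    exact_mod_cast hcard
  rw [dist_eq_norm, EuclideanSpace.norm_eq]
  calc √(∑ m, ‖(moments τ n d a - moments τ' n d b) m‖ ^ 2)
      ≤ √((Fintype.card (Monomial n d) * ε) ^ 2) := by
        apply Real.sqrt_le_sqrt
        calc ∑ m, ‖(moments τ n d a - moments τ' n d b) m‖ ^ 2
            ≤ (∑ m, ‖(moments τ n d a - moments τ' n d b) m‖) ^ 2 :=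
              Finset.sum_sq_le_sq_sum_of_nonneg fun _ _ => norm_nonneg _
          _ ≤ (∑ _m : Monomial n d, ε) ^ 2 :=
              pow_le_pow_left₀ (Finset.sum_nonneg fun _ _ => norm_nonneg _)
                (Finset.sum_le_sum fun m _ => h1 m) 2
          _ = _ := by simp
    _ = Fintype.card (Monomial n d) * ε := Real.sqrt_sq (by positivity)
    _ ≤ _ := mul_le_mul_of_nonneg_right hcard' hε

end Moments

/-! ### Uniform approximation of moments by one matrix algebra -/

section Uniform

open scoped Matrix.Norms.L2Operator

/-- One matrix algebra `M_{2^m}(ℂ)` suffices to approximate all moments in `X(n, d)`. -/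
lemma exists_uniform_approx (n d : ℕ) {ε : ℝ} (hε : 0 < ε) :
    ∃ m : ℕ, ∀ a : Fin n → hyperfinite.toStarSubalgebra, (∀ i, ‖a i‖ ≤ 1) →
      ∃ b : Fin n → Matrix (Fin (2 ^ m)) (Fin (2 ^ m)) ℂ, (∀ i, ‖b i‖ ≤ 1) ∧
        dist (moments hyperfiniteTr n d a) (moments (ntr (2 ^ m)) n d b) ≤ ε := by
  have hbdd : Bornology.IsBounded (momentSet n d) := by
    refine (Metric.isBounded_iff_subset_closedBall (moments hyperfiniteTr n d 0)).2
      ⟨((d + 1) * (2 * n + 1) ^ d : ℕ) * 2, ?_⟩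
    rintro _ ⟨a, ha, rfl⟩
    rw [Metric.mem_closedBall]
    refine dist_moments_le zero_le_two fun w _ _ => ?_
    refine (norm_sub_le _ _).trans ?_
    have h : ∀ b : ℕ → hyperfinite.toStarSubalgebra, (∀ i, ‖b i‖ ≤ 1) →
        ‖hyperfiniteTr (evalWord b w)‖ ≤ 1 := fun b hb =>
      hyperfiniteTr_norm_le (norm_evalWord_le_one (norm_one_le_one _) b w fun l _ => hb l.1)
    have h1 := h _ (norm_extendTuple_le ha)
    have h2 := h (extendTuple (0 : Fin n → hyperfinite.toStarSubalgebra))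
      (norm_extendTuple_le fun i => by simp)
    linarith
  -- A bounded set in finite dimension is totally bounded. The centres are chosen in X(n,d), and a
  -- single large `m` serves all of the finitely many.
  obtain ⟨t, hts, htf, hcov⟩ := Metric.finite_approx_of_totallyBounded
    (hbdd.isCompact_closure.totallyBounded.subset subset_closure) (ε / 2) (by positivity)
  have hev : ∀ s ∈ t, ∀ᶠ m in atTop,
      ∃ b : Fin n → Matrix (Fin (2 ^ m)) (Fin (2 ^ m)) ℂ, (∀ i, ‖b i‖ ≤ 1) ∧
        dist (moments (ntr (2 ^ m)) n d b) s < ε / 2 := by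
    intro s hs
    obtain ⟨a, ha, rfl⟩ := hts hs
    have hlim : Tendsto
        (fun m => moments (ntr (2 ^ m)) n d fun i => compression m (a i)) atTop
        (𝓝 (moments hyperfiniteTr n d a)) := by
      refine ((PiLp.continuous_toLp 2 _).tendsto _).comp (tendsto_pi_nhds.2 fun w => ?_)
      exact tendsto_compression a (List.ofFn w.2)
    filter_upwards [hlim (Metric.ball_mem_nhds _ (half_pos hε))] with m hm
    exact ⟨_, fun i => norm_compression_le_one m (ha i), hm⟩
  obtain ⟨m, hm⟩ := ((Filter.eventually_all_finite htf).2 hev).exists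
  refine ⟨m, fun a ha => ?_⟩
  obtain ⟨s, hs, has⟩ := Set.mem_iUnion₂.1 (hcov ⟨a, ha, rfl⟩)
  obtain ⟨b, hb, hbs⟩ := hm s hs
  refine ⟨b, hb, ?_⟩
  have h1 : dist (moments hyperfiniteTr n d a) s < ε / 2 := has
  have := dist_triangle_right (moments hyperfiniteTr n d a) (moments (ntr (2 ^ m)) n d b) s
  linarith

end Uniform

/-! ### Dependence of formulas on moments -/

section Formulas

/-- A bound for the sum of the absolute values of the coefficients. -/
def coeffSum (P : PolyCode) : ℕ :=
  P.foldr (fun t s => t.1.1.1.natAbs + t.1.2.1.natAbs + s) 0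

/-- A bound for the degree. -/
def lenSum (P : PolyCode) : ℕ := P.foldr (fun t s => t.2.length + s) 0

def coeffSumList (L : List BasicCode) : ℕ := L.foldr (fun φ s => coeffSum φ.2 + s) 0

def lenSumList (L : List BasicCode) : ℕ := L.foldr (fun φ s => lenSum φ.2 + s) 0

lemma le_foldr_add {α : Type*} (f : α → ℕ) {L : List α} {x : α} (hx : x ∈ L) :
    f x ≤ L.foldr (fun y s => f y + s) 0 := by
  induction L with
  | nil => simp at hx
  | cons y L ih =>
    rw [List.foldr_cons]
    rcases List.mem_cons.1 hx with rfl | hx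
    · omega
    · have := ih hx; omega

variable {α : Type*} [Primcodable α]

@[fun_prop] lemma primrec_coeffSum {f : α → PolyCode} (hf : Primrec f) :
    Primrec fun a => coeffSum (f a) := by
  unfold coeffSum
  exact primrec_list_foldr hf (by fun_prop) (by fun_prop)

@[fun_prop] lemma primrec_lenSum {f : α → PolyCode} (hf : Primrec f) :
    Primrec fun a => lenSum (f a) := by
  unfold lenSum
  exact primrec_list_foldr hf (by fun_prop) (by fun_prop)

@[fun_prop] lemma primrec_coeffSumList {f : α → List BasicCode} (hf : Primrec f) :
    Primrec fun a => coeffSumList (f a) := by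
  unfold coeffSumList
  exact primrec_list_foldr hf (by fun_prop) (by fun_prop)

@[fun_prop] lemma primrec_lenSumList {f : α → List BasicCode} (hf : Primrec f) :
    Primrec fun a => lenSumList (f a) := by
  unfold lenSumList
  exact primrec_list_foldr hf (by fun_prop) (by fun_prop)

lemma abs_ratVal_le (q : RatCode) : |(ratVal q : ℝ)| ≤ q.1.natAbs := by
  have h : (q.1.natAbs : ℝ) = |(q.1 : ℝ)| := by
    rw [Nat.cast_natAbs]; push_cast; rfl
  rw [ratVal, h]
  push_cast
  rw [abs_div]
  refine div_le_self (abs_nonneg _) ?_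
  rw [abs_of_nonneg (by positivity)]
  linarith [(Nat.cast_nonneg q.2 : (0 : ℝ) ≤ q.2)]

lemma norm_coeffVal_le (c : CRat) : ‖coeffVal c‖ ≤ c.1.1.natAbs + c.2.1.natAbs :=
  (Complex.norm_le_abs_re_add_abs_im _).trans (add_le_add (abs_ratVal_le _) (abs_ratVal_le _))

variable {A B : Type} [Ring A] [StarRing A] [Algebra ℂ A] [Ring B] [StarRing B] [Algebra ℂ B]

lemma evalPoly_cons (t : CRat × List (ℕ × Bool)) (P : PolyCode) (a : ℕ → A) :
    evalPoly (t :: P) a = coeffVal t.1 • evalWord a t.2 + evalPoly P a := by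
  simp [evalPoly]

lemma norm_evalPoly_sub_le (τ : A →ₗ[ℂ] ℂ) (τ' : B →ₗ[ℂ] ℂ) (P : PolyCode) (a : ℕ → A) (b : ℕ → B)
    {ε : ℝ} (h : ∀ t ∈ P, ‖τ (evalWord a t.2) - τ' (evalWord b t.2)‖ ≤ ε) :
    ‖τ (evalPoly P a) - τ' (evalPoly P b)‖ ≤ coeffSum P * ε := by
  induction P with
  | nil => simp [evalPoly, coeffSum]
  | cons t P ih =>
    have ih' := ih fun s hs => h s (List.mem_cons_of_mem _ hs)
    have ht := h t List.mem_cons_self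
    have e : τ (evalPoly (t :: P) a) - τ' (evalPoly (t :: P) b) =
        coeffVal t.1 * (τ (evalWord a t.2) - τ' (evalWord b t.2)) +
          (τ (evalPoly P a) - τ' (evalPoly P b)) := by
      rw [evalPoly_cons, evalPoly_cons, map_add, map_add, map_smul, map_smul, smul_eq_mul,
        smul_eq_mul]
      ring
    have hs : (coeffSum (t :: P) : ℝ) = (t.1.1.1.natAbs + t.1.2.1.natAbs) + coeffSum P := by
      simp [coeffSum]
    rw [e, hs, add_mul]
    refine (norm_add_le _ _).trans (add_le_add ?_ ih')
    rw [norm_mul]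
    exact mul_le_mul (norm_coeffVal_le t.1) ht (norm_nonneg _) (by positivity)

lemma abs_evalBasic_le (τ : A → ℂ) (φ : BasicCode) (a : ℕ → A) :
    |evalBasic τ φ a| ≤ ‖τ (evalPoly φ.2 a)‖ := by
  unfold evalBasic
  split_ifs
  · exact Complex.abs_im_le_norm _
  · exact Complex.abs_re_le_norm _

lemma abs_evalBasic_sub_le (τ : A → ℂ) (τ' : B → ℂ) (φ : BasicCode) (a : ℕ → A) (b : ℕ → B) :
    |evalBasic τ φ a - evalBasic τ' φ b| ≤ ‖τ (evalPoly φ.2 a) - τ' (evalPoly φ.2 b)‖ := by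
  unfold evalBasic
  split_ifs
  · rw [← Complex.sub_im]; exact Complex.abs_im_le_norm _
  · rw [← Complex.sub_re]; exact Complex.abs_re_le_norm _

end Formulas

/-! ## From the function `F` to the universal theory -/

section Search

variable {α β : Type*} [Primcodable α] [Primcodable β]

/-- Unbounded search for a witness of a decidable predicate. -/
lemma exists_partrec_search {test : α → ℕ → Bool} {out : α → ℕ → β}
    (ht : Computable fun x : α × ℕ => test x.1 x.2)
    (ho : Computable fun x : α × ℕ => out x.1 x.2) :
    ∃ f : α →. β, Partrec f ∧
      ∀ a, (∃ n, test a n = true) → ∃ n, test a n = true ∧ out a n ∈ f a := by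
  have hs : Partrec fun a => Nat.rfind fun n => Part.some (test a n) :=
    Partrec.rfind (p := fun a n => Part.some (test a n)) ht.partrec
  refine ⟨fun a => (Nat.rfind fun n => Part.some (test a n)).map (out a), hs.map ho, ?_⟩
  rintro a ⟨n, hn⟩
  obtain ⟨m, hm, -⟩ := Nat.rfind_min' (p := test a) hn
  refine ⟨m, ?_, Part.mem_map _ hm⟩
  simpa using (Nat.rfind_spec hm)

end Search

/-! ### Values of sentences as maxima over nets -/

section

open scoped Matrix.Norms.L2Operator

variable {A B : Type} [Ring A] [StarRing A] [Algebra ℂ A] [Ring B] [StarRing B] [Algebra ℂ B]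

lemma getD_map_eq {L : List BasicCode} {m : ℕ} (hL : L.length = m) (f : BasicCode → ℝ)
    (j : Fin m) : ((L.map f)[(j : ℕ)]?).getD 0 = f (L.get (Fin.cast hL.symm j)) := by
  have : (j : ℕ) < L.length := hL ▸ j.2
  simp [this]

/-- The value of the quantifier-free part of a sentence at a sequence. -/
noncomputable def evalSeq (C : Connectives) (τ : A → ℂ) (σ : SentenceCode) (a : ℕ → A) : ℝ :=
  C.fn σ.1.2 fun j => ((σ.2.map fun φ => evalBasic τ φ a)[(j : ℕ)]?).getD 0

/-- `δ` is a modulus of uniform continuity of the connectives. -/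
def IsModulus (C : Connectives) (δ : (ℕ × ℕ) × ℕ → ℕ) : Prop :=
  ∀ (i N k : ℕ) (x y : Fin (C.arity i) → ℝ),
    (∀ j, |x j| ≤ N) → (∀ j, |y j| ≤ N) →
    (∀ j, |x j - y j| ≤ 1 / ((δ ((i, N), k) : ℝ) + 1)) →
    |C.fn i x - C.fn i y| ≤ 1 / ((k : ℝ) + 1)

/-- `v` computes approximations of the values of the connectives at rational points. -/
def IsValues (C : Connectives) (v : (ℕ × List RatCode) × ℕ → RatCode) : Prop :=
  ∀ (i : ℕ) (q : List RatCode) (k : ℕ) (hq : q.length = C.arity i),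
    |C.fn i (fun j => (ratVal (q.get (Fin.cast hq.symm j)) : ℝ)) - (ratVal (v ((i, q), k)) : ℝ)|
      ≤ 1 / ((k : ℝ) + 1)

/-- The basic formulas take values in [-1, 1], so the modulus on the box with `N = 1` is enough. -/
lemma abs_evalSeq_sub_le {C : Connectives} {δ : (ℕ × ℕ) × ℕ → ℕ} (hδ : IsModulus C δ)
    {σ : SentenceCode} (hlen : σ.2.length = C.arity σ.1.2) (k : ℕ) {τ : A → ℂ} {τ' : B → ℂ}
    {a : ℕ → A} {b : ℕ → B} (ha : ∀ φ ∈ σ.2, |evalBasic τ φ a| ≤ 1)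
    (hb : ∀ φ ∈ σ.2, |evalBasic τ' φ b| ≤ 1)
    (hab : ∀ φ ∈ σ.2, |evalBasic τ φ a - evalBasic τ' φ b| ≤ 1 / ((δ ((σ.1.2, 1), k) : ℝ) + 1)) :
    |evalSeq C τ σ a - evalSeq C τ' σ b| ≤ 1 / ((k : ℝ) + 1) := by
  refine hδ σ.1.2 1 k _ _ (fun j => ?_) (fun j => ?_) fun j => ?_
  · rw [getD_map_eq hlen, Nat.cast_one]; exact ha _ (List.get_mem _ _)
  · rw [getD_map_eq hlen, Nat.cast_one]; exact hb _ (List.get_mem _ _)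
  · rw [getD_map_eq hlen, getD_map_eq hlen]; exact hab _ (List.get_mem _ _)

lemma abs_evalSeq_grid_sub_le {C : Connectives} {v : (ℕ × List RatCode) × ℕ → RatCode}
    (hv : IsValues C v) {σ : SentenceCode} (hlen : σ.2.length = C.arity σ.1.2) (k : ℕ)
    {p : ℕ} (hp : 0 < p) (N c : ℕ) :
    |evalSeq C (ntr p) σ (gridMat p N c) -
      (ratVal (v ((σ.1.2, σ.2.map fun φ => gridBasic p N c φ), k)) : ℝ)| ≤ 1 / ((k : ℝ) + 1) := by
  have h := hv σ.1.2 (σ.2.map fun φ => gridBasic p N c φ) k (by rw [List.length_map, hlen])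
  refine le_trans (le_of_eq ?_) h
  congr 2
  unfold evalSeq
  congr 1
  funext j
  rw [getD_map_eq hlen, ← ratVal_gridBasic hp]
  simp

/-- Every tuple in a net of contractions has moments close to those of a tuple in `𝓡`. -/
lemma exists_hyperfinite_near_net {n p M c : ℕ} (hp : 0 < p) (hM : 0 < M)
    (hc : inNet n p M c = true) {ε : ℝ} (hε : 0 < ε) :
    ∃ a : Fin n → hyperfinite.toStarSubalgebra, (∀ i, ‖a i‖ ≤ 1) ∧
      ∀ w : List (ℕ × Bool), (∀ l ∈ w, l.1 < n) →
        ‖hyperfiniteTr (evalWord (extendTuple a) w) -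
          ntr p (evalWord (gridMat p (4 * p * M) c) w)‖ ≤ ε := by
  obtain ⟨a, ha, h⟩ := exists_hyperfinite_near hp
    (fun l : ℕ => if l < n then gridMat p (4 * p * M) c l else 0) (fun l => by
      split_ifs with hl
      · exact norm_le_one_of_inNet hp hM hc hl
      · rw [norm_zero]; exact zero_le_one) hε
  refine ⟨fun i => a i, fun i => ha i, fun w hw => ?_⟩
  rw [evalWord_congr (a := extendTuple fun i : Fin n => a i) (b := a)
    fun l hl => extendTuple_of_lt a (hw l hl)]
  rw [evalWord_congr (a := gridMat p (4 * p * M) c)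
    (b := fun l : ℕ => if l < n then gridMat p (4 * p * M) c l else 0)
    fun l hl => by simp [hw l hl]]
  exact h w

/-- Every tuple of contractions has moments close to those of a tuple in the net. -/
lemma exists_net_near {n p M : ℕ} (hp : 0 < p) (hM : 0 < M) (A : Fin n → Matrix (Fin p) (Fin p) ℂ)
    (hA : ∀ i, ‖A i‖ ≤ 1) :
    ∃ c < netBound n p M, inNet n p M c = true ∧ ∀ w : List (ℕ × Bool), (∀ l ∈ w, l.1 < n) →
        ‖ntr p (evalWord (extendTuple A) w) - ntr p (evalWord (gridMat p (4 * p * M) c) w)‖ ≤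
          w.length * (2 / M) := by
  obtain ⟨c, hc, hin, h⟩ := exists_inNet (n := n) hp hM (extendTuple A)
    fun l _ => norm_extendTuple_le hA l
  refine ⟨c, hc, hin, fun w hw => ?_⟩
  rw [← map_sub]
  refine (norm_ntr_le _ _).trans (norm_evalWord_sub_le (matrix_norm_one_le p) _ _ w
    (fun l _ => norm_extendTuple_le hA _)
    (fun l hl => norm_le_one_of_inNet hp hM hin (hw l hl)) fun l hl => ?_)
  rw [norm_sub_rev]
  exact h _ (hw l hl)

lemma coeffSum_le {L : List BasicCode} {φ : BasicCode} (hφ : φ ∈ L) :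
    coeffSum φ.2 ≤ coeffSumList L := le_foldr_add (fun φ : BasicCode => coeffSum φ.2) hφ

lemma length_le_lenSumList {L : List BasicCode} {φ : BasicCode} (hφ : φ ∈ L)
    {t : CRat × List (ℕ × Bool)} (ht : t ∈ φ.2) : t.2.length ≤ lenSumList L :=
  (le_foldr_add (fun t : CRat × List (ℕ × Bool) => t.2.length) ht).trans
    (le_foldr_add (fun φ : BasicCode => lenSum φ.2) hφ)

lemma abs_evalBasic_hyperfinite_le {n : ℕ} {φ : BasicCode} (hφ : IsFunctionSymbol n φ.2)
    {a : Fin n → hyperfinite.toStarSubalgebra} (ha : ∀ i, ‖a i‖ ≤ 1) :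
    |evalBasic hyperfiniteTr φ (extendTuple a)| ≤ 1 :=
  (abs_evalBasic_le _ _ _).trans (hyperfiniteTr_norm_le (hφ.2 L2 hyperfinite a ha))

/-- Closeness of the values of basic formulas. -/
lemma abs_evalBasic_sub_le_of_words {L : List BasicCode} {n : ℕ} (hL : ∀ φ ∈ L, φ.2.VarsLT n)
    (τ : A →ₗ[ℂ] ℂ) (τ' : B →ₗ[ℂ] ℂ) {a : ℕ → A} {b : ℕ → B} {ε : ℝ} (hε : 0 ≤ ε)
    (h : ∀ w : List (ℕ × Bool), (∀ l ∈ w, l.1 < n) → w.length ≤ lenSumList L →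
      ‖τ (evalWord a w) - τ' (evalWord b w)‖ ≤ ε) {φ : BasicCode} (hφ : φ ∈ L) :
    |evalBasic τ φ a - evalBasic τ' φ b| ≤ coeffSumList L * ε := by
  refine (abs_evalBasic_sub_le _ _ _ _ _).trans ((norm_evalPoly_sub_le τ τ' φ.2 a b fun t ht =>
    h t.2 (hL φ hφ t ht) (length_le_lenSumList hφ ht)).trans ?_)
  exact mul_le_mul_of_nonneg_right (by exact_mod_cast coeffSum_le hφ) hε

/-- Function symbols are bounded on von Neumann algebras by definition. The bound passes to the
matrices of the net because their moments are limits of moments in 𝓡. -/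
lemma abs_evalBasic_net_le {n p M c : ℕ} (hp : 0 < p) (hM : 0 < M)
    (hc : inNet n p M c = true) {φ : BasicCode} (hφ : IsFunctionSymbol n φ.2) :
    |evalBasic (ntr p) φ (gridMat p (4 * p * M) c)| ≤ 1 := by
  refine le_of_forall_pos_le_add fun ε hε => ?_
  have hpos : (0 : ℝ) < coeffSumList [φ] + 1 := by positivity
  obtain ⟨a, ha, h⟩ := exists_hyperfinite_near_net hp hM hc (div_pos hε hpos)
  have h1 := abs_evalBasic_hyperfinite_le hφ ha
  have h2 := abs_evalBasic_sub_le_of_words (L := [φ]) (n := n) (by simpa using hφ.1)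
    hyperfiniteTr (ntr p) (div_pos hε hpos).le (fun w hw _ => h w hw) (List.mem_singleton_self φ)
  have h3 : (coeffSumList [φ] : ℝ) * (ε / (coeffSumList [φ] + 1)) ≤ ε := by
    rw [mul_div_assoc', div_le_iff₀ hpos]
    nlinarith
  have h4 := abs_sub_abs_le_abs_sub (evalBasic (ntr p) φ (gridMat p (4 * p * M) c))
    (evalBasic hyperfiniteTr φ (extendTuple a))
  rw [abs_sub_comm] at h4
  linarith

/-- The parameters of the approximation: the precision `k` of the moments. -/
def momentPrec (δ : (ℕ × ℕ) × ℕ → ℕ) (σ : SentenceCode) (K : ℕ) : ℕ :=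
  2 * (δ ((σ.1.2, 1), K) + 1) * (coeffSumList σ.2 + 1)

/-- A sentence may have no variables, whereas `F` is specified only for positive `n`; one dummy
variable is added throughout. -/
lemma IsFunctionSymbol.mono_succ {n : ℕ} {P : PolyCode} (h : IsFunctionSymbol n P) :
    IsFunctionSymbol (n + 1) P := by
  refine ⟨fun t ht l hl => (h.1 t ht l hl).trans (Nat.lt_succ_self n), ?_⟩
  intro H _ _ _ M a ha
  have h1 := h.2 H M (fun i => extendTuple a i) fun i => norm_extendTuple_le ha i
  have h2 : evalPoly P (extendTuple fun i : Fin n => extendTuple a i) =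
      evalPoly P (extendTuple a) := by
    unfold evalPoly
    congr 1
    refine List.map_congr_left fun t ht => ?_
    rw [evalWord_congr fun l hl => extendTuple_of_lt (extendTuple a) (h.1 t ht l hl)]
  rwa [h2] at h1

/-- The approximation of the value of a universal sentence by a maximum over a net. -/
lemma abs_sentenceVal_sub_le {C : Connectives} {δ : (ℕ × ℕ) × ℕ → ℕ} (hδ : IsModulus C δ)
    {v : (ℕ × List RatCode) × ℕ → RatCode} (hv : IsValues C v)
    {σ : SentenceCode} (hσ : IsUniversalSentence C σ) (K : ℕ) {p M : ℕ} (hp : 0 < p)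
    (hM : M = 2 * (lenSumList σ.2 + 1) * momentPrec δ σ K)
    (hF : ∀ s ∈ momentSet (σ.1.1 + 1) (lenSumList σ.2 + 1),
      ∃ t ∈ matrixMomentSet (σ.1.1 + 1) (lenSumList σ.2 + 1) p,
        dist t s < 1 / (momentPrec δ σ K : ℝ)) {c₀ : ℕ} (hc₀ : inNet (σ.1.1 + 1) p M c₀ = true)
    (hmax : ∀ c < netBound (σ.1.1 + 1) p M, inNet (σ.1.1 + 1) p M c = true →
      ratVal (v ((σ.1.2, σ.2.map fun φ => gridBasic p (4 * p * M) c φ), K)) ≤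
        ratVal (v ((σ.1.2, σ.2.map fun φ => gridBasic p (4 * p * M) c₀ φ), K))) :
    |sentenceVal C hyperfinite hyperfiniteTr σ -
      (ratVal (v ((σ.1.2, σ.2.map fun φ => gridBasic p (4 * p * M) c₀ φ), K)) : ℝ)| ≤
        2 / ((K : ℝ) + 1) := by
  set n := σ.1.1 with hn
  set d := lenSumList σ.2 + 1 with hd
  set k := momentPrec δ σ K with hk
  set D := δ ((σ.1.2, 1), K) with hD
  set S := coeffSumList σ.2 with hS
  have hk0 : 0 < k := by rw [hk, momentPrec]; positivity
  have hM0 : 0 < M := by rw [hM]; positivity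
  have hD0 : (0 : ℝ) < D + 1 := by positivity
  have hsym := hσ.symbols
  have hvars : ∀ φ ∈ σ.2, φ.2.VarsLT n := fun φ hφ => (hsym φ hφ).1
  have hb1 : ∀ a : Fin n → hyperfinite.toStarSubalgebra, (∀ i, ‖a i‖ ≤ 1) → ∀ φ ∈ σ.2,
      |evalBasic hyperfiniteTr φ (extendTuple a)| ≤ 1 := fun a ha φ hφ =>
    abs_evalBasic_hyperfinite_le (hsym φ hφ) ha
  have hb2 : ∀ c, inNet (n + 1) p M c = true → ∀ φ ∈ σ.2,
      |evalBasic (ntr p) φ (gridMat p (4 * p * M) c)| ≤ 1 := fun c hc φ hφ =>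
    abs_evalBasic_net_le hp hM0 hc (hsym φ hφ).mono_succ
  -- Upper bound: the tuple is padded by zero, moved to M_p by `hF`, then to a point of the net,
  -- where the value is at most the one at `c₀`.
  have hup : ∀ a : Fin n → hyperfinite.toStarSubalgebra, (∀ i, ‖a i‖ ≤ 1) →
      evalMatrix C hyperfiniteTr σ a ≤
        (ratVal (v ((σ.1.2, σ.2.map fun φ => gridBasic p (4 * p * M) c₀ φ), K)) : ℝ) +
          2 / ((K : ℝ) + 1) := by
    intro a ha
    obtain ⟨t, ⟨A, hA, rfl⟩, ht⟩ := hF (moments hyperfiniteTr (n + 1) d fun i => extendTuple a i)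
      ⟨_, fun i => norm_extendTuple_le ha i, rfl⟩
    obtain ⟨c, hc, hin, hnear⟩ := exists_net_near hp hM0 A hA
    rw [dist_comm] at ht
    have hwords : ∀ w : List (ℕ × Bool), (∀ l ∈ w, l.1 < n) → w.length ≤ lenSumList σ.2 →
        ‖hyperfiniteTr (evalWord (extendTuple a) w) -
          ntr p (evalWord (gridMat p (4 * p * M) c) w)‖ ≤ 2 / (k : ℝ) := by
      intro w hw hwl
      have hw' : ∀ l ∈ w, l.1 < n + 1 := fun l hl => (hw l hl).trans (Nat.lt_succ_self n)
      have h1 := norm_sub_le_of_dist_moments_le ht.le hw' (hwl.trans (Nat.le_succ _))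
      rw [extendTuple_succ] at h1
      have h2 := hnear w hw'
      have h3 : (w.length : ℝ) * (2 / M) ≤ 1 / k := by
        have h4 : (w.length : ℝ) ≤ d := by exact_mod_cast hwl.trans (Nat.le_succ _)
        have hd0 : (0 : ℝ) < d := by rw [hd]; positivity
        have hk0' : (0 : ℝ) < k := by exact_mod_cast hk0
        have : (2 : ℝ) / M = 1 / (d * k) := by
          rw [hM]; push_cast; field_simp
        rw [this]
        calc (w.length : ℝ) * (1 / (d * k)) ≤ d * (1 / (d * k)) :=
              mul_le_mul_of_nonneg_right h4 (by positivity)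
          _ = 1 / k := by field_simp
      have h5 : (2 : ℝ) / k = 1 / k + 1 / k := by ring
      have h6 := norm_sub_le_norm_sub_add_norm_sub (hyperfiniteTr (evalWord (extendTuple a) w))
        (ntr p (evalWord (extendTuple A) w)) (ntr p (evalWord (gridMat p (4 * p * M) c) w))
      linarith
    -- Moments differ by at most 2/k, hence basic formulas by at most 2S/k, and `momentPrec` is
    -- chosen to bring this below 1/(D + 1).
    have hclose := abs_evalSeq_sub_le hδ hσ.length_eq K (hb1 a ha) (hb2 c hin) fun φ hφ => by
      refine (abs_evalBasic_sub_le_of_words hvars hyperfiniteTr (ntr p) (by positivity)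
        hwords hφ).trans ?_
      rw [hk, momentPrec]
      push_cast
      rw [mul_div_assoc', div_le_div_iff₀ (by positivity) (by positivity)]
      nlinarith [mul_nonneg (Nat.cast_nonneg S : (0 : ℝ) ≤ S) hD0.le]
    have hgrid := abs_evalSeq_grid_sub_le hv hσ.length_eq K hp (4 * p * M) c
    have hm : (ratVal (v ((σ.1.2, σ.2.map fun φ => gridBasic p (4 * p * M) c φ), K)) : ℝ) ≤
        ratVal (v ((σ.1.2, σ.2.map fun φ => gridBasic p (4 * p * M) c₀ φ), K)) := by
      exact_mod_cast hmax c hc hin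
    have h2 : (2 : ℝ) / ((K : ℝ) + 1) = 1 / ((K : ℝ) + 1) + 1 / ((K : ℝ) + 1) := by ring
    have e : evalMatrix C hyperfiniteTr σ a = evalSeq C hyperfiniteTr σ (extendTuple a) := rfl
    rw [e, h2]
    linarith [(abs_le.1 hclose).2, (abs_le.1 hgrid).2]
  -- Lower bound: the maximizing point consists of contractions, so its moments are nearly attained
  -- in 𝓡; the dummy variable is dropped again.
  have hlow : ∃ a : Fin n → hyperfinite.toStarSubalgebra, (∀ i, ‖a i‖ ≤ 1) ∧
      (ratVal (v ((σ.1.2, σ.2.map fun φ => gridBasic p (4 * p * M) c₀ φ), K)) : ℝ) -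
        2 / ((K : ℝ) + 1) ≤ evalMatrix C hyperfiniteTr σ a := by
    obtain ⟨a', ha', hnear⟩ := exists_hyperfinite_near_net hp hM0 hc₀
      (ε := 2 / (k : ℝ)) (by positivity)
    set a : Fin n → hyperfinite.toStarSubalgebra := fun i => extendTuple a' i with haa
    have ha : ∀ i, ‖a i‖ ≤ 1 := fun i => norm_extendTuple_le ha' i
    have hwords : ∀ w : List (ℕ × Bool), (∀ l ∈ w, l.1 < n) → w.length ≤ lenSumList σ.2 →
        ‖hyperfiniteTr (evalWord (extendTuple a) w) -
          ntr p (evalWord (gridMat p (4 * p * M) c₀) w)‖ ≤ 2 / (k : ℝ) := by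
      intro w hw _
      rw [evalWord_congr (a := extendTuple a) (b := extendTuple a') fun l hl =>
        extendTuple_of_lt (extendTuple a') (hw l hl)]
      exact hnear w fun l hl => (hw l hl).trans (Nat.lt_succ_self n)
    have hclose := abs_evalSeq_sub_le hδ hσ.length_eq K (hb1 a ha) (hb2 c₀ hc₀) fun φ hφ => by
      refine (abs_evalBasic_sub_le_of_words hvars hyperfiniteTr (ntr p) (by positivity)
        hwords hφ).trans ?_
      rw [hk, momentPrec]
      push_cast
      rw [mul_div_assoc', div_le_div_iff₀ (by positivity) (by positivity)]
      nlinarith [mul_nonneg (Nat.cast_nonneg S : (0 : ℝ) ≤ S) hD0.le]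
    have hgrid := abs_evalSeq_grid_sub_le hv hσ.length_eq K hp (4 * p * M) c₀
    have h2 : (2 : ℝ) / ((K : ℝ) + 1) = 1 / ((K : ℝ) + 1) + 1 / ((K : ℝ) + 1) := by ring
    have e : evalMatrix C hyperfiniteTr σ a = evalSeq C hyperfiniteTr σ (extendTuple a) := rfl
    refine ⟨a, ha, ?_⟩
    rw [e, h2]
    linarith [(abs_le.1 hclose).1, (abs_le.1 hgrid).1]
  obtain ⟨a, ha, hlo⟩ := hlow
  have hbdd : BddAbove {r | ∃ a : Fin σ.1.1 → hyperfinite.toStarSubalgebra, (∀ i, ‖a i‖ ≤ 1) ∧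
      evalMatrix C hyperfiniteTr σ a = r} := ⟨_, by rintro _ ⟨a, ha, rfl⟩; exact hup a ha⟩
  rw [abs_le]
  constructor
  · have := le_csSup hbdd ⟨a, ha, rfl⟩
    have h3 : sentenceVal C hyperfinite hyperfiniteTr σ = sSup _ := rfl
    rw [h3]
    linarith
  · have h3 : sentenceVal C hyperfinite hyperfiniteTr σ ≤ _ :=
      csSup_le ⟨_, a, ha, rfl⟩ (by rintro _ ⟨a, ha, rfl⟩; exact hup a ha)
    linarith

end

/-! ### The algorithm for the universal theory -/

section

open scoped Matrix.Norms.L2Operator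

/-- The data of the maximization: a sentence, a precision, the size of the matrices, and the
parameter of the net. -/
abbrev NetData : Type := SentenceCode × ℕ × ℕ × ℕ

def netArg (D : NetData) (c : ℕ) : (ℕ × List RatCode) × ℕ :=
  ((D.1.1.2, D.1.2.map fun φ => gridBasic D.2.2.1 (4 * D.2.2.1 * D.2.2.2) c φ), D.2.1)

def netIn (D : NetData) (c : ℕ) : Bool := inNet (D.1.1.1 + 1) D.2.2.1 D.2.2.2 c

lemma primrec_netArg : Primrec fun x : NetData × ℕ => netArg x.1 x.2 := by
  have hD : Primrec fun x : (NetData × ℕ) × BasicCode => x.1.1.2.2 :=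
    Primrec.snd.comp (Primrec.snd.comp (Primrec.fst.comp Primrec.fst))
  have hp := Primrec.fst.comp hD
  have hM := Primrec.snd.comp hD
  have h1 : Primrec fun x : (NetData × ℕ) × BasicCode =>
      gridBasic x.1.1.2.2.1 (4 * x.1.1.2.2.1 * x.1.1.2.2.2) x.1.2 x.2 :=
    primrec_gridBasic hp (primrec_nat_mul (primrec_nat_mul (Primrec.const 4) hp) hM)
      (Primrec.snd.comp Primrec.fst) Primrec.snd
  have h2 : Primrec fun x : NetData × ℕ => x.1.1.2 := by fun_prop
  have h3 := primrec_list_map (g := fun (x : NetData × ℕ) (φ : BasicCode) =>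
    gridBasic x.1.2.2.1 (4 * x.1.2.2.1 * x.1.2.2.2) x.2 φ) h2 h1
  have h4 : Primrec fun x : NetData × ℕ => x.1.1.1.2 := by fun_prop
  have h5 : Primrec fun x : NetData × ℕ => x.1.2.1 := by fun_prop
  exact (h4.pair h3).pair h5

lemma primrec_netIn : Primrec fun x : NetData × ℕ => netIn x.1 x.2 := by
  unfold netIn; fun_prop

/-- The code `c₀` is in the net and maximizes the approximate value of the sentence there. -/
def isNetMax (v : (ℕ × List RatCode) × ℕ → RatCode) (D : NetData) (c₀ : ℕ) : Bool :=
  netIn D c₀ && allLT (netBound (D.1.1.1 + 1) D.2.2.1 D.2.2.2) fun c =>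
    !netIn D c || RatCode.le (v (netArg D c)) (v (netArg D c₀))

lemma computable_isNetMax {v : (ℕ × List RatCode) × ℕ → RatCode} (hv : Computable v) :
    Computable fun x : NetData × ℕ => isNetMax v x.1 x.2 := by
  unfold isNetMax
  refine computable_and primrec_netIn.to_comp (computable_allLT ?_ (computable_or ?_ ?_))
  · exact Primrec.to_comp (by fun_prop)
  · exact computable_not (primrec_netIn.to_comp.comp (g := fun x : (NetData × ℕ) × ℕ => (x.1.1, x.2))
      (by fun_prop))
  · exact computable_ratCode_le
      (hv.comp (primrec_netArg.to_comp.comp (g := fun x : (NetData × ℕ) × ℕ => (x.1.1, x.2))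
        (by fun_prop)))
      (hv.comp (primrec_netArg.to_comp.comp (g := fun x : (NetData × ℕ) × ℕ => (x.1.1, x.1.2))
        (by fun_prop)))

/-- A net point approximating the zero tuple shows that the codes below the bound meet the net, so a
maximum over finitely many codes exists. -/
lemma exists_isNetMax (v : (ℕ × List RatCode) × ℕ → RatCode) (D : NetData) (hp : 0 < D.2.2.1)
    (hM : 0 < D.2.2.2) : ∃ c₀, isNetMax v D c₀ = true := by
  obtain ⟨c, hc, hin, -⟩ := exists_inNet (n := D.1.1.1 + 1) hp hM 0 (by
    intro l _
    change ‖(0 : Matrix (Fin D.2.2.1) (Fin D.2.2.1) ℂ)‖ ≤ 1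
    rw [norm_zero]; exact zero_le_one)
  have hne : ((Finset.range (netBound (D.1.1.1 + 1) D.2.2.1 D.2.2.2)).filter
      fun c => netIn D c = true).Nonempty := ⟨c, Finset.mem_filter.2 ⟨Finset.mem_range.2 hc, hin⟩⟩
  obtain ⟨c₀, h0, hmax⟩ := Finset.exists_max_image _ (fun c => ratVal (v (netArg D c))) hne
  refine ⟨c₀, ?_⟩
  rw [Finset.mem_filter] at h0
  rw [isNetMax, Bool.and_eq_true, allLT_eq_true]
  refine ⟨h0.2, fun c hc => ?_⟩
  by_cases hcin : netIn D c = true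
  · rw [hcin, Bool.not_true, Bool.false_or, RatCode.le_iff]
    exact hmax c (by simpa [hcin] using hc)
  · simp [Bool.not_eq_true _ ▸ hcin]

theorem universalTheoryComputable_of_momentApprox (C : Connectives) {F : ℕ × ℕ × ℕ → ℕ}
    (hF : Computable F)
    (h : ∀ n d k : ℕ, 0 < n → 0 < d → 0 < k → 0 < F (n, d, k) ∧
      ∀ s ∈ momentSet n d, ∃ t ∈ matrixMomentSet n d (F (n, d, k)), dist t s < 1 / (k : ℝ)) :
    UniversalTheoryComputable C hyperfinite hyperfiniteTr := by
  obtain ⟨δ, hδc, hδ⟩ := C.computable_modulus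
  obtain ⟨v, hvc, hv⟩ := C.computable_values
  have hvC : IsValues C v := hv
  have hδC : IsModulus C δ := hδ
  -- The value is known up to 2/(K + 1); reporting ±3/(K + 1) makes the inclusion strict. The length
  -- 6/(K + 1) is below 1/(ε.2 + 1), which is at most any positive rational with code ε.
  let K : SentenceCode × RatCode → ℕ := fun x => 6 * (x.2.2 + 1)
  let k : SentenceCode × RatCode → ℕ := fun x => momentPrec δ x.1 (K x)
  -- The increments keep the arguments of `F` positive.
  let p : SentenceCode × RatCode → ℕ := fun x => F (x.1.1.1 + 1, lenSumList x.1.2 + 1, k x)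
  let D : SentenceCode × RatCode → NetData := fun x =>
    (x.1, K x, p x, 2 * (lenSumList x.1.2 + 1) * k x)
  have hK : Primrec K := by fun_prop
  have hk : Computable k := by
    have h1 : Computable fun x : SentenceCode × RatCode => δ ((x.1.1.2, 1), K x) :=
      hδc.comp (Primrec.to_comp (by fun_prop))
    have h2 : Computable fun x : SentenceCode × RatCode => coeffSumList x.1.2 :=
      Primrec.to_comp (by fun_prop)
    simp only [k, momentPrec]
    fun_prop
  have hl : Computable fun x : SentenceCode × RatCode => lenSumList x.1.2 + 1 :=
    Primrec.to_comp (by fun_prop)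
  have hn : Computable fun x : SentenceCode × RatCode => x.1.1.1 + 1 :=
    Primrec.to_comp (by fun_prop)
  have hp : Computable p := hF.comp (hn.pair (hl.pair hk))
  have hD : Computable D := Computable.fst.pair (hK.to_comp.pair (hp.pair (by fun_prop)))
  obtain ⟨f, hf, hspec⟩ := exists_partrec_search
    (test := fun x c => isNetMax v (D x) c)
    (out := fun x c => ((v (netArg (D x) c)).add (-3, K x), (v (netArg (D x) c)).add (3, K x)))
    ((computable_isNetMax hvc).comp (g := fun x : (SentenceCode × RatCode) × ℕ => (D x.1, x.2))
      ((hD.comp Computable.fst).pair Computable.snd))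
    (by
      have h1 : Computable fun x : (SentenceCode × RatCode) × ℕ => v (netArg (D x.1) x.2) :=
        hvc.comp (primrec_netArg.to_comp.comp
          (g := fun x : (SentenceCode × RatCode) × ℕ => (D x.1, x.2))
          ((hD.comp Computable.fst).pair Computable.snd))
      have h2 : ∀ z : ℤ, Computable fun x : (SentenceCode × RatCode) × ℕ => ((z, K x.1) : RatCode) :=
        fun z => (Computable.const z).pair (hK.to_comp.comp Computable.fst)
      exact (computable_ratCode_add h1 (h2 _)).pair (computable_ratCode_add h1 (h2 _)))
  refine ⟨f, hf, fun σ ε hσ hε => ?_⟩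
  have hk0 : 0 < k (σ, ε) := by simp only [k, momentPrec]; positivity
  obtain ⟨hp0, hFs⟩ := h (σ.1.1 + 1) (lenSumList σ.2 + 1) (k (σ, ε)) (by positivity)
    (by positivity) hk0
  obtain ⟨c₀, htest, hout⟩ := hspec (σ, ε)
    (exists_isNetMax v (D (σ, ε)) hp0 (by simp only [D]; positivity))
  refine ⟨_, hout, ?_⟩
  rw [isNetMax, Bool.and_eq_true, allLT_eq_true] at htest
  have hval := abs_sentenceVal_sub_le hδC hvC hσ (K (σ, ε)) (p := p (σ, ε))
    (M := 2 * (lenSumList σ.2 + 1) * k (σ, ε)) hp0 rfl hFs (c₀ := c₀) htest.1 (by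
      intro c hc hcin
      have h1 := htest.2 c hc
      have h2 : netIn (D (σ, ε)) c = true := hcin
      rw [h2, Bool.not_true, Bool.false_or, RatCode.le_iff] at h1
      exact h1)
  change |_ - (ratVal (v (netArg (D (σ, ε)) c₀)) : ℝ)| ≤ _ at hval
  have hKε : ∀ z : ℤ, ratVal (z, K (σ, ε)) = z / ((K (σ, ε) : ℚ) + 1) := fun z => rfl
  have hKpos : (0 : ℝ) < (K (σ, ε) : ℝ) + 1 := by positivity
  have hKposQ : (0 : ℚ) < (K (σ, ε) : ℚ) + 1 := by positivity
  rw [abs_le] at hval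
  have h23 : (2 : ℝ) / ((K (σ, ε) : ℝ) + 1) < 3 / ((K (σ, ε) : ℝ) + 1) := by
    rw [div_lt_div_iff_of_pos_right hKpos]; norm_num
  simp only [ratVal_add, hKε]
  push_cast
  refine ⟨?_, ?_, ?_, ?_⟩
  · have : (0 : ℚ) < 3 / ((K (σ, ε) : ℚ) + 1) := by positivity
    have e : (-3 : ℚ) / ((K (σ, ε) : ℚ) + 1) = -(3 / ((K (σ, ε) : ℚ) + 1)) := by ring
    linarith
  · have hz : 1 ≤ ε.1 := by
      by_contra hcon
      have : (ε.1 : ℚ) ≤ 0 := by exact_mod_cast (by omega : ε.1 ≤ 0)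
      exact absurd hε (not_lt.2 (div_nonpos_of_nonpos_of_nonneg this (by positivity)))
    have hz' : (1 : ℚ) ≤ ε.1 := by exact_mod_cast hz
    have h1 : (1 : ℚ) / (ε.2 + 1) ≤ ratVal ε := by
      rw [ratVal]
      exact div_le_div_of_nonneg_right hz' (by positivity)
    have h2 : (6 : ℚ) / ((K (σ, ε) : ℚ) + 1) < 1 / (ε.2 + 1) := by
      rw [div_lt_div_iff₀ hKposQ (by positivity)]
      simp only [K]
      push_cast
      linarith
    have e : (6 : ℚ) / ((K (σ, ε) : ℚ) + 1) =
      3 / ((K (σ, ε) : ℚ) + 1) - -3 / ((K (σ, ε) : ℚ) + 1) := by ring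
    linarith
  · have e : (-3 : ℝ) / ((K (σ, ε) : ℝ) + 1) = -(3 / ((K (σ, ε) : ℝ) + 1)) := by ring
    linarith [hval.1]
  · linarith [hval.2]

end

/-! ## From the universal theory to the function `F` -/

section Words

def letters (n : ℕ) : List (ℕ × Bool) :=
  (List.range n).flatMap fun i => [(i, false), (i, true)]

/-- The words of length at most `d` in the first `n` variables. -/
def words (n d : ℕ) : List (List (ℕ × Bool)) :=
  Nat.rec [[]] (fun _ W => [] :: (letters n).flatMap fun l => W.map fun w => l :: w) d

/-- The basic formulas given by the real and imaginary parts of the moments. -/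
def momentFormulas (n d : ℕ) : List BasicCode :=
  (words n d).flatMap fun w => [(false, [(((1, 0), (0, 0)), w)]), (true, [(((1, 0), (0, 0)), w)])]

lemma mem_letters {n : ℕ} {l : ℕ × Bool} : l ∈ letters n ↔ l.1 < n := by
  rcases l with ⟨i, b⟩
  simp only [letters, List.mem_flatMap, List.mem_range, List.mem_cons, Prod.mk.injEq,
    List.not_mem_nil, or_false]
  constructor
  · rintro ⟨j, hj, ⟨rfl, -⟩ | ⟨rfl, -⟩⟩ <;> exact hj
  · intro h
    refine ⟨i, h, ?_⟩
    cases b <;> simp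

lemma mem_words {n d : ℕ} {w : List (ℕ × Bool)} :
    w ∈ words n d ↔ (∀ l ∈ w, l.1 < n) ∧ w.length ≤ d := by
  induction d generalizing w with
  | zero =>
    have : words n 0 = [[]] := rfl
    rw [this, List.mem_singleton]
    constructor
    · rintro rfl; simp
    · rintro ⟨-, h⟩; exact List.length_eq_zero_iff.1 (Nat.le_zero.1 h)
  | succ d ih =>
    have : words n (d + 1) =
      [] :: (letters n).flatMap fun l => (words n d).map fun w => l :: w := rfl
    rw [this]
    cases w with
    | nil => simp
    | cons l w =>
      simp only [List.mem_cons, reduceCtorEq, false_or, List.mem_flatMap, List.mem_map,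
        List.cons.injEq, mem_letters, List.length_cons, Nat.add_le_add_iff_right, forall_eq_or_imp]
      constructor
      · rintro ⟨l', hl', w', hw', rfl, rfl⟩
        exact ⟨⟨hl', (ih.1 hw').1⟩, (ih.1 hw').2⟩
      · rintro ⟨⟨h1, h2⟩, h3⟩
        exact ⟨l, h1, w, ih.2 ⟨h2, h3⟩, rfl, rfl⟩

lemma mem_momentFormulas {n d : ℕ} {φ : BasicCode} : φ ∈ momentFormulas n d ↔
    ∃ w, ((∀ l ∈ w, l.1 < n) ∧ w.length ≤ d) ∧ ∃ b, φ = (b, [(((1, 0), (0, 0)), w)]) := by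
  simp only [momentFormulas, List.mem_flatMap, mem_words, List.mem_cons, List.not_mem_nil, or_false]
  simp [Bool.exists_bool]

lemma evalPoly_word {A : Type} [Ring A] [StarRing A] [Algebra ℂ A] (w : List (ℕ × Bool))
    (a : ℕ → A) : evalPoly [(((1, 0), (0, 0)), w)] a = evalWord a w := by
  have : coeffVal ((1, 0), (0, 0)) = 1 := by
    apply Complex.ext <;> simp [coeffVal, ratVal]
  simp [evalPoly, this]

lemma isFunctionSymbol_momentFormulas {n d : ℕ} {φ : BasicCode} (hφ : φ ∈ momentFormulas n d) :
    IsFunctionSymbol n φ.2 := by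
  obtain ⟨w, ⟨hw, -⟩, b, rfl⟩ := mem_momentFormulas.1 hφ
  refine ⟨by simpa [PolyCode.VarsLT] using hw, fun H _ _ _ M a ha => ?_⟩
  rw [evalPoly_word]
  exact norm_evalWord_le_one (norm_one_le_one M) _ w fun l _ => norm_extendTuple_le ha _

variable {α : Type*} [Primcodable α]

@[fun_prop] lemma primrec_letters {n : α → ℕ} (hn : Primrec n) :
    Primrec fun a => letters (n a) := by
  unfold letters
  refine primrec_list_flatMap (by fun_prop) ?_
  exact primrec_list_cons (by fun_prop) (primrec_list_cons (by fun_prop) (by fun_prop))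

@[fun_prop] lemma primrec_words {n d : α → ℕ} (hn : Primrec n) (hd : Primrec d) :
    Primrec fun a => words (n a) (d a) := by
  unfold words
  refine primrec_nat_rec hd (by fun_prop) ?_
  refine primrec_list_cons (by fun_prop) (primrec_list_flatMap (by fun_prop) ?_)
  exact primrec_list_map (by fun_prop) (by fun_prop)

@[fun_prop] lemma primrec_momentFormulas {n d : α → ℕ} (hn : Primrec n) (hd : Primrec d) :
    Primrec fun a => momentFormulas (n a) (d a) := by
  unfold momentFormulas
  refine primrec_list_flatMap (by fun_prop) ?_
  have h : Primrec fun x : α × List (ℕ × Bool) =>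
      ([(((1, 0), (0, 0)), x.2)] : PolyCode) :=
    primrec_list_cons (Primrec.pair (Primrec.const _) Primrec.snd) (Primrec.const _)
  exact primrec_list_cons (Primrec.pair (Primrec.const _) h)
    (primrec_list_cons (Primrec.pair (Primrec.const _) h) (Primrec.const _))

end Words

/-! ### Certificates and their decidability -/

section Check

/-- The precision up to which points of the net are compared with points of the grid. -/
def closePrec (n d k : ℕ) : ℕ := 4 * ((d + 1) * (2 * n + 1) ^ d) * (k + 1)

/-- The mesh of the grid is `1 / gridPrec`. -/
def gridPrec (δ : (ℕ × ℕ) × ℕ → ℕ) (x : ℕ × ℕ × ℕ) (i : ℕ) : ℕ :=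
  δ ((i, 1), 0) + 1 + closePrec x.1 x.2.1 x.2.2

/-- The list of coordinates of the point with code `c` of the grid of mesh `1 / g`. -/
def gridPoint (len g c : ℕ) : List RatCode := (List.range len).map fun e => gridCoord g c e

/-- The `r`-th coordinate of the grid point with code `e` is close to the value of the `r`-th
formula at the point of the net with code `c`. -/
def isCloseAt (K g e p M c : ℕ) (L : List BasicCode) (r : ℕ) : Bool :=
  let t := gridBasic p (4 * p * M) c (L.getD r (false, []))
  let q := gridCoord g e r
  RatCode.le (q.add t.neg) (1, K - 1) && RatCode.le (t.add q.neg) (1, K - 1)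

/-- The grid point with code `e` is close to a point of the net. -/
def isCloseToNet (x : ℕ × ℕ × ℕ) (p M g e : ℕ) : Bool :=
  !allLT (netBound x.1 p M) fun c => !(inNet x.1 p M c &&
    allLT (momentFormulas x.1 x.2.1).length
      (isCloseAt (closePrec x.1 x.2.1 x.2.2) g e p M c (momentFormulas x.1 x.2.1)))

/-- The certificate `(p, M, i)` is valid for `(n, d, k)`: the `i`-th connective is nonnegative on
the cube, and large at the points far away from the moments of the net. -/
def isCertificate (δ : (ℕ × ℕ) × ℕ → ℕ) (v : (ℕ × List RatCode) × ℕ → RatCode) (arity : ℕ → ℕ)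
    (x y : ℕ × ℕ × ℕ) : Bool :=
  decide (arity y.2.2 = (momentFormulas x.1 x.2.1).length) &&
    allLT ((2 * gridPrec δ x y.2.2 + 1) ^ (momentFormulas x.1 x.2.1).length) fun e =>
      -- Passing from the cube to the grid costs at most 2. So grid values at least 2 give
      -- nonnegativity on the cube, and a point of the cube with value at most 7 has a grid
      -- neighbour with value at most 9.
      RatCode.le (RatCode.ofNat 2)
        (v ((y.2.2, gridPoint (momentFormulas x.1 x.2.1).length (gridPrec δ x y.2.2) e), 0)) &&
      (!RatCode.le
        (v ((y.2.2, gridPoint (momentFormulas x.1 x.2.1).length (gridPrec δ x y.2.2) e), 0))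
        (RatCode.ofNat 9) ||
      isCloseToNet x (y.1 + 1) (y.2.1 + 1) (gridPrec δ x y.2.2) e)

/-- The sentence of a certificate. -/
def certSentence (x y : ℕ × ℕ × ℕ) : SentenceCode := ((x.1, y.2.2), momentFormulas x.1 x.2.1)

variable {α : Type*} [Primcodable α]

@[fun_prop] lemma primrec_closePrec {n d k : α → ℕ} (hn : Primrec n) (hd : Primrec d)
    (hk : Primrec k) : Primrec fun a => closePrec (n a) (d a) (k a) := by
  unfold closePrec; fun_prop

@[fun_prop] lemma primrec_gridPoint {len g c : α → ℕ} (hl : Primrec len) (hg : Primrec g)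
    (hc : Primrec c) : Primrec fun a => gridPoint (len a) (g a) (c a) := by
  unfold gridPoint
  exact primrec_list_map (by fun_prop) (by fun_prop)

@[fun_prop] lemma primrec_isCloseAt {K g e p M c r : α → ℕ} {L : α → List BasicCode}
    (hK : Primrec K) (hg : Primrec g) (he : Primrec e) (hp : Primrec p) (hM : Primrec M)
    (hc : Primrec c) (hL : Primrec L) (hr : Primrec r) :
    Primrec fun a => isCloseAt (K a) (g a) (e a) (p a) (M a) (c a) (L a) (r a) := by
  have ht : Primrec fun a => gridBasic (p a) (4 * p a * M a) (c a) ((L a).getD (r a) (false, [])) :=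
    primrec_gridBasic hp (by fun_prop) hc (primrec_list_getD _ hL hr)
  have hq : Primrec fun a => gridCoord (g a) (e a) (r a) := by fun_prop
  have h1 : Primrec fun a => ((1, K a - 1) : RatCode) :=
    (Primrec.const _).pair (primrec_nat_sub hK (Primrec.const 1))
  unfold isCloseAt
  exact primrec_and (primrec_ratCode_le (primrec_ratCode_add hq (primrec_ratCode_neg ht)) h1)
    (primrec_ratCode_le (primrec_ratCode_add ht (primrec_ratCode_neg hq)) h1)

lemma primrec_isCloseToNet : Primrec fun a : (ℕ × ℕ × ℕ) × ℕ × ℕ × ℕ × ℕ =>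
    isCloseToNet a.1 a.2.1 a.2.2.1 a.2.2.2.1 a.2.2.2.2 := by
  unfold isCloseToNet
  refine primrec_not (primrec_allLT (by fun_prop) (primrec_not (primrec_and (by fun_prop)
    (primrec_allLT (by fun_prop) ?_))))
  exact primrec_isCloseAt (by fun_prop) (by fun_prop) (by fun_prop) (by fun_prop) (by fun_prop)
    (by fun_prop) (by fun_prop) (by fun_prop)

lemma computable_isCertificate {δ : (ℕ × ℕ) × ℕ → ℕ} {v : (ℕ × List RatCode) × ℕ → RatCode}
    {arity : ℕ → ℕ} (hδ : Computable δ) (hv : Computable v) (ha : Computable arity) :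
    Computable fun a : (ℕ × ℕ × ℕ) × (ℕ × ℕ × ℕ) => isCertificate δ v arity a.1 a.2 := by
  have hlen : Computable fun a : (ℕ × ℕ × ℕ) × (ℕ × ℕ × ℕ) =>
      (momentFormulas a.1.1 a.1.2.1).length := Primrec.to_comp (by fun_prop)
  have hg : Computable fun a : (ℕ × ℕ × ℕ) × (ℕ × ℕ × ℕ) => gridPrec δ a.1 a.2.2.2 := by
    have h1 : Computable fun a : (ℕ × ℕ × ℕ) × (ℕ × ℕ × ℕ) => δ ((a.2.2.2, 1), 0) :=
      hδ.comp (Primrec.to_comp (by fun_prop))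
    have h2 : Computable fun a : (ℕ × ℕ × ℕ) × (ℕ × ℕ × ℕ) => closePrec a.1.1 a.1.2.1 a.1.2.2 :=
      Primrec.to_comp (by fun_prop)
    unfold gridPrec
    exact computable_nat_add (computable_nat_add h1 (Computable.const 1)) h2
  have hgp : Computable fun a : ((ℕ × ℕ × ℕ) × (ℕ × ℕ × ℕ)) × ℕ =>
      gridPoint (momentFormulas a.1.1.1 a.1.1.2.1).length (gridPrec δ a.1.1 a.1.2.2.2) a.2 :=
    (show Primrec fun b : ℕ × ℕ × ℕ => gridPoint b.1 b.2.1 b.2.2 by fun_prop).to_comp.comp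
      (g := fun a : ((ℕ × ℕ × ℕ) × (ℕ × ℕ × ℕ)) × ℕ =>
        ((momentFormulas a.1.1.1 a.1.1.2.1).length, gridPrec δ a.1.1 a.1.2.2.2, a.2))
      ((hlen.comp Computable.fst).pair ((hg.comp Computable.fst).pair Computable.snd))
  have hval : Computable fun a : ((ℕ × ℕ × ℕ) × (ℕ × ℕ × ℕ)) × ℕ =>
      v ((a.1.2.2.2, gridPoint (momentFormulas a.1.1.1 a.1.1.2.1).length
        (gridPrec δ a.1.1 a.1.2.2.2) a.2), 0) := by
    have h1 : Computable fun a : ((ℕ × ℕ × ℕ) × (ℕ × ℕ × ℕ)) × ℕ => a.1.2.2.2 :=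
      Primrec.to_comp (by fun_prop)
    exact hv.comp ((h1.pair hgp).pair (Computable.const 0))
  have hclose : Computable fun a : ((ℕ × ℕ × ℕ) × (ℕ × ℕ × ℕ)) × ℕ =>
      isCloseToNet a.1.1 (a.1.2.1 + 1) (a.1.2.2.1 + 1) (gridPrec δ a.1.1 a.1.2.2.2) a.2 := by
    have h1 : Computable fun a : ((ℕ × ℕ × ℕ) × (ℕ × ℕ × ℕ)) × ℕ => a.1.1 :=
      Primrec.to_comp (by fun_prop)
    have h2 : Computable fun a : ((ℕ × ℕ × ℕ) × (ℕ × ℕ × ℕ)) × ℕ => a.1.2.1 + 1 :=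
      Primrec.to_comp (by fun_prop)
    have h3 : Computable fun a : ((ℕ × ℕ × ℕ) × (ℕ × ℕ × ℕ)) × ℕ => a.1.2.2.1 + 1 :=
      Primrec.to_comp (by fun_prop)
    exact primrec_isCloseToNet.to_comp.comp
      (g := fun a : ((ℕ × ℕ × ℕ) × (ℕ × ℕ × ℕ)) × ℕ =>
        (a.1.1, a.1.2.1 + 1, a.1.2.2.1 + 1, gridPrec δ a.1.1 a.1.2.2.2, a.2))
      (h1.pair (h2.pair (h3.pair ((hg.comp Computable.fst).pair Computable.snd))))
  have hi : Computable fun a : (ℕ × ℕ × ℕ) × (ℕ × ℕ × ℕ) => a.2.2.2 :=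
    Primrec.to_comp (by fun_prop)
  unfold isCertificate
  refine computable_and (computable_decide_eq (ha.comp hi) hlen) (computable_allLT ?_ ?_)
  · exact computable_nat_pow (computable_nat_add (computable_nat_mul (Computable.const 2) hg)
      (Computable.const 1)) hlen
  · exact computable_and (computable_ratCode_le (Computable.const _) hval)
      (computable_or (computable_not (computable_ratCode_le hval (Computable.const _))) hclose)

lemma primrec_certSentence : Primrec fun a : (ℕ × ℕ × ℕ) × (ℕ × ℕ × ℕ) =>
    certSentence a.1 a.2 := by
  unfold certSentence
  exact Primrec.pair (by fun_prop) (by fun_prop)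

end Check

/-! ### Soundness of certificates -/

section Certificates

open scoped Matrix.Norms.L2Operator

variable {C : Connectives} {δ : (ℕ × ℕ) × ℕ → ℕ} {v : (ℕ × List RatCode) × ℕ → RatCode}
  {x y : ℕ × ℕ × ℕ}

lemma closePrec_pos (n d k : ℕ) : 0 < closePrec n d k := by unfold closePrec; positivity

lemma gridPrec_pos (δ : (ℕ × ℕ) × ℕ → ℕ) (x : ℕ × ℕ × ℕ) (i : ℕ) : 0 < gridPrec δ x i := by
  unfold gridPrec; omega

/-- The approximate value of the connective at a point of the grid. -/
def gridVal (δ : (ℕ × ℕ) × ℕ → ℕ) (v : (ℕ × List RatCode) × ℕ → RatCode) (x : ℕ × ℕ × ℕ)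
    (i e : ℕ) : ℚ :=
  ratVal (v ((i, gridPoint (momentFormulas x.1 x.2.1).length (gridPrec δ x i) e), 0))

lemma isCertificate_iff {arity : ℕ → ℕ} : isCertificate δ v arity x y = true ↔
    arity y.2.2 = (momentFormulas x.1 x.2.1).length ∧
    ∀ e < (2 * gridPrec δ x y.2.2 + 1) ^ (momentFormulas x.1 x.2.1).length,
      2 ≤ gridVal δ v x y.2.2 e ∧ (gridVal δ v x y.2.2 e ≤ 9 →
        isCloseToNet x (y.1 + 1) (y.2.1 + 1) (gridPrec δ x y.2.2) e = true) := by
  unfold isCertificate gridVal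
  rw [Bool.and_eq_true, decide_eq_true_eq, allLT_eq_true]
  refine and_congr_right fun _ => forall₂_congr fun e _ => ?_
  rw [Bool.and_eq_true, RatCode.le_iff, Bool.or_eq_true, Bool.not_eq_true', ← Bool.not_eq_true,
    RatCode.le_iff, ratVal_ofNat, ratVal_ofNat, imp_iff_not_or]
  norm_num

lemma isCloseToNet_iff {p M g e : ℕ} (hp : 0 < p) : isCloseToNet x p M g e = true ↔
    ∃ c < netBound x.1 p M, inNet x.1 p M c = true ∧
      ∀ r < (momentFormulas x.1 x.2.1).length,
        |(ratVal (gridCoord g e r) : ℝ) - evalBasic (ntr p)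
          ((momentFormulas x.1 x.2.1).getD r (false, [])) (gridMat p (4 * p * M) c)| ≤
          1 / closePrec x.1 x.2.1 x.2.2 := by
  unfold isCloseToNet
  rw [Bool.not_eq_true', ← Bool.not_eq_true, allLT_eq_true]
  push Not
  refine exists_congr fun c => and_congr_right fun _ => ?_
  rw [ne_eq, Bool.not_eq_true, Bool.not_eq_false', Bool.and_eq_true, allLT_eq_true]
  refine and_congr_right fun _ => forall₂_congr fun r _ => ?_
  have hK : ratVal (1, closePrec x.1 x.2.1 x.2.2 - 1) = 1 / closePrec x.1 x.2.1 x.2.2 := by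
    have : ((closePrec x.1 x.2.1 x.2.2 - 1 : ℕ) : ℚ) + 1 = closePrec x.1 x.2.1 x.2.2 := by
      exact_mod_cast Nat.sub_add_cancel (closePrec_pos _ _ _)
    simp [ratVal, this]
  simp only [isCloseAt, Bool.and_eq_true, RatCode.le_iff, ratVal_add, ratVal_neg, hK]
  have hcast : (1 : ℝ) / closePrec x.1 x.2.1 x.2.2 =
      ((1 / closePrec x.1 x.2.1 x.2.2 : ℚ) : ℝ) := by push_cast; rfl
  rw [← ratVal_gridBasic hp, hcast, ← Rat.cast_sub, ← Rat.cast_abs, Rat.cast_le, abs_le]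
  constructor
  · rintro ⟨h1, h2⟩; constructor <;> linarith
  · rintro ⟨h1, h2⟩; constructor <;> linarith

lemma abs_fn_sub_gridVal_le (hv : IsValues C v) {i : ℕ}
    (hi : C.arity i = (momentFormulas x.1 x.2.1).length) (e : ℕ) :
    |C.fn i (fun j => (ratVal (gridCoord (gridPrec δ x i) e j) : ℝ)) - (gridVal δ v x i e : ℝ)|
      ≤ 1 := by
  have h := hv i (gridPoint (momentFormulas x.1 x.2.1).length (gridPrec δ x i) e) 0
    (by rw [gridPoint, List.length_map, List.length_range, hi])
  rw [Nat.cast_zero, zero_add, div_one] at h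
  refine le_trans (le_of_eq ?_) h
  congr 3
  funext j
  simp [gridPoint]
  rfl

/-- The values of the connective on the cube are determined up to `2` by the values on the grid. -/
lemma exists_gridVal_near (hδ : IsModulus C δ) (hv : IsValues C v) {i : ℕ}
    (hi : C.arity i = (momentFormulas x.1 x.2.1).length) (X : ℕ → ℝ)
    (hX : ∀ j < (momentFormulas x.1 x.2.1).length, |X j| ≤ 1) :
    ∃ e < (2 * gridPrec δ x i + 1) ^ (momentFormulas x.1 x.2.1).length,
      (∀ j < (momentFormulas x.1 x.2.1).length,
        |(ratVal (gridCoord (gridPrec δ x i) e j) : ℝ) - X j| ≤ 1 / gridPrec δ x i) ∧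
      |C.fn i (fun j => X j) - (gridVal δ v x i e : ℝ)| ≤ 2 := by
  obtain ⟨e, he, h⟩ := exists_gridCoord (gridPrec_pos δ x i) _ X hX
  refine ⟨e, he, h, ?_⟩
  have hjlt : ∀ j : Fin (C.arity i), (j : ℕ) < (momentFormulas x.1 x.2.1).length := fun j =>
    hi ▸ j.2
  -- Precision index 0 means error at most 1: one unit for moving to the grid, another for the
  -- approximate evaluation there.
  have h1 := hδ i 1 0 (fun j => X j) (fun j => (ratVal (gridCoord (gridPrec δ x i) e j) : ℝ))
    (fun j => by rw [Nat.cast_one]; exact hX j (hjlt j))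
    (fun j => by rw [Nat.cast_one]; exact abs_gridCoord_le (gridPrec_pos δ x i) e j) (fun j => by
      rw [abs_sub_comm]
      refine (h j (hjlt j)).trans (one_div_le_one_div_of_le (by positivity) ?_)
      unfold gridPrec
      push_cast
      linarith [(Nat.cast_nonneg (closePrec x.1 x.2.1 x.2.2) : (0 : ℝ) ≤ _)])
  rw [Nat.cast_zero, zero_add, div_one] at h1
  have h2 := abs_fn_sub_gridVal_le (δ := δ) (x := x) hv hi e
  have h3 := abs_sub_le (C.fn i fun j => X j)
    (C.fn i fun j => (ratVal (gridCoord (gridPrec δ x i) e j) : ℝ)) (gridVal δ v x i e : ℝ)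
  linarith

variable {A : Type} [Ring A] [StarRing A] [Algebra ℂ A]

/-- The values of the moment formulas at a sequence. -/
noncomputable def formulaVal (x : ℕ × ℕ × ℕ) (τ : A → ℂ) (a : ℕ → A) (r : ℕ) : ℝ :=
  evalBasic τ ((momentFormulas x.1 x.2.1).getD r (false, [])) a

lemma getD_mem {α : Type*} {L : List α} {r : ℕ} (hr : r < L.length) (b : α) : L.getD r b ∈ L := by
  rw [List.getD_eq_getElem _ _ hr]; exact List.getElem_mem hr

lemma evalMatrix_certSentence {τ : A → ℂ}
    (hi : C.arity y.2.2 = (momentFormulas x.1 x.2.1).length) (a : Fin x.1 → A) :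
    evalMatrix C τ (certSentence x y) a =
      C.fn y.2.2 fun j => formulaVal x τ (extendTuple a) j := by
  have h : evalMatrix C τ (certSentence x y) a = C.fn y.2.2 fun j =>
    (((momentFormulas x.1 x.2.1).map fun φ => evalBasic τ φ (extendTuple a))[(j : ℕ)]?).getD 0 :=
    rfl
  rw [h]
  congr 1
  funext j
  have hj : (j : ℕ) < (momentFormulas x.1 x.2.1).length := hi ▸ j.2
  simp [formulaVal, hj]

/-- This licenses the call to the algorithm for the theory, about which nothing is known on other
inputs. In any tracial algebra the moments of contractions lie in the cube, where the grid test
bounds the connective below by 2 - 2 = 0. -/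
lemma isUniversalSentence_certSentence (hδ : IsModulus C δ) (hv : IsValues C v)
    (h : isCertificate δ v C.arity x y = true) : IsUniversalSentence C (certSentence x y) := by
  obtain ⟨hi, hg⟩ := isCertificate_iff.1 h
  refine ⟨hi.symm, fun φ hφ => isFunctionSymbol_momentFormulas hφ, ?_⟩
  intro H _ _ _ M τ hτ (a : Fin x.1 → _) ha
  refine le_of_le_of_eq ?_ (evalMatrix_certSentence hi a).symm
  obtain ⟨e, he, -, h2⟩ := exists_gridVal_near hδ hv hi (formulaVal x τ (extendTuple a))
    fun j hj => (abs_evalBasic_le _ _ _).trans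
      (hτ.norm_le_one ((isFunctionSymbol_momentFormulas (getD_mem hj _)).2 H M a ha))
  have h3 : (2 : ℝ) ≤ gridVal δ v x y.2.2 e := by exact_mod_cast (hg e he).1
  linarith [(abs_le.1 h2).1]

lemma abs_formulaVal_hyperfinite_le {a : Fin x.1 → hyperfinite.toStarSubalgebra}
    (ha : ∀ i, ‖a i‖ ≤ 1) {r : ℕ} (hr : r < (momentFormulas x.1 x.2.1).length) :
    |formulaVal x hyperfiniteTr (extendTuple a) r| ≤ 1 :=
  abs_evalBasic_hyperfinite_le (isFunctionSymbol_momentFormulas (getD_mem hr _)) ha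

/-- Every tuple in 𝓡 has value at most 7, so a grid point next to its moments has value at most 9
and is close to a point of the net. Each real coordinate is off by at most 2/K, each moment by at
most 4/K, and the monomial count built into `closePrec` turns this into 1/(k + 1). -/
lemma exists_of_certificate (hδ : IsModulus C δ) (hv : IsValues C v)
    (h : isCertificate δ v C.arity x y = true)
    (hval : sentenceVal C hyperfinite hyperfiniteTr (certSentence x y) ≤ 7)
    {a : Fin x.1 → hyperfinite.toStarSubalgebra} (ha : ∀ i, ‖a i‖ ≤ 1) :
    ∃ b : Fin x.1 → Matrix (Fin (y.1 + 1)) (Fin (y.1 + 1)) ℂ, (∀ i, ‖b i‖ ≤ 1) ∧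
      dist (moments (ntr (y.1 + 1)) x.1 x.2.1 b) (moments hyperfiniteTr x.1 x.2.1 a) ≤
        1 / ((x.2.2 : ℝ) + 1) := by
  obtain ⟨hi, hg⟩ := isCertificate_iff.1 h
  set len := (momentFormulas x.1 x.2.1).length with hlen
  set g := gridPrec δ x y.2.2 with hgdef
  set K := closePrec x.1 x.2.1 x.2.2 with hK
  have hKpos : (0 : ℝ) < K := by exact_mod_cast closePrec_pos _ _ _
  -- An unbounded set would have `sSup` equal to `0` and `hval` would say nothing; the finitely many
  -- grid values provide a bound.
  have hbdd : BddAbove {r | ∃ a : Fin x.1 → hyperfinite.toStarSubalgebra, (∀ i, ‖a i‖ ≤ 1) ∧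
      evalMatrix C hyperfiniteTr (certSentence x y) a = r} := by
    obtain ⟨B, hB⟩ := ((Finset.range ((2 * g + 1) ^ len)).image
      fun e => (gridVal δ v x y.2.2 e : ℝ)).bddAbove
    refine ⟨B + 2, ?_⟩
    rintro _ ⟨a, ha, rfl⟩
    rw [evalMatrix_certSentence hi]
    obtain ⟨e, he, -, h2⟩ := exists_gridVal_near hδ hv hi (formulaVal x hyperfiniteTr (extendTuple a))
      fun j hj => abs_formulaVal_hyperfinite_le ha hj
    have h3 := hB (Finset.mem_coe.2 (Finset.mem_image_of_mem _ (Finset.mem_range.2 he)))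
    linarith [(abs_le.1 h2).2]
  have h7 : evalMatrix C hyperfiniteTr (certSentence x y) a ≤ 7 :=
    (le_csSup hbdd ⟨a, ha, rfl⟩).trans hval
  rw [evalMatrix_certSentence hi] at h7
  obtain ⟨e, he, hnear, h2⟩ := exists_gridVal_near hδ hv hi
    (formulaVal x hyperfiniteTr (extendTuple a)) fun j hj => abs_formulaVal_hyperfinite_le ha hj
  have h9 : gridVal δ v x y.2.2 e ≤ 9 := by
    have : (gridVal δ v x y.2.2 e : ℝ) ≤ 9 := by linarith [(abs_le.1 h2).1]
    exact_mod_cast this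
  obtain ⟨c, -, hin, hclose⟩ := (isCloseToNet_iff (Nat.succ_pos y.1)).1 ((hg e he).2 h9)
  refine ⟨fun i => gridMat (y.1 + 1) (4 * (y.1 + 1) * (y.2.1 + 1)) c i, fun i =>
    norm_le_one_of_inNet (Nat.succ_pos _) (Nat.succ_pos _) hin i.2, ?_⟩
  set b := gridMat (y.1 + 1) (4 * (y.1 + 1) * (y.2.1 + 1)) c
  have hcoord : ∀ r < len, |formulaVal x hyperfiniteTr (extendTuple a) r -
      formulaVal x (ntr (y.1 + 1)) b r| ≤ 2 / K := by
    intro r hr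
    have h3 := hnear r hr
    have h4 := hclose r hr
    have h5 : (1 : ℝ) / g ≤ 1 / K := by
      apply one_div_le_one_div_of_le hKpos
      have : K ≤ g := by rw [hgdef, gridPrec]; exact Nat.le_add_left _ _
      exact_mod_cast this
    have h6 := abs_sub_le (formulaVal x hyperfiniteTr (extendTuple a) r)
      (ratVal (gridCoord g e r) : ℝ) (formulaVal x (ntr (y.1 + 1)) b r)
    rw [abs_sub_comm] at h3
    have h8 : (2 : ℝ) / K = 1 / K + 1 / K := by ring
    have h4' : |(ratVal (gridCoord g e r) : ℝ) - formulaVal x (ntr (y.1 + 1)) b r| ≤ 1 / K := h4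
    linarith
  have hφ : ∀ φ ∈ momentFormulas x.1 x.2.1,
      |evalBasic hyperfiniteTr φ (extendTuple a) - evalBasic (ntr (y.1 + 1)) φ b| ≤ 2 / K := by
    intro φ hφ
    obtain ⟨r, hr, rfl⟩ := List.getElem_of_mem hφ
    have := hcoord r hr
    rwa [formulaVal, formulaVal, List.getD_eq_getElem _ _ hr] at this
  rw [dist_comm]
  refine (dist_moments_le (ε := 4 / K) (by positivity) fun w hw hd => ?_).trans (le_of_eq ?_)
  · rw [evalWord_congr (a := extendTuple fun i : Fin x.1 => b i) (b := b)
      fun l hl => extendTuple_of_lt b (hw l hl)]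
    have hre := hφ (false, [(((1, 0), (0, 0)), w)]) (mem_momentFormulas.2 ⟨w, ⟨hw, hd⟩, _, rfl⟩)
    have him := hφ (true, [(((1, 0), (0, 0)), w)]) (mem_momentFormulas.2 ⟨w, ⟨hw, hd⟩, _, rfl⟩)
    simp only [evalBasic, evalPoly_word, if_true, Bool.false_eq_true, if_false] at hre him
    refine (Complex.norm_le_abs_re_add_abs_im _).trans ?_
    rw [Complex.sub_re, Complex.sub_im]
    have h8 : (4 : ℝ) / K = 2 / K + 2 / K := by ring
    rw [h8]
    exact add_le_add hre him
  · rw [hK, closePrec]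
    push_cast
    field_simp

end Certificates

/-! ### Existence of certificates -/

section Completeness

open scoped Matrix.Norms.L2Operator

variable {C : Connectives} {δ : (ℕ × ℕ) × ℕ → ℕ} {v : (ℕ × List RatCode) × ℕ → RatCode}

/-- The vector of the values of the moment formulas. -/
noncomputable def formulaVec {A : Type} [Ring A] [StarRing A] [Algebra ℂ A] (x : ℕ × ℕ × ℕ)
    (τ : A → ℂ) (a : ℕ → A) : Fin (momentFormulas x.1 x.2.1).length → ℝ :=
  fun r => formulaVal x τ a r

/-- The vectors of the values of the moment formulas at the points of the net. -/
def netVecs (x : ℕ × ℕ × ℕ) (p M : ℕ) : Set (Fin (momentFormulas x.1 x.2.1).length → ℝ) :=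
  {t | ∃ c < netBound x.1 p M, inNet x.1 p M c = true ∧
    formulaVec x (ntr p) (gridMat p (4 * p * M) c) = t}

lemma netVecs_nonempty (x : ℕ × ℕ × ℕ) {p M : ℕ} (hp : 0 < p) (hM : 0 < M) :
    (netVecs x p M).Nonempty := by
  obtain ⟨c, hc, hin, -⟩ := exists_inNet (n := x.1) hp hM (fun _ => 0) fun _ _ => by simp
  exact ⟨_, c, hc, hin, rfl⟩

/-- The net in the matrices of a suitable size is dense in the moments of `𝓡`. -/
lemma exists_infDist_netVecs_le (x : ℕ × ℕ × ℕ) : ∃ p M : ℕ, 0 < p ∧ 0 < M ∧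
    ∀ a : Fin x.1 → hyperfinite.toStarSubalgebra, (∀ i, ‖a i‖ ≤ 1) →
      Metric.infDist (formulaVec x hyperfiniteTr (extendTuple a)) (netVecs x p M) ≤
        1 / (8 * closePrec x.1 x.2.1 x.2.2) := by
  set K := closePrec x.1 x.2.1 x.2.2 with hK
  have hK0 : 0 < K := closePrec_pos _ _ _
  have hKpos : (0 : ℝ) < K := by exact_mod_cast hK0
  -- Half of the tolerance 1/(8K) is spent on passing to matrices; the parameter `32 * (x.2.1 + 1) *
  -- K` of the net keeps the other half for rounding words of length at most `x.2.1`.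
  obtain ⟨m, hm⟩ := exists_uniform_approx x.1 x.2.1 (ε := 1 / (16 * K)) (by positivity)
  have hM : 0 < 32 * (x.2.1 + 1) * K := by positivity
  refine ⟨2 ^ m, 32 * (x.2.1 + 1) * K, by positivity, hM, fun a ha => ?_⟩
  obtain ⟨b, hb, hab⟩ := hm a ha
  obtain ⟨c, hc, hin, hcw⟩ := exists_net_near (p := 2 ^ m) (by positivity) hM b hb
  have hmem : formulaVec x (ntr (2 ^ m)) (gridMat (2 ^ m)
      (4 * 2 ^ m * (32 * (x.2.1 + 1) * K)) c) ∈ netVecs x (2 ^ m) (32 * (x.2.1 + 1) * K) :=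
    ⟨c, hc, hin, rfl⟩
  refine (Metric.infDist_le_dist_of_mem hmem).trans
    ((dist_pi_le_iff (by positivity)).2 fun r => ?_)
  obtain ⟨w, ⟨hw, hd⟩, s, hs⟩ := mem_momentFormulas.1 (getD_mem r.2 (false, []))
  have h1 := norm_sub_le_of_dist_moments_le hab hw hd
  have h2 := hcw w hw
  have h3 : (w.length : ℝ) * (2 / ((32 * (x.2.1 + 1) * K : ℕ) : ℝ)) ≤ 1 / (16 * K) := by
    have h4 : (w.length : ℝ) ≤ x.2.1 + 1 := by
      have : (w.length : ℝ) ≤ x.2.1 := by exact_mod_cast hd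
      linarith
    calc (w.length : ℝ) * (2 / ((32 * (x.2.1 + 1) * K : ℕ) : ℝ))
        ≤ ((x.2.1 : ℝ) + 1) * (2 / ((32 * (x.2.1 + 1) * K : ℕ) : ℝ)) := by gcongr
      _ = 1 / (16 * K) := by push_cast; field_simp; norm_num
  have h5 := (norm_sub_le_norm_sub_add_norm_sub (hyperfiniteTr (evalWord (extendTuple a) w))
    (ntr (2 ^ m) (evalWord (extendTuple b) w)) (ntr (2 ^ m)
      (evalWord (gridMat (2 ^ m) (4 * 2 ^ m * (32 * (x.2.1 + 1) * K)) c) w))).trans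
    (add_le_add h1 (h2.trans h3))
  have e : (1 : ℝ) / (16 * K) + 1 / (16 * K) = 1 / (8 * K) := by field_simp; norm_num
  rw [e] at h5
  rw [Real.dist_eq, formulaVec, formulaVec, formulaVal, formulaVal, hs]
  cases s
  · simp only [evalBasic, evalPoly_word, Bool.false_eq_true, if_false]
    rw [← Complex.sub_re]
    exact (Complex.abs_re_le_norm _).trans h5
  · simp only [evalBasic, evalPoly_word, if_true]
    rw [← Complex.sub_im]
    exact (Complex.abs_im_le_norm _).trans h5

/-- There is a valid certificate whose sentence has a small value. -/
lemma exists_certificate (δ : (ℕ × ℕ) × ℕ → ℕ) (hv : IsValues C v) (x : ℕ × ℕ × ℕ) :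
    ∃ y, isCertificate δ v C.arity x y = true ∧
      sentenceVal C hyperfinite hyperfiniteTr (certSentence x y) ≤ 6 := by
  obtain ⟨p, M, hp, hM, hnet⟩ := exists_infDist_netVecs_le x
  obtain ⟨p, rfl⟩ := Nat.exists_eq_succ_of_ne_zero hp.ne'
  obtain ⟨M, rfl⟩ := Nat.exists_eq_succ_of_ne_zero hM.ne'
  set K := closePrec x.1 x.2.1 x.2.2 with hK
  have hKpos : (0 : ℝ) < K := by exact_mod_cast closePrec_pos _ _ _
  set T := netVecs x (p + 1) (M + 1) with hT
  -- The ideal connective, to be matched up to 1 on the cube and evaluated up to 1. Grid values are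
  -- then at least 4 - 2 = 2; a grid value at most 9 gives 8K·dist < 7, so the distance is below
  -- 1/K. On the moments of 𝓡 the distance is at most 1/(8K), so the sentence has value at most 4 +
  -- 1 + 1 = 6.
  have hf : Continuous fun z => 4 + 8 * (K : ℝ) * Metric.infDist z T := by fun_prop
  obtain ⟨i, hi, hfn⟩ := C.dense _ _ hf (Metric.closedBall 0 1) (isCompact_closedBall _ _) 1
    one_pos
  have hnear : ∀ Z : ℕ → ℝ, (∀ r < (momentFormulas x.1 x.2.1).length, |Z r| ≤ 1) →
      |C.fn i (fun j => Z j) - (4 + 8 * (K : ℝ) * Metric.infDist (fun r : Fin _ => Z r) T)| < 1 :=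
    fun Z hZ => hfn (fun r => Z r) <| by
      rw [mem_closedBall_zero_iff]
      exact (pi_norm_le_iff_of_nonneg zero_le_one).2 fun r => hZ r r.2
  refine ⟨(p, M, i), isCertificate_iff.2 ⟨hi, fun e _ => ?_⟩, ?_⟩
  · set q : ℕ → ℝ := fun r => (ratVal (gridCoord (gridPrec δ x i) e r) : ℝ)
    have h1 := abs_lt.1 (hnear q fun r _ => abs_gridCoord_le (gridPrec_pos δ x i) e r)
    have h2 := abs_le.1 (abs_fn_sub_gridVal_le (δ := δ) (x := x) hv hi e)
    have h3 : 0 ≤ 8 * (K : ℝ) * Metric.infDist (fun r : Fin _ => q r) T :=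
      mul_nonneg (by positivity) Metric.infDist_nonneg
    refine ⟨?_, fun h9 => (isCloseToNet_iff (Nat.succ_pos p)).2 ?_⟩
    · have : (2 : ℝ) ≤ gridVal δ v x i e := by linarith [h1.1, h2.2]
      exact_mod_cast this
    · have h9' : (gridVal δ v x i e : ℝ) ≤ 9 := by exact_mod_cast h9
      have h4 : Metric.infDist (fun r : Fin _ => q r) T < 1 / K := by
        rw [lt_div_iff₀ hKpos]
        linarith [h1.1, h2.2]
      obtain ⟨_, ⟨c, hc, hin, rfl⟩, ht⟩ :=
        (Metric.infDist_lt_iff (netVecs_nonempty x (Nat.succ_pos p) (Nat.succ_pos M))).1 h4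
      refine ⟨c, hc, hin, fun r hr => ?_⟩
      exact (dist_le_pi_dist (fun r : Fin _ => q r) (formulaVec x _ _)
        (⟨r, hr⟩ : Fin (momentFormulas x.1 x.2.1).length)).trans ht.le
  · refine csSup_le ⟨_, fun _ => 0, fun _ => by simp, rfl⟩ ?_
    rintro _ ⟨a, ha, rfl⟩
    refine (evalMatrix_certSentence (y := (p, M, i)) hi a).trans_le ?_
    have h1 := abs_lt.1 (hnear (formulaVal x hyperfiniteTr (extendTuple a))
      fun r hr => abs_formulaVal_hyperfinite_le ha hr)
    have h2 : 8 * (K : ℝ) * Metric.infDist (fun r : Fin (momentFormulas x.1 x.2.1).length =>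
        formulaVal x hyperfiniteTr (extendTuple a) r) T ≤ 1 := by
      have h3 := hnet a ha
      rw [le_div_iff₀ (by positivity)] at h3
      refine le_trans (le_of_eq ?_) h3
      rw [mul_comm]
      rfl
    change C.fn i (fun j => formulaVal x hyperfiniteTr (extendTuple a) j) ≤ 6
    linarith [h1.2]

end Completeness

/-! ### The search for a certificate -/

section Search

/-- The computability of the universal theory yields the function `F`. -/
theorem momentApprox_of_universalTheoryComputable {C : Connectives}
    (h : UniversalTheoryComputable C hyperfinite hyperfiniteTr) :
    ∃ F : ℕ × ℕ × ℕ → ℕ, Computable F ∧ ∀ n d k : ℕ, 0 < k → 0 < F (n, d, k) ∧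
      ∀ s ∈ momentSet n d, ∃ t ∈ matrixMomentSet n d (F (n, d, k)), dist t s < 1 / (k : ℝ) := by
  obtain ⟨f, hf, hspec⟩ := h
  obtain ⟨v, hvc, hv⟩ := C.computable_values
  obtain ⟨δ, hδc, hδ⟩ := C.computable_modulus
  -- Precision 1 is enough: the test that the upper endpoint is at most 7 accepts every value up to
  -- 6 and accepts no value above 7.
  have hspec' : ∀ x y, isCertificate δ v C.arity x y = true →
      ∃ ab ∈ f (certSentence x y, (1, 0)),
        (sentenceVal C hyperfinite hyperfiniteTr (certSentence x y) ≤ 6 → ratVal ab.2 ≤ 7) ∧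
        (ratVal ab.2 ≤ 7 → sentenceVal C hyperfinite hyperfiniteTr (certSentence x y) ≤ 7) := by
    intro x y hxy
    have h1 : ratVal (1, 0) = 1 := by simp [ratVal]
    obtain ⟨ab, hab, -, hlt, ha, hb⟩ := hspec _ (1, 0)
      (isUniversalSentence_certSentence hδ hv hxy) (by rw [h1]; exact one_pos)
    refine ⟨ab, hab, fun h6 => ?_, fun h7 => ?_⟩
    · have h2 : (ratVal ab.2 : ℝ) - ratVal ab.1 < 1 := by rw [h1] at hlt; exact_mod_cast hlt
      have h3 : (ratVal ab.2 : ℝ) ≤ 7 := by linarith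
      exact_mod_cast h3
    · have h3 : (ratVal ab.2 : ℝ) ≤ 7 := by exact_mod_cast h7
      linarith
  obtain ⟨dec, hdec, hsurj⟩ : ∃ dec : ℕ → ℕ × ℕ × ℕ, Computable dec ∧ dec.Surjective :=
    ⟨_, Computable.ofNat _, fun y => ⟨_, Denumerable.ofNat_encode y⟩⟩
  -- The certificate is tested before `f` is run, because `f` may diverge on codes that are not
  -- universal sentences and unbounded search needs every trial to halt.
  let g : ℕ × ℕ × ℕ → ℕ →. Bool := fun x s =>
    cond (isCertificate δ v C.arity x (dec s))
      ((f (certSentence x (dec s), (1, 0))).map fun ab => RatCode.le ab.2 (RatCode.ofNat 7))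
      (Part.some false)
  have hg : Partrec₂ g := by
    have hc : Computable fun a : (ℕ × ℕ × ℕ) × ℕ =>
        isCertificate δ v C.arity a.1 (dec a.2) :=
      (computable_isCertificate hδc hvc C.computable_arity).comp
        (g := fun a : (ℕ × ℕ × ℕ) × ℕ => (a.1, dec a.2))
        (Computable.fst.pair (hdec.comp Computable.snd))
    have hs : Computable fun a : (ℕ × ℕ × ℕ) × ℕ =>
        ((certSentence a.1 (dec a.2), (1, 0)) : SentenceCode × RatCode) :=
      (primrec_certSentence.to_comp.comp (g := fun a : (ℕ × ℕ × ℕ) × ℕ => (a.1, dec a.2))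
        (Computable.fst.pair (hdec.comp Computable.snd))).pair (Computable.const (1, 0))
    have hle : Computable₂ fun (_ : (ℕ × ℕ × ℕ) × ℕ) (ab : RatCode × RatCode) =>
        RatCode.le ab.2 (RatCode.ofNat 7) :=
      computable_ratCode_le (Computable.snd.comp Computable.snd) (Computable.const _)
    exact Partrec.cond hc ((hf.comp hs).map hle) (Computable.const false).partrec
  have hg_dom : ∀ x s, (g x s).Dom := by
    intro x s
    by_cases hc : isCertificate δ v C.arity x (dec s) = true
    · obtain ⟨ab, hab, -⟩ := hspec' x (dec s) hc
      simp only [g, hc, cond_true]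
      exact Part.dom_iff_mem.2 ⟨_, Part.mem_map _ hab⟩
    · rw [Bool.not_eq_true] at hc
      simp only [g, hc, cond_false]
      trivial
  have hdom : ∀ x, (Nat.rfind (g x)).Dom := by
    intro x
    obtain ⟨y, hy, h6⟩ := exists_certificate δ hv x
    obtain ⟨s, he⟩ := hsurj y
    refine Nat.rfind_dom.2 ⟨s, ?_, fun _ => hg_dom _ _⟩
    obtain ⟨ab, hab, h7, -⟩ := hspec' x y hy
    simp only [g, he, hy, cond_true]
    have := Part.mem_map (fun ab : RatCode × RatCode => RatCode.le ab.2 (RatCode.ofNat 7)) hab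
    rwa [(RatCode.le_iff ab.2 (RatCode.ofNat 7)).2
      (by rw [ratVal_ofNat]; exact_mod_cast h7 h6)] at this
  have hcomp : Computable fun x => (Nat.rfind (g x)).get (hdom x) :=
    (Partrec.rfind hg).of_eq_tot fun x => Part.get_mem _
  -- A certificate stores the matrix size minus one, so the size is positive automatically.
  refine ⟨fun x => (dec ((Nat.rfind (g x)).get (hdom x))).1 + 1,
    Computable.succ.comp (Computable.fst.comp (hdec.comp hcomp)), fun n d k hk =>
      ⟨Nat.succ_pos _, ?_⟩⟩
  rintro _ ⟨a, ha, rfl⟩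
  have hs := Nat.rfind_spec (Part.get_mem (hdom (n, d, k)))
  set y := dec ((Nat.rfind (g (n, d, k))).get (hdom (n, d, k))) with hy
  by_cases hc : isCertificate δ v C.arity (n, d, k) y = true
  · obtain ⟨ab, hab, -, h7⟩ := hspec' _ _ hc
    simp only [g, ← hy, hc, cond_true] at hs
    obtain ⟨ab', hab', hle⟩ := (Part.mem_map_iff _).1 hs
    obtain rfl := Part.mem_unique hab hab'
    rw [RatCode.le_iff, ratVal_ofNat] at hle
    obtain ⟨b, hb, hdist⟩ := exists_of_certificate (x := (n, d, k)) hδ hv hc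
      (h7 (by exact_mod_cast hle)) ha
    refine ⟨_, ⟨b, hb, rfl⟩, hdist.trans_lt ?_⟩
    exact one_div_lt_one_div_of_lt (by exact_mod_cast hk) (lt_add_one _)
  · rw [Bool.not_eq_true] at hc
    simp only [g, ← hy, hc, cond_false, Part.mem_some_iff] at hs
    exact absurd hs (by simp)

end Search

end MomentApprox

theorem mainTheorem8 (C : MomentApprox.Connectives) :
    MomentApprox.UniversalTheoryComputable C MomentApprox.hyperfinite
        MomentApprox.hyperfiniteTr ↔
      ∃ F : ℕ × ℕ × ℕ → ℕ, Computable F ∧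
        ∀ n d k : ℕ, 0 < n → 0 < d → 0 < k →
          0 < F (n, d, k) ∧
          ∀ s ∈ MomentApprox.momentSet n d,
            ∃ t ∈ MomentApprox.matrixMomentSet n d (F (n, d, k)),
              dist t s < 1 / (k : ℝ) := by
  refine ⟨fun h => ?_, fun ⟨F, hF, h⟩ =>
    MomentApprox.universalTheoryComputable_of_momentApprox C hF h⟩
  obtain ⟨F, hF, h'⟩ := MomentApprox.momentApprox_of_universalTheoryComputable h
  exact ⟨F, hF, fun n d k _ _ hk => h' n d k hk⟩
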